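/- Let $n\ge 1$, $m\ge 0$ be integers, let $p>1$ satisfy $p>\frac{2n}{n+2}$, and let $\lambda,\Lambda>0$. For $x_0\in\mathbb R^n$, $t_0\in\mathbb R$ and $R,\rho>0$ write $Q_{R,\rho}=Q_{R,\rho}(x_0,t_0)=B_R(x_0)\times[t_0-\rho,t_0]$, let $|Q_{R,\rho}|$ be its Lebesgue measure, and let $C^1_0(Q_{R,\rho})$ be the set of $C^1$ functions with compact support in $B_R(x_0)\times(t_0-\rho,t_0)$. Let $V_p(Q_{R,\rho})$ be the space of measurable $u:Q_{R,\rho}\to\mathbb R^m$ with a weak spatial gradient $Du\in L^p(Q_{R,\rho})$ and $\operatorname{ess\,sup}_{t\in[t_0-\rho,t_0]}\|u(\cdot,t)\|_{L^2(B_R(x_0))}<\infty$. A map $A:\mathbb R^m\times\mathbb R^{nm}\to\mathbb R^{nm}$ satisfies condition E) with constants $\lambda,\Lambda$ if for all $w\in\mathbb R^m$ and $\zeta,\eta\in\mathbb R^{nm}$ $$\langle A(w,\zeta),\zeta\rangle\ge\lambda|\zeta|^p,\qquad |\langle A(w,\zeta),\eta\rangle|\le\Lambda|\zeta|^{p-1}|\eta|.$$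 For $\delta\ge0$, a function $u\in V_p(Q)$ on a cylinder $Q$ is a $\delta$-approximate weak solution of $u_t=\operatorname{div}A(u,Du)$ in $Q$ if $A(u,Du)$ is measurable on $Q$ and, for every cylinder $Q'=Q_{r,\sigma}(y,s)\subset Q$ and every $\phi\in C^1_0(Q';\mathbb R^m)$, $$\left|\int_{Q'}\bigl(-u\cdot\phi_t+\langle A(u,Du),D\phi\rangle\bigr)\,dz\right|\le\delta\,\|Du\|_{L^p(Q')}^{p-1}\,\|D\phi\|_{L^p(Q')}.$$ Then there are $\delta_0>0$ and $\varepsilon>0$, depending only on $n,m,p,\lambda,\Lambda$, such that for every $M$ there is a constant $C$, depending only on $n,m,p,\lambda,\Lambda,M$, with the following property. Let $A$ satisfy E) with constants $\lambda,\Lambda$, let $0\le\delta\le\delta_0$ and $0<R\le1$, let $u$ be a $\delta$-approximate weak solution of $u_t=\operatorname{div}A(u,Du)$ in $Q_{R,R^p}=Q_{R,R^p}(x_0,t_0)$, and suppose that $$R^p\,\frac1{|Q_{R,R^p}|}\int_{Q_{R,R^p}}|Du|^p\,dz\le M$$ and, only in the case $p<2$, also that $$\frac1{R^p}\,\frac1{|Q_{R,R^p}|}\int_{Q_{R,R^p}}|u-u_R|^2\,dz\le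 M,\qquad u_R=\frac1{|Q_{R,R^p}|}\int_{Q_{R,R^p}}u\,dz.$$ Then $|Du|^{p+\varepsilon}$ is integrable on $Q_{\frac12R,\frac12R^p}(x_0,t_0)$ and $$R^{p+\varepsilon}\,\frac1{|Q_{\frac12R,\frac12R^p}|}\int_{Q_{\frac12R,\frac12R^p}}|Du|^{p+\varepsilon}\,dz\le C.$$ -/

import Mathlib

open MeasureTheory Set

noncomputable section

/-- Euclidean `k`-space. -/
abbrev RVec (k : ℕ) : Type := EuclideanSpace ℝ (Fin k)

/-- Gradients of `ℝ^m`-valued functions of `n` space variables, with the Euclidean norm of `ℝ^{nm}`;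
the entry `(i, j)` stands for `∂u_i / ∂x_j`. -/
abbrev RGrad (m n : ℕ) : Type := EuclideanSpace ℝ (Fin m × Fin n)

/-- The parabolic cylinder `Q_{R,ρ}(x₀,t₀) = B_R(x₀) × [t₀ - ρ, t₀]`. -/
def parCyl {n : ℕ} (x₀ : RVec n) (t₀ R ρ : ℝ) : Set (RVec n × ℝ) :=
  Metric.ball x₀ R ×ˢ Icc (t₀ - ρ) t₀

/-- The open cylinder `B_R(x₀) × (t₀ - ρ, t₀)`. -/
def parCylInt {n : ℕ} (x₀ : RVec n) (t₀ R ρ : ℝ) : Set (RVec n × ℝ) :=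
  Metric.ball x₀ R ×ˢ Ioo (t₀ - ρ) t₀

/-- Classical time derivative `φ_t`. -/
def timeDeriv {n : ℕ} {F : Type*} [NormedAddCommGroup F] [NormedSpace ℝ F]
    (φ : RVec n × ℝ → F) (z : RVec n × ℝ) : F :=
  fderiv ℝ φ z (0, 1)

/-- Classical space derivative `∂φ/∂x_j`. -/
def spaceDeriv {n : ℕ} {F : Type*} [NormedAddCommGroup F] [NormedSpace ℝ F]
    (φ : RVec n × ℝ → F) (j : Fin n) (z : RVec n × ℝ) : F :=
  fderiv ℝ φ z (EuclideanSpace.single j 1, 0)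

/-- Classical spatial gradient `Dφ` of a vector valued function. -/
def spaceGrad {m n : ℕ} (φ : RVec n × ℝ → RVec m) (z : RVec n × ℝ) : RGrad m n :=
  WithLp.toLp 2 fun ij => spaceDeriv φ ij.2 z ij.1

/-- `C¹₀(Q_{R,ρ}(x₀,t₀))`: `C¹` functions with compact support in the open cylinder. -/
structure IsTestFun {n : ℕ} {F : Type*} [NormedAddCommGroup F] [NormedSpace ℝ F]
    (x₀ : RVec n) (t₀ R ρ : ℝ) (φ : RVec n × ℝ → F) : Prop where
  contDiff : ContDiff ℝ 1 φ
  compactSupport : HasCompactSupport φ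
  support_subset : tsupport φ ⊆ parCylInt x₀ t₀ R ρ

/-- `u ∈ V_p(Q_{R,ρ}(x₀,t₀); ℝ^m)` and `Du` is its weak spatial gradient there: the (essential)
supremum over `t` of `‖u(·,t)‖_{L²(B_R(x₀))}` is finite, and `Du ∈ L^p`. -/
structure MemVp {m n : ℕ} (p : ℝ) (x₀ : RVec n) (t₀ R ρ : ℝ)
    (u : RVec n × ℝ → RVec m) (Du : RVec n × ℝ → RGrad m n) : Prop where
  aestronglyMeasurable : AEStronglyMeasurable u (volume.restrict (parCyl x₀ t₀ R ρ))
  sup_sq : ∃ K : NNReal, ∀ᵐ t ∂(volume.restrict (Icc (t₀ - ρ) t₀)),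
    ∫⁻ x in Metric.ball x₀ R, ‖u (x, t)‖ₑ ^ 2 ≤ K
  memLp_grad : MemLp Du (ENNReal.ofReal p) (volume.restrict (parCyl x₀ t₀ R ρ))
  weak_grad : ∀ ψ : RVec n × ℝ → ℝ, IsTestFun x₀ t₀ R ρ ψ → ∀ (i : Fin m) (j : Fin n),
    ∫ z in parCyl x₀ t₀ R ρ, u z i * spaceDeriv ψ j z
      = - ∫ z in parCyl x₀ t₀ R ρ, Du z (i, j) * ψ z

/-- The ellipticity condition E): `⟨A(u,ζ),ζ⟩ ≥ lam |ζ|^p` and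
`|⟨A(u,ζ),η⟩| ≤ Lam |ζ|^{p-1} |η|` for all `u`, `ζ`, `η`. -/
structure EllipticE {m n : ℕ} (p lam Lam : ℝ) (A : RVec m → RGrad m n → RGrad m n) : Prop where
  lower : ∀ (w : RVec m) (ζ : RGrad m n), lam * ‖ζ‖ ^ p ≤ inner ℝ (A w ζ) ζ
  upper : ∀ (w : RVec m) (ζ η : RGrad m n),
    |inner ℝ (A w ζ) η| ≤ Lam * ‖ζ‖ ^ (p - 1) * ‖η‖

/-- `u ∈ V_p` is a `δ`-approximate weak solution of `u_t = div A(u,Du)` in `Q = Q_{R,ρ}(x₀,t₀)`: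
for every parabolic cylinder `Q' ⊆ Q` and every `φ ∈ C¹₀(Q')`,
`|∫_{Q'} -u·φ_t + ⟨A(u,Du),Dφ⟩| ≤ δ ‖Du‖_{L^p(Q')}^{p-1} ‖Dφ‖_{L^p(Q')}`. -/
structure IsApproxWeakSol {m n : ℕ} (p δ : ℝ) (A : RVec m → RGrad m n → RGrad m n)
    (x₀ : RVec n) (t₀ R ρ : ℝ)
    (u : RVec n × ℝ → RVec m) (Du : RVec n × ℝ → RGrad m n) : Prop where
  memVp : MemVp p x₀ t₀ R ρ u Du
  flux_measurable :
    AEStronglyMeasurable (fun z => A (u z) (Du z)) (volume.restrict (parCyl x₀ t₀ R ρ))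
  approx : ∀ (y : RVec n) (s r σ : ℝ), 0 < r → 0 < σ →
    parCyl y s r σ ⊆ parCyl x₀ t₀ R ρ →
    ∀ φ : RVec n × ℝ → RVec m, IsTestFun y s r σ φ →
      |∫ z in parCyl y s r σ,
          (- inner ℝ (u z) (timeDeriv φ z) + inner ℝ (A (u z) (Du z)) (spaceGrad φ z))|
        ≤ δ * ((∫ z in parCyl y s r σ, ‖Du z‖ ^ p) ^ (1 / p)) ^ (p - 1)
            * (∫ z in parCyl y s r σ, ‖spaceGrad φ z‖ ^ p) ^ (1 / p)

end

noncomputable section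

open scoped ENNReal NNReal

/-! The proof is Gehring's argument, run on cylinders whose shape depends on the size of the
gradient. For p ≠ 2 the system is not homogeneous in u, so space and time have to be scaled in a way
that depends on the solution. At a level l the right cylinders are B_r × [b - l^{2-p} r², b]:
dividing u by l r and mapping such a cylinder to B_1 × [-1, 0] gives a system with the same λ, Λ and
δ, whose gradient is the old one divided by l (`EllipticE.rescale`, `IsApproxWeakSol.rescale`).

At unit scale the analytic heart is `exists_reverseHolder_unit`: for a suitable q < p, if ∫|Du|^p is
bounded on B_2 × [-4, 0] and ∫|Du|^q is small there, then the mean of |Du|^p over B_1 × [-1, 0] is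
at most one. To see it, mollify u and the flux G = A(u, Du), and test with χ ψ³ (w - a), where w is
the mollified u and a is a weighted spatial mean of w at one fixed time. Testing with functions of t
times a fixed function of x shows that the spatial means hardly move in time, because G is small in
L¹ (its size is at most Λ|Du|^{p-1} and p - 1 ≤ q). The energy inequality bounds the slices ∫ψ³|w -
a|² by 1 + W, with W = ∫(ψ|w - a|)^P and P = max(p, 2). Sobolev–Poincaré on slices, interpolated
with L², bounds W by (1 + sup of slices) ∫|Dw|^q plus a power of the drift of the means. As ∫|Dw|^q
is small, W is absorbed and is itself small, and the energy inequality then makes ∫χψ³⟨G, Dw⟩ small.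
This quantity survives the removal of the mollification and dominates λ∫|Du|^p on the smaller
cylinder. Compactness is never used, so u needs no regularity in time, and the error δ behaves like
one more small term.

Undoing the scaling gives `IntrinsicRevHolder`: if the mean of |Du|^p exceeds l^p on an intrinsic
cylinder but not on its enlargement, then |Du|^q has mass at least c₀ l^q times the volume of the
cylinder on the doubled cylinder. A Vitali covering by stopped cylinders turns this into an estimate
of ∫|Du|^p over {|Du| > K l} by l^{p-q} ∫|Du|^q over {|Du| > c' l} in a larger cylinder
(`level_estimate`). Integrating it against l^{ε-1} produces |Du|^{p+ε} on both sides, with a factor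
ε on the right that allows absorption after an iteration over radii
(`lintegral_mul_truncated_rpow_le`, `iteration_absorb`).

The condition p > 2n/(n+2) enters twice: it makes room for q < p with n max(p, 2)/(n+2) ≤ q, which
the slice interpolation needs, and it ensures that for large l every cylinder of the starting size
has mean at most l^p, although for p < 2 the admissible radii shrink with l. -/

/-! ### Parabolic cylinders and a Vitali covering. -/

theorem measurableSet_parCyl {n : ℕ} (y : RVec n) (b r ρ : ℝ) :
    MeasurableSet (parCyl y b r ρ) :=
  measurableSet_ball.prod measurableSet_Icc

theorem mem_parCyl {n : ℕ} {y : RVec n} {b r ρ : ℝ} {z : RVec n × ℝ} :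
    z ∈ parCyl y b r ρ ↔ dist z.1 y < r ∧ b - ρ ≤ z.2 ∧ z.2 ≤ b := by
  simp [parCyl, mem_prod]

theorem parCyl_subset {n : ℕ} {y y' : RVec n} {b b' r r' ρ ρ' : ℝ}
    (h1 : dist y y' + r ≤ r') (h2 : b' - ρ' ≤ b - ρ) (h3 : b ≤ b') :
    parCyl y b r ρ ⊆ parCyl y' b' r' ρ' := by
  intro z hz
  rw [mem_parCyl] at hz ⊢
  exact ⟨by linarith [dist_triangle z.1 y y', hz.1], by linarith [hz.2.1], by linarith [hz.2.2]⟩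

theorem volume_parCyl {n : ℕ} (y : RVec n) (b : ℝ) {r : ℝ} (hr : 0 < r) (ρ : ℝ) :
    volume (parCyl y b r ρ)
      = ENNReal.ofReal (r ^ n * ρ) * volume (Metric.ball (0 : RVec n) 1) := by
  rw [parCyl, Measure.volume_eq_prod, Measure.prod_prod, Measure.addHaar_ball_of_pos _ _ hr,
    Real.volume_Icc, finrank_euclideanSpace_fin, ENNReal.ofReal_mul (by positivity)]
  rw [show b - (b - ρ) = ρ by ring]
  ring

theorem volume_parCyl_ne_top {n : ℕ} (y : RVec n) (b r ρ : ℝ) :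
    volume (parCyl y b r ρ) ≠ ⊤ := by
  rw [parCyl, Measure.volume_eq_prod, Measure.prod_prod]
  exact ENNReal.mul_ne_top Metric.isBounded_ball.measure_lt_top.ne
    (by simp [Real.volume_Icc])

theorem volume_parCyl_scale {n : ℕ} (y y' : RVec n) (b b' σ : ℝ) {k r : ℝ} (hk : 0 < k)
    (hr : 0 < r) :
    volume (parCyl y b (k * r) (σ * (k * r) ^ 2))
      = ENNReal.ofReal (k ^ (n + 2)) * volume (parCyl y' b' r (σ * r ^ 2)) := by
  rw [volume_parCyl _ _ (by positivity), volume_parCyl _ _ hr,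
    ← mul_assoc (ENNReal.ofReal (k ^ (n + 2))), ← ENNReal.ofReal_mul (by positivity)]
  congr 2
  ring

theorem volume_parCyl_pos {n : ℕ} (y : RVec n) (b : ℝ) {r ρ : ℝ} (hr : 0 < r) (hρ : 0 < ρ) :
    0 < volume (parCyl y b r ρ) := by
  rw [volume_parCyl _ _ hr]
  exact ENNReal.mul_pos (by simp; positivity) (Metric.measure_ball_pos _ _ one_pos).ne'

/-- Vitali covering lemma for backward parabolic cylinders lying below the time `0`. -/
theorem exists_disjoint_parCyl {n : ℕ} {ι : Type*} (t : Set ι) (y : ι → RVec n) (b r : ι → ℝ)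
    {σ : ℝ} (hσ : 0 < σ) (hr : ∀ i ∈ t, 0 < r i) (R : ℝ) (hR : ∀ i ∈ t, r i ≤ R)
    (hb : ∀ i ∈ t, b i ≤ 0) :
    ∃ u ⊆ t, u.Countable ∧
      u.PairwiseDisjoint (fun i => parCyl (y i) (b i) (r i) (σ * r i ^ 2)) ∧
      ∀ i ∈ t, ∃ j ∈ u, parCyl (y i) (b i) (r i) (σ * r i ^ 2) ⊆
        parCyl (y j) (min (b j + 4 * (σ * r j ^ 2)) 0) (5 * r j) (σ * (5 * r j) ^ 2) := by
  have hne : ∀ a ∈ t, (parCyl (y a) (b a) (r a) (σ * r a ^ 2)).Nonempty := fun a ha => by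
    have := hr a ha
    exact ⟨(y a, b a), mem_parCyl.2 ⟨by simpa, by simp; positivity, le_rfl⟩⟩
  obtain ⟨u, hut, hdis, hcov⟩ := Vitali.exists_disjoint_subfamily_covering_enlargement
    (fun i => parCyl (y i) (b i) (r i) (σ * r i ^ 2)) t r 2 one_lt_two
    (fun a ha => (hr a ha).le) R hR hne
  refine ⟨u, hut, ?_, hdis, fun i hi => ?_⟩
  · refine hdis.countable_of_nonempty_interior fun i hi => ?_
    have := hr i (hut hi)
    refine ⟨(y i, b i - (σ * r i ^ 2) / 2), ?_⟩
    rw [parCyl, interior_prod_eq, interior_Icc, Metric.isOpen_ball.interior_eq]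
    have h2 : 0 < σ * r i ^ 2 := by positivity
    exact ⟨by simpa, ⟨by linarith, by linarith⟩⟩
  · obtain ⟨j, hj, ⟨z, hz1, hz2⟩, hle⟩ := hcov i hi
    refine ⟨j, hj, ?_⟩
    rw [mem_parCyl] at hz1 hz2
    have hri := hr i hi
    have hrj := hr j (hut hj)
    -- The selected radius is at least half of `r i`, so `r i` costs at most four time lengths of
    -- the selected cylinder. This is why the top is raised by 4σr². The cap at 0 keeps the
    -- enlargement below the final time, beyond which nothing is known.
    have hsq : r i ^ 2 ≤ 4 * r j ^ 2 := by nlinarith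
    have hs : σ * r i ^ 2 ≤ 4 * (σ * r j ^ 2) := by nlinarith
    have hp : 0 ≤ σ * r j ^ 2 := by positivity
    refine parCyl_subset ?_ ?_ ?_
    · have := dist_triangle (y i) z.1 (y j)
      rw [dist_comm (y i) z.1] at this
      linarith [hz1.1, hz2.1]
    · have : min (b j + 4 * (σ * r j ^ 2)) 0 ≤ b j + 4 * (σ * r j ^ 2) := min_le_left _ _
      nlinarith [hz1.2.1, hz2.2.1, hz1.2.2, hz2.2.2]
    · exact le_min (by linarith [hz1.2.1, hz2.2.2]) (hb i hi)

/-- If all small cylinders around the points of `N` have mean at most `κ`, then the set of points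
of `N` where the function is much larger than `κ` is negligible. -/
theorem measure_eq_zero_of_parCyl_mean_le {n : ℕ} {F : RVec n × ℝ → ℝ≥0∞}
    {σ r₀ : ℝ} (hσ : 0 < σ) (hr₀ : 0 < r₀) {κ : ℝ≥0∞} (hκ : κ ≠ 0) (hκt : κ ≠ ⊤)
    {N : Set (RVec n × ℝ)} (hN : volume N ≠ ⊤) (hN0 : ∀ z ∈ N, z.2 ≤ 0)
    (hmean : ∀ z ∈ N, ∀ (y : RVec n) (b r : ℝ), 0 < r → r < r₀ → b ≤ 0 →
      z ∈ parCyl y b r (σ * r ^ 2) →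
      ∫⁻ w in parCyl y b r (σ * r ^ 2), F w ≤ κ * volume (parCyl y b r (σ * r ^ 2)))
    (hF : Measurable F) (hbig : ∀ z ∈ N, 2 * ENNReal.ofReal (5 ^ (n + 2)) * κ < F z) :
    volume N = 0 := by
  by_contra hN1
  -- Outer regularity replaces a differentiation theorem: disjoint cylinders inside U have total
  -- volume below 2|N|, their enlargements cover N and have means at most κ, and Chebyshev's
  -- inequality contradicts the threshold. The factor 2 comes from U, the factor 5^{n+2} from the
  -- enlargement.
  obtain ⟨U, hNU, hUo, hU⟩ := N.exists_isOpen_lt_of_lt (2 * volume N)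
    (by rw [two_mul]; exact ENNReal.lt_add_right hN hN1)
  have hex : ∀ z ∈ N, ∃ r : ℝ, 0 < r ∧ r < r₀ / 5 ∧ parCyl z.1 z.2 r (σ * r ^ 2) ⊆ U := by
    intro z hz
    obtain ⟨ε, hε, hball⟩ := Metric.isOpen_iff.1 hUo z (hNU hz)
    set r := min (min (r₀ / 6) (ε / 2)) (min 1 (ε / (2 * σ)))
    have hr : 0 < r := by positivity
    have h1 : r ≤ r₀ / 6 := (min_le_left _ _).trans (min_le_left _ _)
    have h2 : r ≤ ε / 2 := (min_le_left _ _).trans (min_le_right _ _)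
    have h3 : r ≤ 1 := (min_le_right _ _).trans (min_le_left _ _)
    have h4 : r ≤ ε / (2 * σ) := (min_le_right _ _).trans (min_le_right _ _)
    refine ⟨r, hr, by linarith, fun w hw => hball ?_⟩
    rw [mem_parCyl] at hw
    rw [le_div_iff₀ (by positivity)] at h4
    have h5 : σ * r ^ 2 ≤ ε / 2 := by nlinarith [mul_pos hσ hr]
    rw [Metric.mem_ball, Prod.dist_eq]
    refine max_lt (by linarith [hw.1]) ?_
    rw [Real.dist_eq, abs_lt]
    constructor <;> linarith [hw.2.1, hw.2.2]
  choose! r hr hr5 hrU using hex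
  obtain ⟨u, huN, huc, hdis, hcov⟩ := exists_disjoint_parCyl N (fun z => z.1) (fun z => z.2) r hσ
    hr (r₀ / 5) (fun z hz => (hr5 z hz).le) hN0
  set B : RVec n × ℝ → Set (RVec n × ℝ) := fun z => parCyl z.1 z.2 (r z) (σ * r z ^ 2)
  set D : RVec n × ℝ → Set (RVec n × ℝ) := fun j =>
    parCyl j.1 (min (j.2 + 4 * (σ * r j ^ 2)) 0) (5 * r j) (σ * (5 * r j) ^ 2)
  have hNsub : N ⊆ {w | 2 * ENNReal.ofReal (5 ^ (n + 2)) * κ ≤ F w} ∩ ⋃ j ∈ u, D j := by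
    intro z hz
    obtain ⟨j, hj, hsub⟩ := hcov z hz
    refine ⟨(hbig z hz).le, mem_iUnion₂.2 ⟨j, hj, hsub ?_⟩⟩
    have := hr z hz
    exact mem_parCyl.2 ⟨by simpa, by simp; positivity, le_rfl⟩
  have h1 : 2 * ENNReal.ofReal (5 ^ (n + 2)) * κ * volume N ≤ ∫⁻ w in ⋃ j ∈ u, D j, F w := by
    calc _ ≤ 2 * ENNReal.ofReal (5 ^ (n + 2)) * κ *
        (volume.restrict (⋃ j ∈ u, D j)) {w | 2 * ENNReal.ofReal (5 ^ (n + 2)) * κ ≤ F w} := by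
          rw [Measure.restrict_apply (measurableSet_le measurable_const hF)]
          exact mul_le_mul_right (measure_mono hNsub) _
      _ ≤ _ := mul_meas_ge_le_lintegral hF _
  have h2 : ∫⁻ w in ⋃ j ∈ u, D j, F w ≤ κ * ENNReal.ofReal (5 ^ (n + 2)) * volume U := by
    calc ∫⁻ w in ⋃ j ∈ u, D j, F w ≤ ∑' j : u, ∫⁻ w in D j, F w := by
          have := huc.to_subtype
          rw [biUnion_eq_iUnion]
          exact lintegral_iUnion_le _ _
      _ ≤ ∑' j : u, κ * ENNReal.ofReal (5 ^ (n + 2)) * volume (B j) := by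
          refine ENNReal.tsum_le_tsum fun j => ?_
          have hj := huN j.2
          have hrj := hr _ hj
          have := hmean j hj j.1.1 (min (j.1.2 + 4 * (σ * r j ^ 2)) 0) (5 * r j) (by positivity)
            (by linarith [hr5 _ hj]) (min_le_right _ _) (mem_parCyl.2 ⟨by simpa, ?_, ?_⟩)
          · refine this.trans_eq ?_
            rw [volume_parCyl_scale _ j.1.1 _ j.1.2 _ (by norm_num) hrj]
            ring
          · have h3 : min (j.1.2 + 4 * (σ * r j ^ 2)) 0 ≤ j.1.2 + 4 * (σ * r j ^ 2) :=
              min_le_left _ _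
            nlinarith [mul_pos hσ (pow_pos hrj 2)]
          · exact le_min (by nlinarith [mul_pos hσ (pow_pos hrj 2)]) (hN0 _ hj)
      _ = κ * ENNReal.ofReal (5 ^ (n + 2)) * volume (⋃ j ∈ u, B j) := by
          rw [ENNReal.tsum_mul_left, measure_biUnion huc hdis fun j _ => measurableSet_parCyl _ _ _ _]
      _ ≤ _ := by
          gcongr
          exact iUnion₂_subset fun j hj => hrU j (huN hj)
  have h3 : κ * ENNReal.ofReal (5 ^ (n + 2)) * volume U <
      κ * ENNReal.ofReal (5 ^ (n + 2)) * (2 * volume N) := by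
    refine (ENNReal.mul_lt_mul_iff_right ?_ ?_).2 hU
    · refine mul_ne_zero hκ ?_
      simp
    · exact ENNReal.mul_ne_top hκt ENNReal.ofReal_ne_top
  refine absurd (h1.trans h2) (not_le.2 (h3.trans_eq ?_))
  ring

/-! ### Gehring's lemma in intrinsic cylinders. -/

/-- The reverse Hölder inequality on intrinsic cylinders `B_r × [b - l^{2-p} r², b]` on which the
mean of `g^p` exceeds `l^p`, while it does not on an enlarged cylinder. -/
def IntrinsicRevHolder {n : ℕ} (p q c₀ : ℝ) (g : RVec n × ℝ → ℝ≥0) : Prop :=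
  ∀ (l : ℝ), 1 ≤ l → ∀ (y : RVec n) (b r : ℝ), 0 < r → b ≤ 0 →
    parCyl y (min (b + 16 * (l ^ (2 - p) * r ^ 2)) 0) (10 * r) (l ^ (2 - p) * (10 * r) ^ 2)
      ⊆ parCyl 0 0 1 1 →
    ENNReal.ofReal (l ^ p) * volume (parCyl y b r (l ^ (2 - p) * r ^ 2))
      < ∫⁻ z in parCyl y b r (l ^ (2 - p) * r ^ 2), (g z : ℝ≥0∞) ^ p →
    ∫⁻ z in parCyl y (min (b + 16 * (l ^ (2 - p) * r ^ 2)) 0) (10 * r)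
        (l ^ (2 - p) * (10 * r) ^ 2), (g z : ℝ≥0∞) ^ p
      ≤ ENNReal.ofReal (l ^ p) * volume (parCyl y (min (b + 16 * (l ^ (2 - p) * r ^ 2)) 0)
          (10 * r) (l ^ (2 - p) * (10 * r) ^ 2)) →
    ENNReal.ofReal (c₀ * l ^ q) * volume (parCyl y b r (l ^ (2 - p) * r ^ 2))
      ≤ ∫⁻ z in parCyl y b (2 * r) (l ^ (2 - p) * (2 * r) ^ 2), (g z : ℝ≥0∞) ^ q

/-- A stopping argument: keep multiplying the radius by 10 while the enlarged mean still exceeds κ.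
Radii between r₀/10 and r₀ are known to have mean at most κ, so this ends before they are passed,
and N bounds the number of rounds. The factor 10 and the shift 16σr² are the Vitali enlargement (5
and 4) of the doubled cylinder. -/
theorem exists_stopped_parCyl {n : ℕ} {F : RVec n × ℝ → ℝ≥0∞} {σ r₀ : ℝ} (hσ : 0 < σ)
    {κ : ℝ≥0∞} {z : RVec n × ℝ} 
    (hstart : ∀ (y : RVec n) (b r : ℝ), r₀ / 10 ≤ r → r ≤ r₀ → b ≤ 0 →
      z ∈ parCyl y b r (σ * r ^ 2) →
      ∫⁻ w in parCyl y b r (σ * r ^ 2), F w ≤ κ * volume (parCyl y b r (σ * r ^ 2)))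
    (N : ℕ) (y : RVec n) (b r : ℝ) (hr : 0 < r) (hr₀ : r < r₀ / 10) (hN : r₀ / 10 ≤ 10 ^ N * r)
    (hb : b ≤ 0) (hz : z ∈ parCyl y b r (σ * r ^ 2))
    (hbig : κ * volume (parCyl y b r (σ * r ^ 2)) < ∫⁻ w in parCyl y b r (σ * r ^ 2), F w) :
    ∃ (y : RVec n) (b r : ℝ), 0 < r ∧ 10 * r ≤ r₀ ∧ b ≤ 0 ∧ z ∈ parCyl y b r (σ * r ^ 2) ∧
      κ * volume (parCyl y b r (σ * r ^ 2)) < ∫⁻ w in parCyl y b r (σ * r ^ 2), F w ∧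
      ∫⁻ w in parCyl y (min (b + 16 * (σ * r ^ 2)) 0) (10 * r) (σ * (10 * r) ^ 2), F w
        ≤ κ * volume (parCyl y (min (b + 16 * (σ * r ^ 2)) 0) (10 * r) (σ * (10 * r) ^ 2)) := by
  induction N generalizing b r with
  | zero => simp at hN; linarith
  | succ N ih =>
    by_cases h : ∫⁻ w in parCyl y (min (b + 16 * (σ * r ^ 2)) 0) (10 * r) (σ * (10 * r) ^ 2), F w
        ≤ κ * volume (parCyl y (min (b + 16 * (σ * r ^ 2)) 0) (10 * r) (σ * (10 * r) ^ 2))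
    · exact ⟨y, b, r, hr, by linarith, hb, hz, hbig, h⟩
    · have hz' : z ∈ parCyl y (min (b + 16 * (σ * r ^ 2)) 0) (10 * r) (σ * (10 * r) ^ 2) := by
        have hs : 0 < σ * r ^ 2 := by positivity
        refine parCyl_subset ?_ ?_ ?_ hz
        · simp; linarith
        · have : min (b + 16 * (σ * r ^ 2)) 0 ≤ b + 16 * (σ * r ^ 2) := min_le_left _ _
          nlinarith
        · exact le_min (by linarith) hb
      have h10 : 10 * r < r₀ / 10 := by
        by_contra! h10
        exact h (hstart _ _ _ h10 (by linarith) (min_le_right _ _) hz')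
      exact ih _ _ (by positivity) h10 (by rw [pow_succ] at hN; linarith) (min_le_right _ _) hz'
        (not_le.1 h)

/-- Almost every point of the upper level set lies in a stopped cylinder. On its enlargement the
mean of g^p is at most l^p, while the reverse Hölder inequality turns l^q times the volume into the
integral of g^q over the doubled cylinder. Choosing disjoint doubled cylinders and summing gives the
factor l^{p-q}. -/
theorem level_estimate {n : ℕ} {p q c₀ : ℝ} (hq : 1 ≤ q) (hqp : q < p) (hc₀ : 0 < c₀)
    (hc₀1 : c₀ ≤ 1) {g : RVec n × ℝ → ℝ≥0} (hg : Measurable g) (hRH : IntrinsicRevHolder p q c₀ g)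
    {l r₀ ρ₁ ρ₂ : ℝ} (hl : 1 ≤ l) (hr₀ : 0 < r₀) (hρ₁ : 0 < ρ₁) (hρ₂ : ρ₂ ≤ 1)
    (hr₀1 : 2 * r₀ ≤ ρ₂ - ρ₁) (hr₀2 : l ^ (2 - p) * r₀ ^ 2 ≤ ρ₂ - ρ₁)
    (hstart : ∀ (y : RVec n) (b r : ℝ), r₀ / 10 ≤ r → r ≤ r₀ →
      parCyl y b r (l ^ (2 - p) * r ^ 2) ⊆ parCyl 0 0 1 1 →
      ∫⁻ w in parCyl y b r (l ^ (2 - p) * r ^ 2), (g w : ℝ≥0∞) ^ p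
        ≤ ENNReal.ofReal (l ^ p) * volume (parCyl y b r (l ^ (2 - p) * r ^ 2))) :
    ∫⁻ z in parCyl 0 0 ρ₁ ρ₁ ∩ {z | 2 * 5 ^ (n + 2) * l < g z}, (g z : ℝ≥0∞) ^ p
      ≤ ENNReal.ofReal (2 * 10 ^ (n + 2) / c₀ * l ^ (p - q)) *
        ∫⁻ z in parCyl 0 0 ρ₂ ρ₂ ∩ {z | c₀ / 2 ^ (n + 3) * l < g z}, (g z : ℝ≥0∞) ^ q := by
  have hl0 : 0 < l := by linarith
  set σ := l ^ (2 - p) with hσdef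
  have hσ : 0 < σ := Real.rpow_pos_of_pos hl0 _
  set κ := ENNReal.ofReal (l ^ p) with hκdef
  have hκ : κ ≠ 0 := by simp [hκdef]; positivity
  set F : RVec n × ℝ → ℝ≥0∞ := fun w => (g w : ℝ≥0∞) ^ p
  have hF : Measurable F := by fun_prop
  have hsub : ∀ z ∈ parCyl (0 : RVec n) 0 ρ₁ ρ₁, ∀ (y : RVec n) (b r : ℝ), 0 < r → r ≤ r₀ → b ≤ 0 →
      z ∈ parCyl y b r (σ * r ^ 2) → parCyl y b r (σ * r ^ 2) ⊆ parCyl 0 0 ρ₂ ρ₂ := by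
    intro z hz y b r hr hrr hb hzC
    rw [mem_parCyl] at hz hzC
    have : σ * r ^ 2 ≤ σ * r₀ ^ 2 := by gcongr
    refine parCyl_subset ?_ (by linarith [hz.2.1, hzC.2.2]) hb
    have := dist_triangle y z.1 0
    rw [dist_comm y z.1] at this
    linarith [hz.1, hzC.1]
  have hsub1 : parCyl (0 : RVec n) 0 ρ₂ ρ₂ ⊆ parCyl 0 0 1 1 :=
    parCyl_subset (by simpa using hρ₂) (by linarith) le_rfl
  set H := parCyl (0 : RVec n) 0 ρ₁ ρ₁ ∩ {z | 2 * 5 ^ (n + 2) * l < g z} with hH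
  have hHm : MeasurableSet H := (measurableSet_parCyl _ _ _ _).inter
    (measurableSet_lt measurable_const hg.coe_nnreal_real)
  set T := {z ∈ H | ∃ (y : RVec n) (b r : ℝ), 0 < r ∧ r < r₀ / 10 ∧ b ≤ 0 ∧
      z ∈ parCyl y b r (σ * r ^ 2) ∧
      κ * volume (parCyl y b r (σ * r ^ 2)) < ∫⁻ w in parCyl y b r (σ * r ^ 2), F w} with hT
  have hnull : volume (H \ T) = 0 := by
    refine measure_eq_zero_of_parCyl_mean_le hσ (r₀ := r₀ / 10) (by positivity) hκ
      ENNReal.ofReal_ne_top ?_ ?_ ?_ hF ?_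
    · exact ((measure_mono (sdiff_subset.trans inter_subset_left)).trans_lt
        (volume_parCyl_ne_top _ _ _ _).lt_top).ne
    · intro z hz
      exact (mem_parCyl.1 hz.1.1).2.2
    · intro z hz y b r h1 h2 h3 h4
      by_contra h5
      exact hz.2 ⟨hz.1, y, b, r, h1, h2, h3, h4, not_le.1 h5⟩
    · intro z hz
      have hgz : 2 * 5 ^ (n + 2) * l < (g z : ℝ) := hz.1.2
      have h1 : ENNReal.ofReal (2 * 5 ^ (n + 2) * l) < (g z : ℝ≥0∞) := by
        rw [← ENNReal.ofReal_coe_nnreal]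
        exact (ENNReal.ofReal_lt_ofReal_iff (by linarith [show (0:ℝ) < 2 * 5 ^ (n + 2) * l by positivity])).2 hgz
      calc 2 * ENNReal.ofReal (5 ^ (n + 2)) * κ
          = ENNReal.ofReal (2 * 5 ^ (n + 2) * l ^ p) := by
            rw [ENNReal.ofReal_mul (by positivity), ENNReal.ofReal_mul (by positivity)]
            simp [hκdef]
        _ ≤ ENNReal.ofReal ((2 * 5 ^ (n + 2) * l) ^ p) := by
            apply ENNReal.ofReal_le_ofReal
            rw [Real.mul_rpow (by positivity) hl0.le]
            gcongr
            refine Real.self_le_rpow_of_one_le ?_ (by linarith)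
            have : (1:ℝ) ≤ 5 ^ (n + 2) := one_le_pow₀ (by norm_num)
            linarith
        _ = ENNReal.ofReal (2 * 5 ^ (n + 2) * l) ^ p := by
            rw [ENNReal.ofReal_rpow_of_pos (by positivity)]
        _ < F z := ENNReal.rpow_lt_rpow h1 (by linarith)
  have hsel : ∀ z ∈ T, ∃ (y : RVec n) (b r : ℝ), 0 < r ∧ 10 * r ≤ r₀ ∧ b ≤ 0 ∧
      z ∈ parCyl y b r (σ * r ^ 2) ∧
      κ * volume (parCyl y b r (σ * r ^ 2)) < ∫⁻ w in parCyl y b r (σ * r ^ 2), F w ∧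
      ∫⁻ w in parCyl y (min (b + 16 * (σ * r ^ 2)) 0) (10 * r) (σ * (10 * r) ^ 2), F w
        ≤ κ * volume (parCyl y (min (b + 16 * (σ * r ^ 2)) 0) (10 * r) (σ * (10 * r) ^ 2)) := by
    rintro z ⟨hzH, y, b, r, hr, hrr, hb, hz, hbig⟩
    obtain ⟨N, hN⟩ := pow_unbounded_of_one_lt (r₀ / 10 / r) (show (1:ℝ) < 10 by norm_num)
    rw [div_lt_iff₀ hr] at hN
    refine exists_stopped_parCyl hσ (fun y b r h1 h2 h3 h4 => hstart y b r h1 h2 ?_) N y b r hr hrr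
      hN.le hb hz hbig
    exact (hsub z hzH.1 y b r (by linarith) h2 h3 h4).trans hsub1
  choose! y b r hr hrr hb hzC hbig hE using hsel
  have hEz : ∀ z ∈ T, z ∈ parCyl (y z) (min (b z + 16 * (σ * r z ^ 2)) 0) (10 * r z)
      (σ * (10 * r z) ^ 2) := by
    intro z hz
    have hrz := hr z hz
    have hs : 0 < σ * r z ^ 2 := by positivity
    refine parCyl_subset ?_ ?_ ?_ (hzC z hz)
    · simp; linarith
    · have : min (b z + 16 * (σ * r z ^ 2)) 0 ≤ b z + 16 * (σ * r z ^ 2) := min_le_left _ _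
      nlinarith
    · exact le_min (by linarith) (hb z hz)
  have hOsub : ∀ z ∈ T, parCyl (y z) (b z) (2 * r z) (σ * (2 * r z) ^ 2) ⊆ parCyl 0 0 ρ₂ ρ₂ := by
    intro z hz
    have hrz := hr z hz
    have hs : 0 < σ * r z ^ 2 := by positivity
    refine hsub z hz.1.1 _ _ _ (by positivity) (by linarith [hrr z hz]) (hb z hz)
      (parCyl_subset ?_ (by nlinarith) le_rfl (hzC z hz))
    simp; linarith
  have hRHz : ∀ z ∈ T, ENNReal.ofReal (c₀ * l ^ q) * volume (parCyl (y z) (b z) (r z) (σ * r z ^ 2))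
      ≤ ∫⁻ w in parCyl (y z) (b z) (2 * r z) (σ * (2 * r z) ^ 2), (g w : ℝ≥0∞) ^ q := by
    intro z hz
    have hrz := hr z hz
    refine hRH l hl _ _ _ hrz (hb z hz) ?_ (hbig z hz) (hE z hz)
    exact (hsub z hz.1.1 _ _ _ (by positivity) (hrr z hz) (min_le_right _ _) (hEz z hz)).trans hsub1
  -- Points with g below this threshold contribute at most half of the reverse Hölder lower bound:
  -- the doubled cylinder has 2^{n+2} times the volume, and (c₀/2^{n+3})^q ≤ c₀/2^{n+3} as q ≥ 1 and
  -- c₀ ≤ 1.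
  set Hq := {z : RVec n × ℝ | c₀ / 2 ^ (n + 3) * l < g z} with hHq
  have hHqm : MeasurableSet Hq := measurableSet_lt measurable_const hg.coe_nnreal_real
  have hRHz' : ∀ z ∈ T, ENNReal.ofReal (c₀ / 2 * l ^ q) *
      volume (parCyl (y z) (b z) (r z) (σ * r z ^ 2))
      ≤ ∫⁻ w in parCyl (y z) (b z) (2 * r z) (σ * (2 * r z) ^ 2) ∩ Hq, (g w : ℝ≥0∞) ^ q := by
    intro z hz
    have hrz := hr z hz
    set V := volume (parCyl (y z) (b z) (r z) (σ * r z ^ 2)) with hV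
    have hVt : V ≠ ⊤ := volume_parCyl_ne_top _ _ _ _
    have h1 := hRHz z hz
    rw [← lintegral_inter_add_sdiff _ (parCyl (y z) (b z) (2 * r z) (σ * (2 * r z) ^ 2)) hHqm] at h1
    have h2 : ∫⁻ w in parCyl (y z) (b z) (2 * r z) (σ * (2 * r z) ^ 2) \ Hq, (g w : ℝ≥0∞) ^ q
        ≤ ENNReal.ofReal (c₀ / 2 * l ^ q) * V := by
      calc _ ≤ ∫⁻ w in parCyl (y z) (b z) (2 * r z) (σ * (2 * r z) ^ 2) \ Hq,
            ENNReal.ofReal (c₀ / 2 ^ (n + 3) * l ^ q) := by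
            refine setLIntegral_mono measurable_const fun w hw => ?_
            have hgw : (g w : ℝ) ≤ c₀ / 2 ^ (n + 3) * l := not_lt.1 hw.2
            rw [← ENNReal.ofReal_coe_nnreal, ENNReal.ofReal_rpow_of_nonneg (by positivity)
              (by linarith)]
            apply ENNReal.ofReal_le_ofReal
            calc (g w : ℝ) ^ q ≤ (c₀ / 2 ^ (n + 3) * l) ^ q := by gcongr
              _ = (c₀ / 2 ^ (n + 3)) ^ q * l ^ q := Real.mul_rpow (by positivity) hl0.le
              _ ≤ (c₀ / 2 ^ (n + 3)) * l ^ q := by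
                gcongr
                refine Real.rpow_le_self_of_le_one (by positivity) ?_ hq
                rw [div_le_one (by positivity)]
                exact hc₀1.trans (one_le_pow₀ (by norm_num))
        _ ≤ ENNReal.ofReal (c₀ / 2 ^ (n + 3) * l ^ q) *
            volume (parCyl (y z) (b z) (2 * r z) (σ * (2 * r z) ^ 2)) := by
            rw [setLIntegral_const]
            gcongr
            exact sdiff_subset
        _ = _ := by
            rw [volume_parCyl_scale _ (y z) _ (b z) _ (by norm_num) hrz, ← hV, ← mul_assoc,
              ← ENNReal.ofReal_mul (by positivity)]
            congr 2
            field_simp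
            ring
    have h3 : ENNReal.ofReal (c₀ * l ^ q) * V
        = ENNReal.ofReal (c₀ / 2 * l ^ q) * V + ENNReal.ofReal (c₀ / 2 * l ^ q) * V := by
      rw [← add_mul, ← ENNReal.ofReal_add (by positivity) (by positivity)]
      congr 2
      ring
    rw [h3] at h1
    have h4 : ENNReal.ofReal (c₀ / 2 * l ^ q) * V ≠ ⊤ := ENNReal.mul_ne_top ENNReal.ofReal_ne_top hVt
    refine (ENNReal.add_le_add_iff_right h4).1 (h1.trans ?_)
    gcongr
  -- The doubled cylinders are the ones that must be disjoint, because the integrals of g^q live on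
  -- them. Their enlargements are exactly the cylinders on which the stopping gave an upper bound.
  obtain ⟨u, huT, huc, hdis, hcov⟩ := exists_disjoint_parCyl T y b (fun z => 2 * r z) hσ
    (fun z hz => by have := hr z hz; positivity) r₀ (fun z hz => by
      have := hr z hz; linarith [hrr z hz]) hb
  set D : RVec n × ℝ → Set (RVec n × ℝ) := fun j =>
    parCyl (y j) (min (b j + 16 * (σ * r j ^ 2)) 0) (10 * r j) (σ * (10 * r j) ^ 2)
  set O : RVec n × ℝ → Set (RVec n × ℝ) := fun j =>
    parCyl (y j) (b j) (2 * r j) (σ * (2 * r j) ^ 2)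
  have hcovT : T ⊆ ⋃ j ∈ u, D j := by
    intro z hz
    obtain ⟨j, hj, hsubj⟩ := hcov z hz
    have hrz := hr z hz
    have hs : 0 < σ * r z ^ 2 := by positivity
    refine mem_iUnion₂.2 ⟨j, hj, ?_⟩
    have := hsubj (parCyl_subset (by simp; linarith) (by nlinarith) le_rfl (hzC z hz))
    convert! this using 2 <;> ring_nf
  calc ∫⁻ z in H, F z ≤ ∫⁻ z in (⋃ j ∈ u, D j), F z := by
        refine lintegral_mono' (Measure.restrict_mono_ae ?_) le_rfl
        rw [ae_le_set]
        exact measure_mono_null (sdiff_subset_sdiff_right hcovT) hnull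
    _ ≤ ∑' j : u, ∫⁻ z in D j, F z := by
        have := huc.to_subtype
        rw [biUnion_eq_iUnion]
        exact lintegral_iUnion_le _ _
    _ ≤ ∑' j : u, ENNReal.ofReal (2 * 10 ^ (n + 2) / c₀ * l ^ (p - q)) *
        ∫⁻ w in O j ∩ Hq, (g w : ℝ≥0∞) ^ q := by
        refine ENNReal.tsum_le_tsum fun j => ?_
        have hj := huT j.2
        refine (hE j hj).trans ?_
        rw [volume_parCyl_scale _ (y j) _ (b j) _ (by norm_num) (hr j hj)]
        refine le_trans (le_of_eq ?_) (mul_le_mul_right (hRHz' j hj) _)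
        rw [← mul_assoc, ← mul_assoc, hκdef, ← ENNReal.ofReal_mul (by positivity),
          ← ENNReal.ofReal_mul (by positivity)]
        congr 2
        rw [Real.rpow_sub hl0]
        field_simp
    _ = ENNReal.ofReal (2 * 10 ^ (n + 2) / c₀ * l ^ (p - q)) *
        ∫⁻ w in (⋃ j ∈ u, O j ∩ Hq),
          (g w : ℝ≥0∞) ^ q := by
        rw [ENNReal.tsum_mul_left]
        congr 1
        rw [lintegral_biUnion huc (fun j _ => (measurableSet_parCyl _ _ _ _).inter hHqm)
          (hdis.mono fun j => inter_subset_left)]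
    _ ≤ _ := by
        gcongr
        exact iUnion₂_subset fun j hj => inter_subset_inter_left _ (hOsub j (huT hj))

theorem coe_nnreal_rpow_eq_ofReal (x : ℝ≥0) {p : ℝ} (hp : 0 ≤ p) :
    (x : ℝ≥0∞) ^ p = ENNReal.ofReal ((x : ℝ) ^ p) := by
  rw [← ENNReal.ofReal_coe_nnreal, ENNReal.ofReal_rpow_of_nonneg x.coe_nonneg hp]

/-- Integrate the level estimate against ε t^{ε-1} over t > t₀ and use the layer-cake formula on
both sides; levels below t₀ are bounded trivially. Truncating at k keeps the integrals finite, which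
is what makes a later absorption legitimate, and no constant depends on k. -/
theorem lintegral_mul_truncated_rpow_le {α : Type*} [MeasurableSpace α] {μ : Measure α}
    {g : α → ℝ≥0} (hg : Measurable g) {Q₁ Q₂ : Set α}
    {p q B c t₀ ε k : ℝ} (hq : 0 < q) (hqp : q < p) (hB : 0 ≤ B)
    (hc : 0 < c) (hc1 : c ≤ 1) (ht₀ : 0 < t₀) (hε : 0 < ε) (hε1 : ε ≤ 1) (hk : 0 < k)
    (hlev : ∀ t, t₀ < t → ∫⁻ z in Q₁ ∩ {z | t < g z}, (g z : ℝ≥0∞) ^ p ∂μ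
      ≤ ENNReal.ofReal (B * t ^ (p - q)) * ∫⁻ z in Q₂ ∩ {z | c * t < g z}, (g z : ℝ≥0∞) ^ q ∂μ) :
    ∫⁻ z in Q₁, (g z : ℝ≥0∞) ^ p * ENNReal.ofReal ((min (g z : ℝ) k) ^ ε) ∂μ
      ≤ ENNReal.ofReal (t₀ ^ ε) * ∫⁻ z in Q₁, (g z : ℝ≥0∞) ^ p ∂μ
        + ENNReal.ofReal (ε * (B * (1 / c) ^ (1 + p - q) / (p - q))) *
          ∫⁻ z in Q₂, (g z : ℝ≥0∞) ^ p * ENNReal.ofReal ((min (g z : ℝ) k) ^ ε) ∂μ := by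
  have hpm : Measurable fun z => (g z : ℝ≥0∞) ^ p := by fun_prop
  have hqm : Measurable fun z => (g z : ℝ≥0∞) ^ q := by fun_prop
  have hgm : Measurable fun z => (g z : ℝ) := hg.coe_nnreal_real
  have hmk : ∀ z, 0 ≤ min (g z : ℝ) k := fun z => le_min (g z).coe_nonneg hk.le
  -- With g^p and g^q built into the measures, the two sides of the level estimate become measures
  -- of level sets.
  set μ₁ := (μ.restrict Q₁).withDensity fun z => (g z : ℝ≥0∞) ^ p with hμ₁
  set μ₂ := (μ.restrict Q₂).withDensity fun z => (g z : ℝ≥0∞) ^ q with hμ₂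
  have hm1 : Measurable fun z => min (g z : ℝ) k := hgm.min measurable_const
  have hm2 : Measurable fun z => min (g z / c : ℝ) k := (hgm.div_const c).min measurable_const
  have e1 : ∫⁻ z in Q₁, (g z : ℝ≥0∞) ^ p * ENNReal.ofReal ((min (g z : ℝ) k) ^ ε) ∂μ
      = ∫⁻ z, ENNReal.ofReal ((min (g z : ℝ) k) ^ ε) ∂μ₁ := by
    rw [hμ₁, lintegral_withDensity_eq_lintegral_mul _ hpm (by fun_prop)]
    rfl
  -- As ε ≤ 1, the power of 1/c is bounded independently of ε, so ε can later be chosen after this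
  -- constant.
  have e2 : ∫⁻ z, ENNReal.ofReal ((min (g z / c : ℝ) k) ^ (ε + (p - q))) ∂μ₂
      ≤ ENNReal.ofReal ((1 / c) ^ (1 + p - q)) *
        ∫⁻ z in Q₂, (g z : ℝ≥0∞) ^ p * ENNReal.ofReal ((min (g z : ℝ) k) ^ ε) ∂μ := by
    rw [hμ₂, lintegral_withDensity_eq_lintegral_mul _ hqm (by fun_prop),
      ← lintegral_const_mul _ (by fun_prop)]
    refine lintegral_mono fun z => ?_
    simp only [Pi.mul_apply]
    have h1 : min (g z / c : ℝ) k ≤ 1 / c * min (g z : ℝ) k := by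
      rw [mul_min_of_nonneg _ _ (by positivity)]
      refine min_le_min (by rw [one_div, inv_mul_eq_div]) ?_
      rw [one_div, inv_mul_eq_div, le_div_iff₀ hc]
      nlinarith
    have h0 : 0 ≤ min (g z / c : ℝ) k := le_min (by positivity) hk.le
    rw [coe_nnreal_rpow_eq_ofReal _ hq.le, coe_nnreal_rpow_eq_ofReal _ (hq.trans hqp).le,
      ← ENNReal.ofReal_mul (by positivity), ← ENNReal.ofReal_mul (by positivity),
      ← ENNReal.ofReal_mul (by positivity)]
    apply ENNReal.ofReal_le_ofReal
    have hcc : 1 ≤ 1 / c := by rw [le_div_iff₀ hc]; linarith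
    calc (g z : ℝ) ^ q * min (g z / c : ℝ) k ^ (ε + (p - q))
        ≤ (g z : ℝ) ^ q * (1 / c * min (g z : ℝ) k) ^ (ε + (p - q)) := by
          gcongr
      _ = (g z : ℝ) ^ q * ((1 / c) ^ (ε + (p - q)) *
          (min (g z : ℝ) k ^ ε * min (g z : ℝ) k ^ (p - q))) := by
          rw [Real.mul_rpow (by positivity) (hmk z),
            Real.rpow_add_of_nonneg (hmk z) hε.le (by linarith)]
      _ ≤ (g z : ℝ) ^ q * ((1 / c) ^ (1 + p - q) *
          (min (g z : ℝ) k ^ ε * (g z : ℝ) ^ (p - q))) := by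
          have := hmk z
          gcongr
          · linarith
          · exact min_le_left _ _
      _ = (1 / c) ^ (1 + p - q) * ((g z : ℝ) ^ (q + (p - q)) * min (g z : ℝ) k ^ ε) := by
          rw [Real.rpow_add_of_nonneg (g z).coe_nonneg (by linarith) (by linarith)]
          ring
      _ = _ := by rw [show q + (p - q) = p by ring]
  rw [e1, lintegral_rpow_eq_lintegral_meas_lt_mul _ (Filter.Eventually.of_forall hmk)
    hm1.aemeasurable hε, ← Ioc_union_Ioi_eq_Ioi ht₀.le]
  refine (mul_le_mul_right (lintegral_union_le _ _ _) _).trans ?_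
  rw [mul_add]
  refine add_le_add ?_ ?_
  · have h1 : μ₁ univ = ∫⁻ z in Q₁, (g z : ℝ≥0∞) ^ p ∂μ := by
      rw [hμ₁, withDensity_apply _ MeasurableSet.univ, Measure.restrict_univ]
    have h2 : ∫⁻ t in Ioc 0 t₀, ENNReal.ofReal (t ^ (ε - 1)) = ENNReal.ofReal (t₀ ^ ε / ε) := by
      rw [← ofReal_integral_eq_lintegral_ofReal]
      · rw [← intervalIntegral.integral_of_le ht₀.le, integral_rpow (by left; linarith)]
        simp [Real.zero_rpow hε.ne']
      · rw [← IntegrableOn, ← intervalIntegrable_iff_integrableOn_Ioc_of_le ht₀.le]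
        exact intervalIntegral.intervalIntegrable_rpow' (by linarith)
      · filter_upwards [ae_restrict_mem measurableSet_Ioc] with t ht
        have := ht.1
        positivity
    calc _ ≤ ENNReal.ofReal ε * ∫⁻ t in Ioc 0 t₀, μ₁ univ * ENNReal.ofReal (t ^ (ε - 1)) := by
          gcongr
          exact subset_univ _
      _ = _ := by
          rw [lintegral_const_mul _ (by fun_prop), h1, h2, mul_comm (∫⁻ z in Q₁, _ ∂μ), ← mul_assoc,
            ← ENNReal.ofReal_mul hε.le]
          congr 2
          field_simp
  · calc _ ≤ ENNReal.ofReal ε * ∫⁻ t in Ioi t₀, ENNReal.ofReal B *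
          (μ₂ {z | t < min (g z / c : ℝ) k} * ENNReal.ofReal (t ^ (ε + (p - q) - 1))) := by
          refine mul_le_mul_right (setLIntegral_mono' measurableSet_Ioi fun t ht => ?_) _
          have ht0 : 0 < t := ht₀.trans ht
          -- Below k truncation does not change the level sets; from k on the left one is empty.
          by_cases htk : t < k
          · have s1 : {z | t < min (g z : ℝ) k} = {z | t < g z} := by
              ext z; simp [htk]
            have s2 : {z | t < min (g z / c : ℝ) k} = {z | c * t < g z} := by
              ext z
              simp only [lt_min_iff, mem_ofPred_eq, htk, and_true]
              rw [lt_div_iff₀ hc, mul_comm]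
            rw [s1, s2, hμ₁, hμ₂, withDensity_apply _ (measurableSet_lt measurable_const hgm),
              withDensity_apply _ (measurableSet_lt measurable_const hgm),
              Measure.restrict_restrict (measurableSet_lt measurable_const hgm),
              Measure.restrict_restrict (measurableSet_lt measurable_const hgm),
              inter_comm, inter_comm _ Q₂]
            refine (mul_le_mul_left (hlev t ht) _).trans (le_of_eq ?_)
            rw [ENNReal.ofReal_mul hB, show ε + (p - q) - 1 = (p - q) + (ε - 1) by ring,
              Real.rpow_add ht0, ENNReal.ofReal_mul (by positivity)]
            ring
          · have s1 : {z | t < min (g z : ℝ) k} = ∅ := by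
              ext z; simp [htk]
            rw [s1]
            simp
      _ ≤ ENNReal.ofReal ε * (ENNReal.ofReal B * ∫⁻ t in Ioi 0,
          (μ₂ {z | t < min (g z / c : ℝ) k} * ENNReal.ofReal (t ^ (ε + (p - q) - 1)))) := by
          rw [lintegral_const_mul' _ _ ENNReal.ofReal_ne_top]
          gcongr
      _ = ENNReal.ofReal (ε * B / (ε + (p - q))) *
          ∫⁻ z, ENNReal.ofReal ((min (g z / c : ℝ) k) ^ (ε + (p - q))) ∂μ₂ := by
          rw [lintegral_rpow_eq_lintegral_meas_lt_mul _
            (Filter.Eventually.of_forall fun z => le_min (by positivity) hk.le) hm2.aemeasurable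
            (by linarith : 0 < ε + (p - q)), ← mul_assoc, ← mul_assoc,
            ← ENNReal.ofReal_mul hε.le, ← ENNReal.ofReal_mul (by
              have : 0 < ε + (p - q) := by linarith
              positivity)]
          congr 2
          have : 0 < ε + (p - q) := by linarith
          field_simp
      _ ≤ ENNReal.ofReal (ε * B / (p - q)) *
          (ENNReal.ofReal ((1 / c) ^ (1 + p - q)) *
        ∫⁻ z in Q₂, (g z : ℝ≥0∞) ^ p * ENNReal.ofReal ((min (g z : ℝ) k) ^ ε) ∂μ) := by
          have : 0 < p - q := by linarith
          gcongr
          linarith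
      _ = _ := by
          rw [← mul_assoc, ← ENNReal.ofReal_mul (by
            have : 0 < p - q := by linarith
            positivity)]
          congr 2
          ring

/-- Iterate along the radii 1 - τ^j/2. With τ^{-γ} = 3/2 the j-th error is (3/2)^j, and the
accumulated factor (1/2)^j turns it into (3/4)^j, whose sum is 4. The a priori bound D serves only
to send the remainder to zero and does not enter the result. -/
theorem iteration_absorb {Φ : ℝ → ℝ≥0∞} {A γ : ℝ} (hA : 0 ≤ A) (hγ : 0 < γ) {D : ℝ≥0∞}
    (hD : D ≠ ⊤) (hΦD : ∀ ρ ≤ 1, Φ ρ ≤ D)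
    (h : ∀ ρ₁ ρ₂, 1 / 2 ≤ ρ₁ → ρ₁ < ρ₂ → ρ₂ ≤ 1 →
      Φ ρ₁ ≤ ENNReal.ofReal (A * (ρ₂ - ρ₁) ^ (-γ)) + ENNReal.ofReal (1 / 2) * Φ ρ₂) :
    Φ (1 / 2) ≤ ENNReal.ofReal (4 * (A * ((1 - (2 / 3 : ℝ) ^ (1 / γ)) / 2) ^ (-γ))) := by
  set τ : ℝ := (2 / 3 : ℝ) ^ (1 / γ) with hτ
  have hτ0 : 0 < τ := by positivity
  have hτ1 : τ < 1 := Real.rpow_lt_one (by norm_num) (by norm_num) (by positivity)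
  have hτγ : τ ^ (-γ) = 3 / 2 := by
    rw [hτ, ← Real.rpow_mul (by norm_num), show 1 / γ * -γ = -1 by field_simp, Real.rpow_neg_one]
    norm_num
  have h1τ : 0 < 1 - τ := by linarith
  have hA'0 : 0 ≤ A * ((1 - τ) / 2) ^ (-γ) := by positivity
  generalize hA' : A * ((1 - τ) / 2) ^ (-γ) = A' at hA'0 ⊢
  have key : ∀ j : ℕ, Φ (1 / 2) ≤ ENNReal.ofReal (4 * A' * (1 - (3 / 4) ^ j))
      + ENNReal.ofReal ((1 / 2) ^ j) * Φ (1 - τ ^ j / 2) := by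
    intro j
    induction j with
    | zero => norm_num
    | succ j ih =>
      have hj : 0 < τ ^ j := by positivity
      have hj1 : τ ^ j ≤ 1 := pow_le_one₀ hτ0.le hτ1.le
      have hjj : τ ^ (j + 1) < τ ^ j := pow_lt_pow_right_of_lt_one₀ hτ0 hτ1 (Nat.lt_succ_self j)
      have h34 : 0 ≤ 1 - (3 / 4 : ℝ) ^ j := by
        have : (3 / 4 : ℝ) ^ j ≤ 1 := pow_le_one₀ (by norm_num) (by norm_num)
        linarith
      have hs := h (1 - τ ^ j / 2) (1 - τ ^ (j + 1) / 2) (by linarith) (by linarith)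
        (by have : 0 < τ ^ (j + 1) := by positivity
            linarith)
      have hd : A * (1 - τ ^ (j + 1) / 2 - (1 - τ ^ j / 2)) ^ (-γ) = A' * (3 / 2) ^ j := by
        rw [show 1 - τ ^ (j + 1) / 2 - (1 - τ ^ j / 2) = (1 - τ) / 2 * τ ^ j by ring,
          Real.mul_rpow (by positivity) hj.le, ← mul_assoc, hA', ← Real.rpow_natCast τ j, ← Real.rpow_mul hτ0.le,
          mul_comm (j : ℝ), Real.rpow_mul hτ0.le, hτγ, Real.rpow_natCast]
      rw [hd] at hs
      refine ih.trans ((add_le_add_right (mul_le_mul_right hs _) _).trans (le_of_eq ?_))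
      rw [mul_add, ← mul_assoc (ENNReal.ofReal _) (ENNReal.ofReal _), ← add_assoc, ← ENNReal.ofReal_mul (by positivity),
        ← ENNReal.ofReal_mul (by positivity), ← ENNReal.ofReal_add (by positivity) (by positivity)]
      have e : (1 / 2 : ℝ) ^ j * (3 / 2) ^ j = (3 / 4) ^ j := by
        rw [← mul_pow]; norm_num
      congr 2
      rw [mul_comm A', ← mul_assoc, e]
      ring
  have hlim : Filter.Tendsto (fun j : ℕ => ENNReal.ofReal (4 * A') + ENNReal.ofReal ((1 / 2) ^ j) * D)
      Filter.atTop (nhds (ENNReal.ofReal (4 * A') + ENNReal.ofReal 0 * D)) := by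
    refine Filter.Tendsto.add tendsto_const_nhds (ENNReal.Tendsto.mul_const ?_ (Or.inr hD))
    exact ENNReal.tendsto_ofReal (tendsto_pow_atTop_nhds_zero_of_lt_one (by norm_num) (by norm_num))
  rw [ENNReal.ofReal_zero, zero_mul, add_zero] at hlim
  refine ge_of_tendsto' hlim fun j => (key j).trans ?_
  have h3 : (0:ℝ) ≤ (3 / 4) ^ j := by positivity
  have h4 : 0 < τ ^ j := by positivity
  exact add_le_add (ENNReal.ofReal_le_ofReal (by nlinarith))
    (mul_le_mul_right (hΦD _ (by linarith)) _)

/-- Supplies the starting bound of the stopping argument: for large l a cylinder of radius at least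
r₀/10 is so big that the total mass M' alone forces its mean below l^p. -/
theorem level_estimate_of_large {n : ℕ} {p q c₀ : ℝ} (hq : 1 ≤ q) (hqp : q < p) (hc₀ : 0 < c₀)
    (hc₀1 : c₀ ≤ 1) {g : RVec n × ℝ → ℝ≥0} (hg : Measurable g) (hRH : IntrinsicRevHolder p q c₀ g)
    {M' ω l ρ₁ ρ₂ : ℝ} (hM'0 : 0 ≤ M')
    (hM : ∫⁻ z in parCyl 0 0 1 1, (g z : ℝ≥0∞) ^ p ≤ ENNReal.ofReal M')
    (hω : 0 < ω) (hωdef : volume (Metric.ball (0 : RVec n) 1) = ENNReal.ofReal ω)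
    (hρ₁ : 0 < ρ₁) (hρ : ρ₁ < ρ₂) (hρ₂ : ρ₂ ≤ 1) (hl1 : 1 ≤ l)
    (hl : (1 + M' * 40 ^ (n + 2) / ω) * (ρ₂ - ρ₁) ^ (-((n : ℝ) + 2))
      ≤ l ^ (min 2 (2 + (p - 2) / 2 * ((n : ℝ) + 2)))) :
    ∫⁻ z in parCyl 0 0 ρ₁ ρ₁ ∩ {z | 2 * 5 ^ (n + 2) * l < g z}, (g z : ℝ≥0∞) ^ p
      ≤ ENNReal.ofReal (2 * 10 ^ (n + 2) / c₀ * l ^ (p - q)) *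
        ∫⁻ z in parCyl 0 0 ρ₂ ρ₂ ∩ {z | c₀ / 2 ^ (n + 3) * l < g z}, (g z : ℝ≥0∞) ^ q := by
  have hl0 : 0 < l := by linarith
  have hd0 : 0 < ρ₂ - ρ₁ := by linarith
  have hd1 : ρ₂ - ρ₁ ≤ 1 := by linarith
  generalize hd : ρ₂ - ρ₁ = d at *
  -- The starting radius is r₀ = (d/4)m. For p < 2 the time length l^{2-p}r² grows with l, and m
  -- shrinks the radius just enough for the cylinder to fit into the gap d.
  obtain ⟨m, hm⟩ : ∃ m, m = min 1 (l ^ ((p - 2) / 2)) := ⟨_, rfl⟩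
  have hm0 : 0 < m := by rw [hm]; positivity
  have hm1 : m ≤ 1 := hm ▸ min_le_left _ _
  have hml : m ≤ l ^ ((p - 2) / 2) := hm ▸ min_le_right _ _
  have hr₀0 : 0 < d / 4 * m := by positivity
  have hll : l ^ (2 - p) * (l ^ ((p - 2) / 2)) ^ 2 = 1 := by
    rw [← Real.rpow_natCast (l ^ ((p - 2) / 2)), ← Real.rpow_mul hl0.le, ← Real.rpow_add hl0]
    norm_num
  have hr₀2 : l ^ (2 - p) * (d / 4 * m) ^ 2 ≤ d := by
    calc l ^ (2 - p) * (d / 4 * m) ^ 2 ≤ l ^ (2 - p) * (d / 4 * (l ^ ((p - 2) / 2))) ^ 2 := by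
          gcongr
      _ = (l ^ (2 - p) * (l ^ ((p - 2) / 2)) ^ 2) * (d ^ 2 / 16) := by ring
      _ ≤ d := by rw [hll]; nlinarith
  refine level_estimate hq hqp hc₀ hc₀1 hg hRH hl1 hr₀0 hρ₁ hρ₂ (by rw [hd]; nlinarith)
    (by rw [hd]; exact hr₀2) ?_
  intro y b r hr hrr hsub
  have hr0 : 0 < r := lt_of_lt_of_le (by positivity) hr
  refine (lintegral_mono_set hsub).trans (hM.trans ?_)
  rw [volume_parCyl _ _ hr0, hωdef,
    ← ENNReal.ofReal_mul (by positivity), ← ENNReal.ofReal_mul (by positivity)]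
  apply ENNReal.ofReal_le_ofReal
  -- After cancelling l^p against l^{2-p}, what has to dominate M' is l² m^{n+2} times quantities
  -- independent of l. Its exponent in l is positive exactly when p > 2n/(n+2).
  have hmin : l ^ (min 2 (2 + (p - 2) / 2 * ((n : ℝ) + 2))) ≤ l ^ 2 * m ^ (n + 2) := by
    rcases min_cases 1 (l ^ ((p - 2) / 2)) with ⟨h, _⟩ | ⟨h, _⟩ <;> rw [← hm] at h
    · rw [h, one_pow, mul_one, ← Real.rpow_natCast]
      exact Real.rpow_le_rpow_of_exponent_le hl1 (by simp)
    · rw [h, ← Real.rpow_natCast, ← Real.rpow_natCast, ← Real.rpow_mul hl0.le,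
        ← Real.rpow_add hl0]
      refine Real.rpow_le_rpow_of_exponent_le hl1 ((min_le_right _ _).trans (le_of_eq ?_))
      push_cast
      ring
  have hdn : d ^ (-((n : ℝ) + 2)) * d ^ (n + 2) = 1 := by
    rw [← Real.rpow_natCast, ← Real.rpow_add hd0]
    push_cast
    rw [neg_add_cancel, Real.rpow_zero]
  obtain ⟨H, hHdef⟩ : ∃ H, H = 1 + M' * 40 ^ (n + 2) / ω := ⟨_, rfl⟩
  rw [← hHdef] at hl
  have hH0 : 0 ≤ H := by rw [hHdef]; positivity
  calc M' ≤ H * ω / 40 ^ (n + 2) := by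
        rw [hHdef, le_div_iff₀ (by positivity), add_mul, div_mul_cancel₀ _ hω.ne']
        linarith
    _ = H * d ^ (-((n : ℝ) + 2)) * (d ^ (n + 2) * ω / 40 ^ (n + 2)) := by
        rw [show H * d ^ (-((n : ℝ) + 2)) * (d ^ (n + 2) * ω / 40 ^ (n + 2))
          = H * (d ^ (-((n : ℝ) + 2)) * d ^ (n + 2)) * ω / 40 ^ (n + 2) by ring, hdn, mul_one]
    _ ≤ (l ^ 2 * m ^ (n + 2)) *
        (d ^ (n + 2) * ω / 40 ^ (n + 2)) := by
        exact mul_le_mul_of_nonneg_right (hl.trans hmin) (by positivity)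
    _ = l ^ 2 * ((d / 4 * m / 10) ^ (n + 2) * ω) := by
        rw [show d / 4 * m / 10
          = d * m / 40 by ring, div_pow, mul_pow]
        ring
    _ ≤ l ^ 2 * (r ^ (n + 2) * ω) := by gcongr
    _ = l ^ p * l ^ (2 - p) * (r ^ (n + 2) * ω) := by
        rw [← Real.rpow_add hl0, ← Real.rpow_natCast]
        norm_num
    _ = _ := by ring

/-- Gehring's lemma in the intrinsic geometry of the `p`-Laplacian. -/
theorem IntrinsicRevHolder.higher_integrability (n : ℕ) {p q c₀ : ℝ} (hq : 1 ≤ q) (hqp : q < p)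
    (hp : 2 * (n : ℝ) / ((n : ℝ) + 2) < p) (hc₀ : 0 < c₀) (hc₀1 : c₀ ≤ 1) :
    ∃ ε : ℝ, 0 < ε ∧ ∀ M : ℝ, ∃ C : ℝ, ∀ g : RVec n × ℝ → ℝ≥0, Measurable g →
      IntrinsicRevHolder p q c₀ g →
      ∫⁻ z in parCyl 0 0 1 1, (g z : ℝ≥0∞) ^ p ≤ ENNReal.ofReal M →
      ∫⁻ z in parCyl 0 0 (1 / 2) (1 / 2), (g z : ℝ≥0∞) ^ (p + ε) ≤ ENNReal.ofReal C := by
  have hpq : 0 < p - q := by linarith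
  set K : ℝ := 2 * 5 ^ (n + 2) with hK
  have hK0 : 1 ≤ K := by
    have : (1:ℝ) ≤ 5 ^ (n + 2) := one_le_pow₀ (by norm_num)
    linarith
  set c : ℝ := c₀ / 2 ^ (n + 3) / K with hc
  have hc0 : 0 < c := by positivity
  have hc1 : c ≤ 1 := by
    have : (1:ℝ) ≤ 2 ^ (n + 3) := one_le_pow₀ (by norm_num)
    rw [hc, div_le_one (by positivity), div_le_iff₀ (by positivity)]
    nlinarith
  set B : ℝ := 2 * 10 ^ (n + 2) / c₀ with hB
  have hB0 : 0 < B := by positivity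
  set D : ℝ := B * (1 / c) ^ (1 + p - q) / (p - q) with hD
  have hD0 : 0 < D := by positivity
  -- The coefficient εD of the integral over the larger cylinder becomes at most 1/2.
  set ε : ℝ := min 1 (1 / (2 * D)) with hεdef
  have hε : 0 < ε := by positivity
  have hε1 : ε ≤ 1 := min_le_left _ _
  have hεD : ε * D ≤ 1 / 2 := by
    calc ε * D ≤ 1 / (2 * D) * D := by gcongr; exact min_le_right _ _
      _ = 1 / 2 := by field_simp
  set β : ℝ := min 2 (2 + (p - 2) / 2 * (n + 2)) with hβdef
  have hβ : 0 < β := by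
    refine lt_min two_pos ?_
    rw [div_lt_iff₀ (by positivity)] at hp
    linarith
  set ω : ℝ := (volume (Metric.ball (0 : RVec n) 1)).toReal with hωdef
  have hωt : volume (Metric.ball (0 : RVec n) 1) ≠ ⊤ := measure_ball_lt_top.ne
  have hω : 0 < ω := ENNReal.toReal_pos (Metric.measure_ball_pos _ _ one_pos).ne' hωt
  refine ⟨ε, hε, fun M => ?_⟩
  set M' : ℝ := max M 0 with hM'
  have hM'0 : 0 ≤ M' := le_max_right _ _
  set H : ℝ := 1 + M' * 40 ^ (n + 2) / ω with hHdef
  have hH1 : 1 ≤ H := by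
    have : 0 ≤ M' * 40 ^ (n + 2) / ω := by positivity
    linarith
  set γ : ℝ := (n + 2) / β with hγdef
  have hγ : 0 < γ := by positivity
  set A : ℝ := K * H ^ (1 / β) * M' with hA
  refine ⟨4 * (A * ((1 - (2 / 3 : ℝ) ^ (1 / γ)) / 2) ^ (-γ)), fun g hg hRH hM => ?_⟩
  replace hM : ∫⁻ z in parCyl 0 0 1 1, (g z : ℝ≥0∞) ^ p ≤ ENNReal.ofReal M' :=
    hM.trans (ENNReal.ofReal_le_ofReal (le_max_left _ _))
  have hstep : ∀ k : ℝ, 0 < k → ∀ ρ₁ ρ₂, 1 / 2 ≤ ρ₁ → ρ₁ < ρ₂ → ρ₂ ≤ 1 →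
      ∫⁻ z in parCyl 0 0 ρ₁ ρ₁, (g z : ℝ≥0∞) ^ p * ENNReal.ofReal ((min (g z : ℝ) k) ^ ε)
      ≤ ENNReal.ofReal (A * (ρ₂ - ρ₁) ^ (-γ)) + ENNReal.ofReal (1 / 2) *
        ∫⁻ z in parCyl 0 0 ρ₂ ρ₂, (g z : ℝ≥0∞) ^ p * ENNReal.ofReal ((min (g z : ℝ) k) ^ ε) := by
    intro k hk ρ₁ ρ₂ h1 h2 h3
    set d := ρ₂ - ρ₁ with hd
    have hd0 : 0 < d := by linarith
    have hd1 : d ≤ 1 / 2 := by linarith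
    -- The least l that the large-level hypothesis allows, obtained by solving Λ^β = H d^{-(n+2)}.
    -- The level estimate then holds for all t = K l with l ≥ Λ, and Λ is a negative power of the
    -- gap, as the iteration requires.
    set Λ : ℝ := H ^ (1 / β) * d ^ (-γ) with hΛ
    have hΛ1 : 1 ≤ Λ := by
      refine one_le_mul_of_one_le_of_one_le (Real.one_le_rpow hH1 (by positivity)) ?_
      exact Real.one_le_rpow_of_pos_of_le_one_of_nonpos hd0 (by linarith) (by linarith)
    have hΛβ : Λ ^ β = H * d ^ (-((n : ℝ) + 2)) := by
      rw [hΛ, Real.mul_rpow (by positivity) (by positivity), ← Real.rpow_mul (by positivity),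
        ← Real.rpow_mul hd0.le]
      congr 1
      · rw [one_div_mul_cancel hβ.ne', Real.rpow_one]
      · rw [hγdef]; field_simp
    have hlev : ∀ t, K * Λ < t → ∫⁻ z in parCyl 0 0 ρ₁ ρ₁ ∩ {z | t < g z}, (g z : ℝ≥0∞) ^ p
        ≤ ENNReal.ofReal (B * t ^ (p - q)) *
          ∫⁻ z in parCyl 0 0 ρ₂ ρ₂ ∩ {z | c * t < g z}, (g z : ℝ≥0∞) ^ q := by
      intro t ht
      have hK0' : 0 < K := by linarith
      have hlΛ : Λ ≤ t / K := by rw [le_div_iff₀ hK0']; linarith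
      have ht0 : 0 < t := lt_of_le_of_lt (by positivity) ht
      generalize hl : t / K = l at hlΛ
      have htl : t = K * l := by rw [← hl]; field_simp
      have hl1 : 1 ≤ l := hΛ1.trans hlΛ
      have hl0 : 0 < l := by linarith
      have hest := level_estimate_of_large hq hqp hc₀ hc₀1 hg hRH hM'0 hM hω
        (ENNReal.ofReal_toReal hωt).symm (by linarith : 0 < ρ₁) h2 h3 hl1 (by
          refine hΛβ.symm.le.trans ?_
          gcongr)
      rw [htl, show c * (K * l) = c₀ / 2 ^ (n + 3) * l by rw [hc]; field_simp]
      refine hest.trans ?_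
      gcongr
      nlinarith
    have := lintegral_mul_truncated_rpow_le (μ := volume) hg (by linarith : 0 < q) hqp hB0.le hc0 hc1
      (by positivity : 0 < K * Λ) hε hε1 hk hlev
    refine this.trans (add_le_add ?_ ?_)
    · have hKΛ : 1 ≤ K * Λ := one_le_mul_of_one_le_of_one_le hK0 hΛ1
      calc _ ≤ ENNReal.ofReal (K * Λ) * ENNReal.ofReal M' := by
            gcongr
            · exact (Real.rpow_le_rpow_of_exponent_le hKΛ hε1).trans_eq (Real.rpow_one _)
            · refine (lintegral_mono_set ?_).trans hM
              exact parCyl_subset (by simp; linarith) (by linarith) le_rfl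
        _ = _ := by
            rw [← ENNReal.ofReal_mul (by positivity)]
            congr 1
            rw [hA, hΛ]
            ring
    · gcongr
  have hk : ∀ k : ℕ, ∫⁻ z in parCyl 0 0 (1 / 2) (1 / 2),
      (g z : ℝ≥0∞) ^ p * ENNReal.ofReal ((min (g z : ℝ) (k + 1)) ^ ε)
      ≤ ENNReal.ofReal (4 * (A * ((1 - (2 / 3 : ℝ) ^ (1 / γ)) / 2) ^ (-γ))) := by
    intro k
    have hk0 : (0 : ℝ) < k + 1 := by positivity
    refine iteration_absorb (Φ := fun ρ => ∫⁻ z in parCyl (0 : RVec n) 0 ρ ρ,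
      (g z : ℝ≥0∞) ^ p * ENNReal.ofReal ((min (g z : ℝ) (k + 1)) ^ ε))
      (D := ENNReal.ofReal M' * ENNReal.ofReal (((k : ℝ) + 1) ^ ε)) (by positivity) hγ
      (ENNReal.mul_ne_top ENNReal.ofReal_ne_top ENNReal.ofReal_ne_top) ?_ (hstep _ hk0)
    intro ρ hρ
    calc _ ≤ ∫⁻ z in parCyl 0 0 1 1, (g z : ℝ≥0∞) ^ p * ENNReal.ofReal (((k : ℝ) + 1) ^ ε) := by
          refine lintegral_mono' (Measure.restrict_mono (parCyl_subset (by simpa using hρ)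
            (by linarith) le_rfl) le_rfl) fun z => ?_
          have : 0 ≤ min (g z : ℝ) (k + 1) := le_min (g z).coe_nonneg hk0.le
          gcongr
          exact min_le_right _ _
      _ ≤ _ := by
          rw [lintegral_mul_const _ (by fun_prop)]
          gcongr
  have hgm : Measurable fun z => (g z : ℝ) := hg.coe_nnreal_real
  -- The bound is uniform in the truncation, so monotone convergence removes it.
  have htend := lintegral_tendsto_of_tendsto_of_monotone
    (μ := volume.restrict (parCyl (0 : RVec n) 0 (1 / 2) (1 / 2)))
    (f := fun (k : ℕ) z => (g z : ℝ≥0∞) ^ p * ENNReal.ofReal ((min (g z : ℝ) (k + 1)) ^ ε))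
    (F := fun z => (g z : ℝ≥0∞) ^ (p + ε)) (fun k => by fun_prop) ?_ ?_
  · exact le_of_tendsto' htend hk
  · refine Filter.Eventually.of_forall fun z k k' hkk => ?_
    have : 0 ≤ min (g z : ℝ) (k + 1) := le_min (g z).coe_nonneg (by positivity)
    have hkk' : (k : ℝ) ≤ k' := by exact_mod_cast hkk
    dsimp only
    gcongr
  · refine Filter.Eventually.of_forall fun z => tendsto_const_nhds.congr' ?_
    obtain ⟨N, hN⟩ := exists_nat_ge (g z : ℝ)
    filter_upwards [Filter.eventually_ge_atTop N] with k hk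
    have hk' : (N : ℝ) ≤ k := by exact_mod_cast hk
    rw [min_eq_left (by linarith), ← coe_nnreal_rpow_eq_ofReal _ hε.le,
      ENNReal.rpow_add_of_nonneg _ _ (by linarith) hε.le]

/-! ### Restriction and rescaling of approximate solutions. -/

theorem IsTestFun.mono {n : ℕ} {F : Type*} [NormedAddCommGroup F] [NormedSpace ℝ F]
    {x₀ x₁ : RVec n} {t₀ t₁ R R₁ ρ ρ₁ : ℝ} {φ : RVec n × ℝ → F} (h : IsTestFun x₁ t₁ R₁ ρ₁ φ)
    (hsub : parCylInt x₁ t₁ R₁ ρ₁ ⊆ parCylInt x₀ t₀ R ρ) : IsTestFun x₀ t₀ R ρ φ :=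
  ⟨h.contDiff, h.compactSupport, h.support_subset.trans hsub⟩

theorem parCylInt_subset_parCyl {n : ℕ} (x₀ : RVec n) (t₀ R ρ : ℝ) :
    parCylInt x₀ t₀ R ρ ⊆ parCyl x₀ t₀ R ρ :=
  prod_mono_right Ioo_subset_Icc_self

theorem parCyl_subset_iff_of_pos {n : ℕ} {x₀ x₁ : RVec n} {t₀ t₁ R R₁ ρ ρ₁ : ℝ} (hR₁ : 0 < R₁)
    (hρ₁ : 0 < ρ₁) (hsub : parCyl x₁ t₁ R₁ ρ₁ ⊆ parCyl x₀ t₀ R ρ) :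
    Metric.ball x₁ R₁ ⊆ Metric.ball x₀ R ∧ Icc (t₁ - ρ₁) t₁ ⊆ Icc (t₀ - ρ) t₀ :=
  (prod_subset_prod_iff.1 hsub).resolve_right (by
    rintro (h | h)
    · exact (Metric.nonempty_ball.2 hR₁).ne_empty h
    · exact (nonempty_Icc.2 (by linarith)).ne_empty h)

theorem parCylInt_subset_parCylInt {n : ℕ} {x₀ x₁ : RVec n} {t₀ t₁ R R₁ ρ ρ₁ : ℝ} (hR₁ : 0 < R₁)
    (hρ₁ : 0 < ρ₁) (hsub : parCyl x₁ t₁ R₁ ρ₁ ⊆ parCyl x₀ t₀ R ρ) :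
    parCylInt x₁ t₁ R₁ ρ₁ ⊆ parCylInt x₀ t₀ R ρ := by
  obtain ⟨h1, h2⟩ := parCyl_subset_iff_of_pos hR₁ hρ₁ hsub
  refine prod_mono h1 ?_
  rw [← interior_Icc, ← interior_Icc]
  exact interior_mono h2

theorem IsTestFun.spaceDeriv_eq_zero {n : ℕ} {F : Type*} [NormedAddCommGroup F] [NormedSpace ℝ F]
    {x₀ : RVec n} {t₀ R ρ : ℝ} {φ : RVec n × ℝ → F} (h : IsTestFun x₀ t₀ R ρ φ)
    {z : RVec n × ℝ} (hz : z ∉ parCyl x₀ t₀ R ρ) (j : Fin n) : spaceDeriv φ j z = 0 := by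
  have : z ∉ tsupport φ := fun h' => hz (parCylInt_subset_parCyl _ _ _ _ (h.support_subset h'))
  rw [spaceDeriv, image_eq_zero_of_notMem_tsupport fun h' => this (tsupport_fderiv_subset ℝ h')]
  rfl

theorem IsTestFun.eq_zero {n : ℕ} {F : Type*} [NormedAddCommGroup F] [NormedSpace ℝ F]
    {x₀ : RVec n} {t₀ R ρ : ℝ} {φ : RVec n × ℝ → F} (h : IsTestFun x₀ t₀ R ρ φ)
    {z : RVec n × ℝ} (hz : z ∉ parCyl x₀ t₀ R ρ) : φ z = 0 :=
  image_eq_zero_of_notMem_tsupport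
    fun h' => hz (parCylInt_subset_parCyl _ _ _ _ (h.support_subset h'))

theorem setIntegral_eq_of_subset_of_eq_zero {α : Type*} [MeasurableSpace α] {μ : Measure α}
    {s t : Set α} {f : α → ℝ} (hs : MeasurableSet s) (ht : MeasurableSet t) (hst : s ⊆ t)
    (hf : ∀ x, x ∉ s → f x = 0) : ∫ x in t, f x ∂μ = ∫ x in s, f x ∂μ := by
  rw [← integral_indicator hs, ← integral_indicator ht]
  congr 1
  ext x
  by_cases hx : x ∈ s
  · simp [hx, hst hx]
  · simp [indicator, hx, hf x hx]

theorem MemVp.mono {m n : ℕ} {p : ℝ} {x₀ x₁ : RVec n} {t₀ t₁ R R₁ ρ ρ₁ : ℝ} (hR₁ : 0 < R₁)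
    (hρ₁ : 0 < ρ₁) (hsub : parCyl x₁ t₁ R₁ ρ₁ ⊆ parCyl x₀ t₀ R ρ)
    {u : RVec n × ℝ → RVec m} {Du : RVec n × ℝ → RGrad m n} (h : MemVp p x₀ t₀ R ρ u Du) :
    MemVp p x₁ t₁ R₁ ρ₁ u Du where
  aestronglyMeasurable := h.aestronglyMeasurable.mono_measure (Measure.restrict_mono hsub le_rfl)
  sup_sq := by
    obtain ⟨h1, h2⟩ := parCyl_subset_iff_of_pos hR₁ hρ₁ hsub
    obtain ⟨K, hK⟩ := h.sup_sq
    refine ⟨K, ?_⟩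
    filter_upwards [ae_mono (Measure.restrict_mono h2 le_rfl) hK] with t ht
    exact (lintegral_mono_set h1).trans ht
  memLp_grad := h.memLp_grad.mono_measure (Measure.restrict_mono hsub le_rfl)
  weak_grad := by
    intro ψ hψ i j
    have hψ' := hψ.mono (parCylInt_subset_parCylInt hR₁ hρ₁ hsub)
    rw [← setIntegral_eq_of_subset_of_eq_zero (measurableSet_parCyl _ _ _ _)
      (measurableSet_parCyl _ _ _ _) hsub fun z hz => by rw [hψ.spaceDeriv_eq_zero hz, mul_zero],
      ← setIntegral_eq_of_subset_of_eq_zero (measurableSet_parCyl _ _ _ _)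
      (measurableSet_parCyl _ _ _ _) hsub fun z hz => by rw [hψ.eq_zero hz, mul_zero]]
    exact h.weak_grad ψ hψ' i j

theorem IsApproxWeakSol.mono {m n : ℕ} {p δ : ℝ} {A : RVec m → RGrad m n → RGrad m n}
    {x₀ x₁ : RVec n} {t₀ t₁ R R₁ ρ ρ₁ : ℝ} (hR₁ : 0 < R₁)
    (hρ₁ : 0 < ρ₁) (hsub : parCyl x₁ t₁ R₁ ρ₁ ⊆ parCyl x₀ t₀ R ρ)
    {u : RVec n × ℝ → RVec m} {Du : RVec n × ℝ → RGrad m n}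
    (h : IsApproxWeakSol p δ A x₀ t₀ R ρ u Du) : IsApproxWeakSol p δ A x₁ t₁ R₁ ρ₁ u Du where
  memVp := h.memVp.mono hR₁ hρ₁ hsub
  flux_measurable := h.flux_measurable.mono_measure (Measure.restrict_mono hsub le_rfl)
  approx := fun y s r σ hr hσ hs φ hφ => h.approx y s r σ hr hσ (hs.trans hsub) φ hφ

/-- The parabolic change of variables `(x, t) ↦ (y + r x, τ + s t)`. -/
def parHomeo {n : ℕ} (y : RVec n) (τ : ℝ) {r s : ℝ} (hr : r ≠ 0) (hs : s ≠ 0) :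
    RVec n × ℝ ≃ₜ RVec n × ℝ where
  toFun z := (y + r • z.1, τ + s * z.2)
  invFun z := (r⁻¹ • (z.1 - y), s⁻¹ * (z.2 - τ))
  left_inv z := by ext <;> simp [hr, hs]
  right_inv z := by ext <;> simp [hr, hs]
  continuous_toFun := by fun_prop
  continuous_invFun := by fun_prop

section parHomeo

variable {n : ℕ} (y : RVec n) (τ : ℝ) {r s : ℝ} (hr : 0 < r) (hs : 0 < s)

theorem map_parHomeo :
    Measure.map (parHomeo y τ hr.ne' hs.ne') (volume : Measure (RVec n × ℝ))
      = ENNReal.ofReal ((r ^ n * s)⁻¹) • (volume : Measure (RVec n × ℝ)) := by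
  have h1 : Measure.map (fun x : RVec n => y + r • x) volume
      = ENNReal.ofReal ((r ^ n)⁻¹) • (volume : Measure (RVec n)) := by
    have : (fun x : RVec n => y + r • x) = (fun x => y + x) ∘ (fun x => r • x) := rfl
    rw [this, ← Measure.map_map (by fun_prop) (by fun_prop), Measure.map_addHaar_smul _ hr.ne',
      Measure.map_smul, map_add_left_eq_self, finrank_euclideanSpace_fin,
      abs_of_pos (by positivity)]
  have h2 : Measure.map (fun t : ℝ => τ + s * t) volume
      = ENNReal.ofReal (s⁻¹) • (volume : Measure ℝ) := by
    have : (fun t : ℝ => τ + s * t) = (fun x => τ + x) ∘ (fun x => s • x) := rfl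
    rw [this, ← Measure.map_map (by fun_prop) (by fun_prop), Measure.map_addHaar_smul _ hs.ne',
      Measure.map_smul, map_add_left_eq_self, Module.finrank_self, pow_one,
      abs_of_pos (by positivity)]
  have h3 : (parHomeo y τ hr.ne' hs.ne' : RVec n × ℝ → RVec n × ℝ)
      = Prod.map (fun x : RVec n => y + r • x) (fun t : ℝ => τ + s * t) := rfl
  rw [h3, Measure.volume_eq_prod, ← Measure.map_prod_map _ _ (by fun_prop) (by fun_prop), h1, h2,
    Measure.prod_smul_left, Measure.prod_smul_right, smul_smul, ← ENNReal.ofReal_mul (by positivity),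
    mul_inv]

theorem parHomeo_preimage_parCyl (x₁ : RVec n) (t₁ R₁ ρ₁ : ℝ) :
    parHomeo y τ hr.ne' hs.ne' ⁻¹' parCyl (y + r • x₁) (τ + s * t₁) (r * R₁) (s * ρ₁)
      = parCyl x₁ t₁ R₁ ρ₁ := by
  ext z
  have : dist (y + r • z.1) (y + r • x₁) = r * dist z.1 x₁ := by
    rw [dist_add_left, dist_smul₀, Real.norm_of_nonneg hr.le]
  simp only [mem_preimage, mem_parCyl]
  change dist (y + r • z.1) (y + r • x₁) < _ ∧ _ ≤ τ + s * z.2 ∧ τ + s * z.2 ≤ _ ↔ _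
  rw [this, mul_lt_mul_iff_right₀ hr]
  refine and_congr Iff.rfl (and_congr ?_ ?_)
  · rw [← mul_le_mul_iff_right₀ hs (b := t₁ - ρ₁)]
    constructor <;> intro h <;> linarith
  · rw [← mul_le_mul_iff_right₀ hs (c := t₁)]
    constructor <;> intro h <;> linarith

theorem parHomeo_preimage_parCylInt (x₁ : RVec n) (t₁ R₁ ρ₁ : ℝ) :
    parHomeo y τ hr.ne' hs.ne' ⁻¹' parCylInt (y + r • x₁) (τ + s * t₁) (r * R₁) (s * ρ₁)
      = parCylInt x₁ t₁ R₁ ρ₁ := by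
  ext z
  have : dist (y + r • z.1) (y + r • x₁) = r * dist z.1 x₁ := by
    rw [dist_add_left, dist_smul₀, Real.norm_of_nonneg hr.le]
  simp only [mem_preimage, parCylInt, mem_prod, Metric.mem_ball, mem_Ioo]
  change dist (y + r • z.1) (y + r • x₁) < _ ∧ _ < τ + s * z.2 ∧ τ + s * z.2 < _ ↔ _
  rw [this, mul_lt_mul_iff_right₀ hr]
  refine and_congr Iff.rfl (and_congr ?_ ?_)
  · rw [← mul_lt_mul_iff_right₀ hs (b := t₁ - ρ₁)]
    constructor <;> intro h <;> linarith
  · rw [← mul_lt_mul_iff_right₀ hs (c := t₁)]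
    constructor <;> intro h <;> linarith

theorem map_parHomeo_restrict (x₁ : RVec n) (t₁ R₁ ρ₁ : ℝ) :
    Measure.map (parHomeo y τ hr.ne' hs.ne') (volume.restrict (parCyl x₁ t₁ R₁ ρ₁))
      = ENNReal.ofReal ((r ^ n * s)⁻¹) •
        (volume.restrict (parCyl (y + r • x₁) (τ + s * t₁) (r * R₁) (s * ρ₁))) := by
  rw [← Measure.restrict_smul, ← map_parHomeo y τ hr hs,
    Measure.restrict_map (parHomeo y τ hr.ne' hs.ne').continuous.measurable
      (measurableSet_parCyl _ _ _ _), parHomeo_preimage_parCyl y τ hr hs]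

theorem setIntegral_comp_parHomeo {F : Type*} [NormedAddCommGroup F] [NormedSpace ℝ F]
    (f : RVec n × ℝ → F) (x₁ : RVec n) (t₁ R₁ ρ₁ : ℝ) :
    ∫ z in parCyl x₁ t₁ R₁ ρ₁, f (parHomeo y τ hr.ne' hs.ne' z)
      = (r ^ n * s)⁻¹ • ∫ z in parCyl (y + r • x₁) (τ + s * t₁) (r * R₁) (s * ρ₁), f z := by
  rw [← (parHomeo y τ hr.ne' hs.ne').measurableEmbedding.integral_map, map_parHomeo_restrict y τ hr hs,
    integral_smul_measure, ENNReal.toReal_ofReal (by positivity)]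

theorem setLIntegral_comp_parHomeo
    (f : RVec n × ℝ → ℝ≥0∞) (x₁ : RVec n) (t₁ R₁ ρ₁ : ℝ) :
    ∫⁻ z in parCyl x₁ t₁ R₁ ρ₁, f (parHomeo y τ hr.ne' hs.ne' z)
      = ENNReal.ofReal ((r ^ n * s)⁻¹) *
        ∫⁻ z in parCyl (y + r • x₁) (τ + s * t₁) (r * R₁) (s * ρ₁), f z := by
  rw [← (parHomeo y τ hr.ne' hs.ne').measurableEmbedding.lintegral_map, map_parHomeo_restrict y τ hr hs,
    lintegral_smul_measure, smul_eq_mul]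

theorem fderiv_comp_parHomeo_symm {F : Type*} [NormedAddCommGroup F] [NormedSpace ℝ F]
    {φ : RVec n × ℝ → F} (hφ : ContDiff ℝ 1 φ) (z v : RVec n × ℝ) :
    fderiv ℝ (fun w => φ ((parHomeo y τ hr.ne' hs.ne').symm w)) (parHomeo y τ hr.ne' hs.ne' z) v
      = fderiv ℝ φ z (r⁻¹ • v.1, s⁻¹ * v.2) := by
  have h1 : HasFDerivAt φ (fderiv ℝ φ z) ((parHomeo y τ hr.ne' hs.ne').symm
      (parHomeo y τ hr.ne' hs.ne' z)) := by
    rw [Homeomorph.symm_apply_apply]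
    exact (hφ.differentiable one_ne_zero z).hasFDerivAt
  have h2 : HasFDerivAt (fun w : RVec n × ℝ => (r⁻¹ • (w.1 - y), s⁻¹ * (w.2 - τ)))
      ((r⁻¹ • ContinuousLinearMap.fst ℝ (RVec n) ℝ).prod (s⁻¹ • ContinuousLinearMap.snd ℝ (RVec n) ℝ))
      (parHomeo y τ hr.ne' hs.ne' z) := by
    refine HasFDerivAt.prodMk ?_ ?_
    · exact (hasFDerivAt_fst.sub_const y).const_smul r⁻¹
    · exact (hasFDerivAt_snd.sub_const τ).const_smul s⁻¹
  have h3 := (HasFDerivAt.comp (parHomeo y τ hr.ne' hs.ne' z) (g := φ)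
    (f := fun w => (parHomeo y τ hr.ne' hs.ne').symm w) h1 h2).fderiv
  change fderiv ℝ (φ ∘ fun w => (parHomeo y τ hr.ne' hs.ne').symm w) _ v = _
  rw [h3]
  rfl

theorem IsTestFun.comp_parHomeo_symm {F : Type*} [NormedAddCommGroup F] [NormedSpace ℝ F]
    {φ : RVec n × ℝ → F} {x₁ : RVec n} {t₁ R₁ ρ₁ : ℝ} (hφ : IsTestFun x₁ t₁ R₁ ρ₁ φ) :
    IsTestFun (y + r • x₁) (τ + s * t₁) (r * R₁) (s * ρ₁)
      (fun w => φ ((parHomeo y τ hr.ne' hs.ne').symm w)) where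
  contDiff := by
    refine hφ.contDiff.comp (g := φ) ?_
    change ContDiff ℝ 1 (fun w : RVec n × ℝ => (r⁻¹ • (w.1 - y), s⁻¹ * (w.2 - τ)))
    fun_prop
  compactSupport := hφ.compactSupport.comp_homeomorph (parHomeo y τ hr.ne' hs.ne').symm
  support_subset := by
    have : tsupport (fun w => φ ((parHomeo y τ hr.ne' hs.ne').symm w))
        = (parHomeo y τ hr.ne' hs.ne').symm ⁻¹' tsupport φ :=
      tsupport_comp_eq_preimage φ (parHomeo y τ hr.ne' hs.ne').symm
    rw [this]
    intro w hw
    have h1 := hφ.support_subset hw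
    rw [← parHomeo_preimage_parCylInt y τ hr hs, mem_preimage, Homeomorph.apply_symm_apply] at h1
    exact h1

end parHomeo

/-- Both bounds are homogeneous of degree p - 1 in ζ (after pairing) and uniform in w, so the
constants do not change. -/
theorem EllipticE.rescale {m n : ℕ} {p lam Lam : ℝ} {A : RVec m → RGrad m n → RGrad m n}
    (hA : EllipticE p lam Lam A) {r μ : ℝ} (hr : 0 < r) (hμ : 0 < μ) :
    EllipticE p lam Lam (fun w ζ => (r / μ) ^ (p - 1) • A (μ • w) ((μ / r) • ζ)) := by
  have h0 : 0 < r / μ := by positivity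
  have h1 : 0 < (r / μ) ^ (p - 1) := by positivity
  have h2 : (r / μ) ^ (p - 1) * (μ / r) ^ (p - 1) = 1 := by
    rw [← Real.mul_rpow (by positivity) (by positivity), show r / μ * (μ / r) = 1 by field_simp,
      Real.one_rpow]
  constructor
  · intro w ζ
    have h := hA.lower (μ • w) ((μ / r) • ζ)
    rw [inner_smul_right, norm_smul, Real.norm_of_nonneg (by positivity),
      Real.mul_rpow (by positivity) (norm_nonneg _)] at h
    rw [real_inner_smul_left]
    have h3 : (μ / r) ^ p = (μ / r) ^ (p - 1) * (μ / r) := by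
      rw [← Real.rpow_add_one (by positivity)]; ring_nf
    have h4 := mul_le_mul_of_nonneg_left h (mul_pos h1 h0).le
    have e1 : (r / μ) ^ (p - 1) * (r / μ) * (lam * ((μ / r) ^ p * ‖ζ‖ ^ p)) = lam * ‖ζ‖ ^ p := by
      rw [h3]
      calc _ = ((r / μ) ^ (p - 1) * (μ / r) ^ (p - 1)) * (r / μ * (μ / r)) * (lam * ‖ζ‖ ^ p) := by
            ring
        _ = _ := by rw [h2, show r / μ * (μ / r) = 1 by field_simp]; ring
    rw [e1] at h4
    refine h4.trans (le_of_eq ?_)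
    field_simp
  · intro w ζ η
    have h := hA.upper (μ • w) ((μ / r) • ζ) η
    rw [norm_smul, Real.norm_of_nonneg (by positivity),
      Real.mul_rpow (by positivity) (norm_nonneg _)] at h
    rw [real_inner_smul_left, abs_mul, abs_of_pos h1]
    refine (mul_le_mul_of_nonneg_left h h1.le).trans (le_of_eq ?_)
    calc _ = ((r / μ) ^ (p - 1) * (μ / r) ^ (p - 1)) * (Lam * ‖ζ‖ ^ (p - 1) * ‖η‖) := by ring
      _ = _ := by rw [h2, one_mul]

variable {m n : ℕ} {p δ : ℝ} {A : RVec m → RGrad m n → RGrad m n}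
  {u : RVec n × ℝ → RVec m} {Du : RVec n × ℝ → RGrad m n}

theorem MemVp.rescale {y : RVec n} {τ r s μ : ℝ} (hr : 0 < r) (hs : 0 < s)
    (hμ : 0 < μ) {x₁ : RVec n} {t₁ R₁ ρ₁ : ℝ}
    (h : MemVp p (y + r • x₁) (τ + s * t₁) (r * R₁) (s * ρ₁) u Du) :
    MemVp p x₁ t₁ R₁ ρ₁ (fun z => μ⁻¹ • u (parHomeo y τ hr.ne' hs.ne' z))
      (fun z => (r / μ) • Du (parHomeo y τ hr.ne' hs.ne' z)) where
  aestronglyMeasurable := by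
    have : AEStronglyMeasurable (u ∘ parHomeo y τ hr.ne' hs.ne')
        (volume.restrict (parCyl x₁ t₁ R₁ ρ₁)) := by
      refine AEStronglyMeasurable.comp_measurable (g := u) ?_
        (parHomeo y τ hr.ne' hs.ne').continuous.measurable
      rw [map_parHomeo_restrict y τ hr hs]
      exact h.aestronglyMeasurable.smul_measure _
    exact this.const_smul μ⁻¹
  sup_sq := by
    obtain ⟨K, hK⟩ := h.sup_sq
    set e : ℝ≃ₜ ℝ :=
      ⟨⟨fun t => τ + s * t, fun t => s⁻¹ * (t - τ), fun t => by simp [hs.ne'],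
        fun t => by simp [hs.ne']⟩, by fun_prop, by fun_prop⟩ with he
    have hq : Measure.QuasiMeasurePreserving e
        (volume.restrict (Icc (t₁ - ρ₁) t₁))
        (volume.restrict (Icc (τ + s * t₁ - s * ρ₁) (τ + s * t₁))) := by
      refine ⟨e.continuous.measurable, ?_⟩
      have hpre : e ⁻¹' (Icc (τ + s * t₁ - s * ρ₁) (τ + s * t₁)) = Icc (t₁ - ρ₁) t₁ := by
        ext t
        change (_ ≤ τ + s * t ∧ τ + s * t ≤ _) ↔ _
        refine and_congr ?_ ?_
        · rw [← mul_le_mul_iff_right₀ hs (b := t₁ - ρ₁)]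
          constructor <;> intro h <;> linarith
        · rw [← mul_le_mul_iff_right₀ hs (c := t₁)]
          constructor <;> intro h <;> linarith
      rw [← hpre, ← Measure.restrict_map e.continuous.measurable measurableSet_Icc]
      have : Measure.map e volume = ENNReal.ofReal |s⁻¹| • (volume : Measure ℝ) := by
        have h2 : (e : ℝ → ℝ) = (fun x => τ + x) ∘ (fun x => s • x) := rfl
        rw [h2, ← Measure.map_map (by fun_prop) (by fun_prop), Measure.map_addHaar_smul _ hs.ne',
          Measure.map_smul, map_add_left_eq_self, Module.finrank_self, pow_one]
      rw [this, Measure.restrict_smul]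
      exact Measure.smul_absolutelyContinuous
    set c : ℝ≥0∞ := ‖μ⁻¹‖ₑ ^ 2 * ENNReal.ofReal |(r ^ n)⁻¹| with hc
    have hct : c ≠ ⊤ := ENNReal.mul_ne_top (ENNReal.pow_ne_top enorm_ne_top) ENNReal.ofReal_ne_top
    refine ⟨c.toNNReal * K, ?_⟩
    filter_upwards [hq.ae hK] with t ht
    have hm : Measure.map (fun x : RVec n => y + r • x) (volume.restrict (Metric.ball x₁ R₁))
        = ENNReal.ofReal |(r ^ n)⁻¹| • volume.restrict (Metric.ball (y + r • x₁) (r * R₁)) := by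
      have h1 : Measure.map (fun x : RVec n => y + r • x) volume
          = ENNReal.ofReal |(r ^ n)⁻¹| • (volume : Measure (RVec n)) := by
        have : (fun x : RVec n => y + r • x) = (fun x => y + x) ∘ (fun x => r • x) := rfl
        rw [this, ← Measure.map_map (by fun_prop) (by fun_prop), Measure.map_addHaar_smul _ hr.ne',
          Measure.map_smul, map_add_left_eq_self, finrank_euclideanSpace_fin]
      rw [← Measure.restrict_smul, ← h1, Measure.restrict_map (by fun_prop) measurableSet_ball]
      congr 2
      ext x
      rw [mem_preimage, Metric.mem_ball, Metric.mem_ball, dist_add_left, dist_smul₀,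
        Real.norm_of_nonneg hr.le, mul_lt_mul_iff_right₀ hr]
    have hemb : MeasurableEmbedding (fun x : RVec n => y + r • x) :=
      ((Homeomorph.smulOfNeZero r hr.ne').trans (Homeomorph.addLeft y)).measurableEmbedding
    calc ∫⁻ x in Metric.ball x₁ R₁, ‖μ⁻¹ • u (parHomeo y τ hr.ne' hs.ne' (x, t))‖ₑ ^ 2
        = ∫⁻ x in Metric.ball x₁ R₁, ‖μ⁻¹‖ₑ ^ 2 * ‖u (y + r • x, e t)‖ₑ ^ 2 := by
          refine lintegral_congr fun x => ?_
          rw [enorm_smul, mul_pow]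
          rfl
      _ = c * ∫⁻ x in Metric.ball (y + r • x₁) (r * R₁), ‖u (x, e t)‖ₑ ^ 2 := by
          rw [lintegral_const_mul' _ _ (ENNReal.pow_ne_top enorm_ne_top),
            ← hemb.lintegral_map (fun x => ‖u (x, e t)‖ₑ ^ 2), hm, lintegral_smul_measure,
            smul_eq_mul, hc, mul_assoc]
      _ ≤ c * K := by gcongr
      _ = _ := by rw [ENNReal.coe_mul, ENNReal.coe_toNNReal hct]
  memLp_grad := by
    refine MemLp.const_smul (f := Du ∘ parHomeo y τ hr.ne' hs.ne') ?_ (r / μ)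
    refine (memLp_map_measure_iff (g := Du) ?_
      (parHomeo y τ hr.ne' hs.ne').continuous.measurable.aemeasurable).1 ?_
    · rw [map_parHomeo_restrict y τ hr hs]
      exact h.memLp_grad.aestronglyMeasurable.smul_measure _
    · rw [map_parHomeo_restrict y τ hr hs]
      exact h.memLp_grad.smul_measure ENNReal.ofReal_ne_top
  weak_grad := by
    intro ψ hψ i j
    have h1 := h.weak_grad _ (hψ.comp_parHomeo_symm y τ hr hs) i j
    have h2 : ∀ z, spaceDeriv ψ j z = r * spaceDeriv
        (fun w => ψ ((parHomeo y τ hr.ne' hs.ne').symm w)) j (parHomeo y τ hr.ne' hs.ne' z) := by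
      intro z
      rw [spaceDeriv, spaceDeriv, fderiv_comp_parHomeo_symm y τ hr hs hψ.contDiff, mul_zero]
      have : (r⁻¹ • (EuclideanSpace.single j (1:ℝ) : RVec n), (0 : ℝ))
        = r⁻¹ • ((EuclideanSpace.single j (1:ℝ) : RVec n), (0 : ℝ)) := by simp
      rw [this, map_smul, smul_eq_mul, mul_inv_cancel_left₀ hr.ne']
    have h3 : ∀ z, ψ z = (fun w => ψ ((parHomeo y τ hr.ne' hs.ne').symm w))
        (parHomeo y τ hr.ne' hs.ne' z) := fun z => by simp
    have e1 := setIntegral_comp_parHomeo y τ hr hs (fun w => u w i * spaceDeriv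
        (fun w => ψ ((parHomeo y τ hr.ne' hs.ne').symm w)) j w) x₁ t₁ R₁ ρ₁
    have e2 := setIntegral_comp_parHomeo y τ hr hs (fun w => Du w (i, j) *
        (fun w => ψ ((parHomeo y τ hr.ne' hs.ne').symm w)) w) x₁ t₁ R₁ ρ₁
    rw [h1, smul_neg, ← e2] at e1
    refine Eq.trans ?_ ((congrArg (fun x => r / μ * x) e1).trans ?_)
    · rw [← integral_const_mul]
      refine integral_congr_ae (Filter.Eventually.of_forall fun z => ?_)
      dsimp only
      rw [h2 z, PiLp.smul_apply, smul_eq_mul]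
      field_simp
    · dsimp only
      rw [mul_neg, ← integral_const_mul]
      congr 1
      refine integral_congr_ae (Filter.Eventually.of_forall fun z => ?_)
      dsimp only
      rw [PiLp.smul_apply, smul_eq_mul, Homeomorph.symm_apply_apply]
      ring

/-- The relation s μ^{p-2} = r^p is what makes u_t and the divergence term scale alike. It leaves δ
unchanged as well. It is used with μ = l r and s = l^{2-p} r² for intrinsic cylinders, and with μ =
1 and s = R^p to normalise the given cylinder. -/
theorem IsApproxWeakSol.rescale (hp : 1 < p) {y : RVec n} {τ r s μ : ℝ} (hr : 0 < r) (hs : 0 < s)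
    (hμ : 0 < μ) (hrs : s * μ ^ (p - 2) = r ^ p) {x₁ : RVec n} {t₁ R₁ ρ₁ : ℝ}
    (h : IsApproxWeakSol p δ A (y + r • x₁) (τ + s * t₁) (r * R₁) (s * ρ₁) u Du) :
    IsApproxWeakSol p δ (fun w ζ => (r / μ) ^ (p - 1) • A (μ • w) ((μ / r) • ζ)) x₁ t₁ R₁ ρ₁
      (fun z => μ⁻¹ • u (parHomeo y τ hr.ne' hs.ne' z))
      (fun z => (r / μ) • Du (parHomeo y τ hr.ne' hs.ne' z)) where
  memVp := h.memVp.rescale hr hs hμ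
  flux_measurable := by
    have : AEStronglyMeasurable ((fun z => A (u z) (Du z)) ∘ parHomeo y τ hr.ne' hs.ne')
        (volume.restrict (parCyl x₁ t₁ R₁ ρ₁)) := by
      refine AEStronglyMeasurable.comp_measurable ?_
        (parHomeo y τ hr.ne' hs.ne').continuous.measurable
      rw [map_parHomeo_restrict y τ hr hs]
      exact h.flux_measurable.smul_measure _
    replace this := this.const_smul ((r / μ) ^ (p - 1))
    simp only [smul_smul, mul_inv_cancel₀ hμ.ne', one_smul]
    rw [show μ / r * (r / μ) = 1 by field_simp]
    simp only [one_smul]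
    exact this
  approx := by
    intro y' s' r' σ' hr' hσ' hsub φ hφ
    -- The factor of the flux term equals the factor s/μ of the time term.
    have hκ : (r / μ) ^ (p - 1) * r = s / μ := by
      rw [Real.div_rpow hr.le hμ.le, div_mul_eq_mul_div, ← Real.rpow_add_one hr.ne',
        sub_add_cancel, ← hrs, div_eq_div_iff (by positivity) hμ.ne',
        show p - 1 = (p - 2) + 1 by ring, Real.rpow_add_one hμ.ne']
      ring
    set T := parHomeo y τ hr.ne' hs.ne' with hT
    set Φ : RVec n × ℝ → RVec m := fun w => φ (T.symm w) with hΦ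
    have hsub' : parCyl (y + r • y') (τ + s * s') (r * r') (s * σ') ⊆
        parCyl (y + r • x₁) (τ + s * t₁) (r * R₁) (s * ρ₁) := by
      rw [← parHomeo_preimage_parCyl y τ hr hs, ← parHomeo_preimage_parCyl y τ hr hs x₁] at hsub
      exact (Homeomorph.surjective _).preimage_subset_preimage_iff.1 hsub
    have hmain := h.approx _ _ _ _ (mul_pos hr hr') (mul_pos hs hσ') hsub' Φ
      (hφ.comp_parHomeo_symm y τ hr hs)
    have hd : ∀ z, timeDeriv φ z = s • timeDeriv Φ (T z) := by
      intro z
      rw [timeDeriv, timeDeriv, hΦ, hT, fderiv_comp_parHomeo_symm y τ hr hs hφ.contDiff, smul_zero,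
        mul_one]
      have : ((0 : RVec n), s⁻¹) = s⁻¹ • ((0 : RVec n), (1 : ℝ)) := by simp
      rw [this, map_smul, smul_inv_smul₀ hs.ne']
    have hg : ∀ z, spaceGrad φ z = r • spaceGrad Φ (T z) := by
      intro z
      ext ij
      simp only [spaceGrad, PiLp.smul_apply, smul_eq_mul]
      rw [spaceDeriv, spaceDeriv, hΦ, hT, fderiv_comp_parHomeo_symm y τ hr hs hφ.contDiff, mul_zero]
      have : (r⁻¹ • (EuclideanSpace.single ij.2 (1:ℝ) : RVec n), (0 : ℝ))
        = r⁻¹ • ((EuclideanSpace.single ij.2 (1:ℝ) : RVec n), (0 : ℝ)) := by simp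
      rw [this, map_smul, PiLp.smul_apply, smul_eq_mul, mul_inv_cancel_left₀ hr.ne']
    set P := parCyl (y + r • y') (τ + s * s') (r * r') (s * σ') with hP
    have e1 : ∫ z in parCyl y' s' r' σ', (- inner ℝ (μ⁻¹ • u (T z)) (timeDeriv φ z) +
          inner ℝ ((r / μ) ^ (p - 1) • A (μ • μ⁻¹ • u (T z)) ((μ / r) • (r / μ) • Du (T z)))
            (spaceGrad φ z))
        = (r ^ n * s)⁻¹ * (s / μ * ∫ z in P, (- inner ℝ (u z) (timeDeriv Φ z) +
          inner ℝ (A (u z) (Du z)) (spaceGrad Φ z))) := by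
      rw [← integral_const_mul, ← smul_eq_mul, hP, ← setIntegral_comp_parHomeo y τ hr hs]
      refine integral_congr_ae (Filter.Eventually.of_forall fun z => ?_)
      dsimp only
      rw [hd, hg, smul_inv_smul₀ hμ.ne', smul_smul (μ / r), show μ / r * (r / μ) = 1 by field_simp,
        one_smul, real_inner_smul_left, real_inner_smul_left, inner_smul_right, inner_smul_right,
        ← mul_assoc ((r / μ) ^ (p - 1)), hκ, ← hT]
      ring
    have e2 : ∫ z in parCyl y' s' r' σ', ‖(r / μ) • Du (T z)‖ ^ p
        = (r ^ n * s)⁻¹ * ((r / μ) ^ p * ∫ z in P, ‖Du z‖ ^ p) := by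
      rw [← integral_const_mul, ← smul_eq_mul, hP, ← setIntegral_comp_parHomeo y τ hr hs]
      refine integral_congr_ae (Filter.Eventually.of_forall fun z => ?_)
      dsimp only
      rw [norm_smul, Real.norm_of_nonneg (by positivity),
        Real.mul_rpow (by positivity) (norm_nonneg _)]
    have e3 : ∫ z in parCyl y' s' r' σ', ‖spaceGrad φ z‖ ^ p
        = (r ^ n * s)⁻¹ * (r ^ p * ∫ z in P, ‖spaceGrad Φ z‖ ^ p) := by
      rw [← integral_const_mul, ← smul_eq_mul, hP, ← setIntegral_comp_parHomeo y τ hr hs]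
      refine integral_congr_ae (Filter.Eventually.of_forall fun z => ?_)
      dsimp only
      rw [hg, norm_smul, Real.norm_of_nonneg (by positivity),
        Real.mul_rpow (by positivity) (norm_nonneg _)]
    rw [e1, e2, e3, abs_mul, abs_mul, abs_of_pos (by positivity : 0 < (r ^ n * s)⁻¹),
      abs_of_pos (by positivity : 0 < s / μ)]
    have hI : 0 ≤ ∫ z in P, ‖Du z‖ ^ p := integral_nonneg fun z => by positivity
    have hJ : 0 ≤ ∫ z in P, ‖spaceGrad Φ z‖ ^ p := integral_nonneg fun z => by positivity
    have hp0 : p ≠ 0 := by linarith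
    have hc : 0 < (r ^ n * s)⁻¹ := by positivity
    generalize (∫ z in P, ‖Du z‖ ^ p) = I at *
    generalize (∫ z in P, ‖spaceGrad Φ z‖ ^ p) = J at *
    generalize (r ^ n * s)⁻¹ = c at *
    refine (mul_le_mul_of_nonneg_left (mul_le_mul_of_nonneg_left hmain
      (by positivity : 0 ≤ s / μ)) hc.le).trans (le_of_eq ?_)
    have f1 : ((c * ((r / μ) ^ p * I)) ^ (1 / p)) ^ (p - 1)
        = (c ^ (1 / p)) ^ (p - 1) * ((r / μ) ^ (p - 1) * (I ^ (1 / p)) ^ (p - 1)) := by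
      rw [Real.mul_rpow hc.le (by positivity), Real.mul_rpow (by positivity) hI,
        ← Real.rpow_mul (by positivity) p, mul_one_div_cancel hp0, Real.rpow_one,
        Real.mul_rpow (by positivity) (by positivity), Real.mul_rpow (by positivity) (by positivity)]
    have f2 : (c * (r ^ p * J)) ^ (1 / p) = c ^ (1 / p) * (r * J ^ (1 / p)) := by
      rw [Real.mul_rpow hc.le (by positivity), Real.mul_rpow (by positivity) hJ,
        ← Real.rpow_mul hr.le p, mul_one_div_cancel hp0, Real.rpow_one]
    -- The Jacobian appears with exponents (p-1)/p and 1/p, which add up to the single power on the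
    -- left-hand side.
    have f3 : (c ^ (1 / p)) ^ (p - 1) * c ^ (1 / p) = c := by
      rw [← Real.rpow_add_one (by positivity), sub_add_cancel, ← Real.rpow_mul hc.le,
        one_div_mul_cancel hp0, Real.rpow_one]
    rw [f1, f2, ← hκ]
    calc _ = ((c ^ (1 / p)) ^ (p - 1) * c ^ (1 / p)) * ((r / μ) ^ (p - 1) * r *
          (δ * (I ^ (1 / p)) ^ (p - 1) * J ^ (1 / p))) := by rw [f3]
      _ = _ := by ring

/-! ### Poincaré and Sobolev–Poincaré inequalities on balls. -/

theorem rpow_lintegral_le {α : Type*} [MeasurableSpace α] (μ : Measure α) {f : α → ℝ≥0∞}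
    (hf : AEMeasurable f μ) {q : ℝ} (hq : 1 ≤ q) :
    (∫⁻ x, f x ∂μ) ^ q ≤ μ univ ^ (q - 1) * ∫⁻ x, f x ^ q ∂μ := by
  have hq0 : 0 < q := by linarith
  have h := ENNReal.lintegral_mul_norm_pow_le (μ := μ) (f := fun x => f x ^ q) (g := fun _ => 1)
    (hf.pow_const q) aemeasurable_const (p := 1 / q) (q := 1 - 1 / q) (by positivity)
    (by rw [sub_nonneg, div_le_one hq0]; exact hq) (by ring)
  simp only [ENNReal.one_rpow, mul_one, lintegral_one] at h
  simp_rw [← ENNReal.rpow_mul, mul_one_div_cancel hq0.ne', ENNReal.rpow_one] at h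
  refine (ENNReal.rpow_le_rpow h hq0.le).trans (le_of_eq ?_)
  rw [ENNReal.mul_rpow_of_nonneg _ _ hq0.le, ← ENNReal.rpow_mul, ← ENNReal.rpow_mul,
    one_div_mul_cancel hq0.ne', ENNReal.rpow_one, sub_mul, one_div_mul_cancel hq0.ne', one_mul,
    mul_comm]

theorem lintegral_comp_smul_add {n : ℕ} (f : RVec n → ℝ≥0∞) {a : ℝ} (ha : 0 < a) (v : RVec n) :
    ∫⁻ x, f (a • x + v) = ENNReal.ofReal ((a ^ n)⁻¹) * ∫⁻ x, f x := by
  have hemb : MeasurableEmbedding (fun x : RVec n => a • x + v) :=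
    ((Homeomorph.smulOfNeZero a ha.ne').trans (Homeomorph.addRight v)).measurableEmbedding
  rw [← hemb.lintegral_map]
  have : (fun x : RVec n => a • x + v) = (fun x => x + v) ∘ (fun x => a • x) := rfl
  rw [this, ← Measure.map_map (by fun_prop) (by fun_prop), Measure.map_addHaar_smul _ ha.ne',
    Measure.map_smul, map_add_right_eq_self, finrank_euclideanSpace_fin, lintegral_smul_measure,
    abs_of_pos (by positivity), smul_eq_mul]

/-- By convexity the map x ↦ ax + (1-a)y sends the ball into itself, and its Jacobian a^n is at
least 2^{-n}. -/
theorem lintegral_ball_comp_convex_le {n : ℕ} {R : ℝ} {h : RVec n → ℝ≥0∞}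
    {a : ℝ} (ha : 1 / 2 ≤ a) (ha1 : a ≤ 1) {y : RVec n} (hy : y ∈ Metric.ball (0 : RVec n) R) :
    ∫⁻ x in Metric.ball (0 : RVec n) R, h (a • x + (1 - a) • y)
      ≤ ENNReal.ofReal (2 ^ n) * ∫⁻ x in Metric.ball (0 : RVec n) R, h x := by
  have ha0 : 0 < a := by linarith
  rw [← lintegral_indicator measurableSet_ball, ← lintegral_indicator measurableSet_ball]
  calc _ ≤ ∫⁻ x, (Metric.ball (0 : RVec n) R).indicator h (a • x + (1 - a) • y) := by
        refine lintegral_mono fun x => ?_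
        by_cases hx : x ∈ Metric.ball (0 : RVec n) R
        · have : a • x + (1 - a) • y ∈ Metric.ball (0 : RVec n) R :=
            (convex_ball _ _) hx hy ha0.le (by linarith) (by ring)
          simp [hx, this]
        · simp [hx]
    _ ≤ _ := by
        rw [lintegral_comp_smul_add _ ha0]
        gcongr
        rw [← inv_pow]
        gcongr
        rw [inv_le_comm₀ ha0 two_pos]
        linarith

/-- A Poincaré inequality on balls in double integral form. -/
theorem lintegral_enorm_sub_rpow_le {n : ℕ} {F : Type*} [NormedAddCommGroup F] [NormedSpace ℝ F]
    [CompleteSpace F] {w : RVec n → F} (hw : ContDiff ℝ 1 w) {R q : ℝ} (hq : 1 ≤ q) :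
    ∫⁻ x in Metric.ball (0 : RVec n) R, ∫⁻ y in Metric.ball (0 : RVec n) R, ‖w x - w y‖ₑ ^ q
      ≤ ENNReal.ofReal (2 * R) ^ q * (ENNReal.ofReal (2 ^ n) *
        volume (Metric.ball (0 : RVec n) R)) *
        ∫⁻ x in Metric.ball (0 : RVec n) R, ‖fderiv ℝ w x‖ₑ ^ q := by
  set B := Metric.ball (0 : RVec n) R with hB
  have hq0 : 0 < q := by linarith
  have hdc : Continuous (fderiv ℝ w) := hw.continuous_fderiv one_ne_zero
  set h : RVec n → ℝ≥0∞ := fun x => ‖fderiv ℝ w x‖ₑ ^ q with hh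
  have hm : Measurable h := by
    have : Measurable fun x => ‖fderiv ℝ w x‖ₑ := hdc.enorm.measurable
    exact this.pow_const q
  have hpt : ∀ x ∈ B, ∀ y ∈ B, ‖w x - w y‖ₑ ^ q
      ≤ ENNReal.ofReal (2 * R) ^ q * ∫⁻ s in Ioc (0:ℝ) 1, h (s • x + (1 - s) • y) := by
    intro x hx y hy
    have hder : ∀ s ∈ uIcc (0:ℝ) 1, HasDerivAt (fun s : ℝ => w (s • x + (1 - s) • y))
        (fderiv ℝ w (s • x + (1 - s) • y) (x - y)) s := by
      intro s _
      have h1 : HasDerivAt (fun s : ℝ => s • x + (1 - s) • y) (x - y) s := by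
        have := ((hasDerivAt_id s).smul_const x).add
          (((hasDerivAt_const s (1:ℝ)).sub (hasDerivAt_id s)).smul_const y)
        convert! this using 1
        simp [sub_eq_add_neg]
      exact (hw.differentiable one_ne_zero _).hasFDerivAt.comp_hasDerivAt s h1
    have hint := intervalIntegral.integral_eq_sub_of_hasDerivAt hder
      ((Continuous.intervalIntegrable (by fun_prop) _ _))
    have e1 : w x - w y = ∫ s in Ioc (0:ℝ) 1, fderiv ℝ w (s • x + (1 - s) • y) (x - y) := by
      rw [← intervalIntegral.integral_of_le zero_le_one, hint]
      simp
    have h1 : ‖w x - w y‖ₑ ≤ ∫⁻ s in Ioc (0:ℝ) 1,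
        ENNReal.ofReal (2 * R) * ‖fderiv ℝ w (s • x + (1 - s) • y)‖ₑ := by
      rw [e1]
      refine (enorm_integral_le_lintegral_enorm _).trans (lintegral_mono fun s => ?_)
      refine (ContinuousLinearMap.le_opENorm _ _).trans ?_
      rw [mul_comm]
      gcongr
      rw [← ofReal_norm]
      apply ENNReal.ofReal_le_ofReal
      rw [hB, mem_ball_zero_iff] at hx hy
      linarith [norm_sub_le x y]
    have hmeas : Measurable fun s : ℝ => ‖fderiv ℝ w (s • x + (1 - s) • y)‖ₑ :=
      (hdc.comp (by fun_prop)).enorm.measurable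
    calc ‖w x - w y‖ₑ ^ q ≤ (∫⁻ s in Ioc (0:ℝ) 1,
        ENNReal.ofReal (2 * R) * ‖fderiv ℝ w (s • x + (1 - s) • y)‖ₑ) ^ q := by gcongr
      _ ≤ _ := by
        rw [lintegral_const_mul _ hmeas, ENNReal.mul_rpow_of_nonneg _ _ hq0.le]
        gcongr
        refine (rpow_lintegral_le _ hmeas.aemeasurable hq).trans ?_
        simp [hh]
  -- The Jacobian of the segment point degenerates in x as s → 0 and in y as s → 1. Integrating
  -- first in x for s ≥ 1/2 and first in y for s ≤ 1/2 avoids both.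
  have hinner : ∀ s ∈ Ioc (0:ℝ) 1, ∫⁻ x in B, ∫⁻ y in B, h (s • x + (1 - s) • y)
      ≤ ENNReal.ofReal (2 ^ n) * volume B * ∫⁻ x in B, h x := by
    intro s hs
    have hms : Measurable fun p : RVec n × RVec n => h (s • p.1 + (1 - s) • p.2) :=
      hm.comp (by fun_prop)
    rcases le_total (1 / 2) s with h1 | h1
    · rw [lintegral_lintegral_swap hms.aemeasurable]
      calc _ ≤ ∫⁻ y in B, ENNReal.ofReal (2 ^ n) * ∫⁻ x in B, h x :=
            setLIntegral_mono' measurableSet_ball fun y hy =>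
              lintegral_ball_comp_convex_le h1 hs.2 hy
        _ = _ := by rw [setLIntegral_const]; ring
    · calc _ ≤ ∫⁻ x in B, ENNReal.ofReal (2 ^ n) * ∫⁻ x in B, h x :=
            setLIntegral_mono' measurableSet_ball fun x hx => by
              have := lintegral_ball_comp_convex_le (h := h) (a := 1 - s) (by linarith)
                (by linarith [hs.1]) hx
              rw [sub_sub_cancel] at this
              simpa only [add_comm] using this
        _ = _ := by rw [setLIntegral_const]; ring
  calc _ ≤ ∫⁻ x in B, ∫⁻ y in B, ENNReal.ofReal (2 * R) ^ q *
        ∫⁻ s in Ioc (0:ℝ) 1, h (s • x + (1 - s) • y) :=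
        setLIntegral_mono' measurableSet_ball fun x hx =>
          setLIntegral_mono' measurableSet_ball fun y hy => hpt x hx y hy
    _ = ENNReal.ofReal (2 * R) ^ q *
        ∫⁻ s in Ioc (0:ℝ) 1, ∫⁻ x in B, ∫⁻ y in B, h (s • x + (1 - s) • y) := by
        have hct : ENNReal.ofReal (2 * R) ^ q ≠ ⊤ :=
          ENNReal.rpow_ne_top_of_nonneg hq0.le ENNReal.ofReal_ne_top
        simp_rw [lintegral_const_mul' _ _ hct]
        congr 1
        have e1 : ∀ x, ∫⁻ y in B, ∫⁻ s in Ioc (0:ℝ) 1, h (s • x + (1 - s) • y)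
            = ∫⁻ s in Ioc (0:ℝ) 1, ∫⁻ y in B, h (s • x + (1 - s) • y) := fun x =>
          lintegral_lintegral_swap (f := fun y s => h (s • x + (1 - s) • y))
            (Measurable.aemeasurable (hm.comp (g := h)
              (f := fun p : RVec n × ℝ => p.2 • x + (1 - p.2) • p.1) (by fun_prop)))
        simp_rw [e1]
        have hm5 : Measurable fun p : (RVec n × ℝ) × RVec n =>
            h (p.1.2 • p.1.1 + (1 - p.1.2) • p.2) := hm.comp (by fun_prop)
        exact lintegral_lintegral_swap
          (f := fun x s => ∫⁻ y in B, h (s • x + (1 - s) • y)) hm5.lintegral_prod_right'.aemeasurable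
    _ ≤ ENNReal.ofReal (2 * R) ^ q *
        ∫⁻ s in Ioc (0:ℝ) 1, ENNReal.ofReal (2 ^ n) * volume B * ∫⁻ x in B, h x := by
        exact mul_le_mul_right (setLIntegral_mono' measurableSet_Ioc hinner) _
    _ = _ := by
        rw [setLIntegral_const]
        simp [mul_assoc]

/-- Poincaré inequality on balls for weighted means. -/
theorem lintegral_enorm_sub_mean_rpow_le {n : ℕ} {F : Type*} [NormedAddCommGroup F]
    [NormedSpace ℝ F] [CompleteSpace F] {R q Z : ℝ} (hq : 1 ≤ q)
    {ζ : RVec n → ℝ} (hζ : Continuous ζ) (hζB : tsupport ζ ⊆ Metric.ball 0 R)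
    (hζZ : ∀ x, ‖ζ x‖ ≤ Z) (hζ1 : ∫ x, ζ x = 1) :
    ∃ C : ℝ≥0, ∀ w : RVec n → F, ContDiff ℝ 1 w →
      ∫⁻ x in Metric.ball (0 : RVec n) R, ‖w x - ∫ y, ζ y • w y‖ₑ ^ q
        ≤ C * ∫⁻ x in Metric.ball (0 : RVec n) R, ‖fderiv ℝ w x‖ₑ ^ q := by
  set B := Metric.ball (0 : RVec n) R with hB
  have hq0 : 0 < q := by linarith
  have hBt : volume B ≠ ⊤ := measure_ball_lt_top.ne
  set C : ℝ≥0∞ := (ENNReal.ofReal Z ^ q * volume B ^ (q - 1)) *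
    (ENNReal.ofReal (2 * R) ^ q * (ENNReal.ofReal (2 ^ n) * volume B)) with hC
  have hCt : C ≠ ⊤ := by
    have h1 : ∀ x : ℝ, ENNReal.ofReal x ^ q ≠ ⊤ := fun x =>
      ENNReal.rpow_ne_top_of_nonneg hq0.le ENNReal.ofReal_ne_top
    exact ENNReal.mul_ne_top (ENNReal.mul_ne_top (h1 _)
      (ENNReal.rpow_ne_top_of_nonneg (by linarith) hBt))
      (ENNReal.mul_ne_top (h1 _) (ENNReal.mul_ne_top ENNReal.ofReal_ne_top hBt))
  refine ⟨C.toNNReal, fun w hw => ?_⟩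
  rw [ENNReal.coe_toNNReal hCt]
  have hζc : HasCompactSupport ζ :=
    HasCompactSupport.of_support_subset_isCompact (isCompact_closedBall 0 R)
      ((subset_tsupport ζ).trans (hζB.trans Metric.ball_subset_closedBall))
  have hpt : ∀ x, ‖w x - ∫ y, ζ y • w y‖ₑ ^ q
      ≤ ENNReal.ofReal Z ^ q * volume B ^ (q - 1) * ∫⁻ y in B, ‖w x - w y‖ₑ ^ q := by
    intro x
    have e1 : w x - ∫ y, ζ y • w y = ∫ y in B, ζ y • (w x - w y) := by
      have i1 : Integrable (fun y => ζ y • w x) :=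
        (hζ.integrable_of_hasCompactSupport hζc).smul_const _
      have i2 : Integrable (fun y => ζ y • w y) :=
        (hζ.smul hw.continuous).integrable_of_hasCompactSupport hζc.smul_right
      rw [setIntegral_eq_integral_of_forall_compl_eq_zero]
      · simp_rw [smul_sub]
        rw [integral_sub i1 i2, integral_smul_const, hζ1, one_smul]
      · intro y hy
        rw [image_eq_zero_of_notMem_tsupport fun h => hy (hζB h), zero_smul]
    have hmeas : Measurable fun y => ‖w x - w y‖ₑ :=
      (continuous_const.sub hw.continuous).enorm.measurable
    calc _ ≤ (∫⁻ y in B, ENNReal.ofReal Z * ‖w x - w y‖ₑ) ^ q := by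
          rw [e1]
          gcongr
          refine (enorm_integral_le_lintegral_enorm _).trans (lintegral_mono fun y => ?_)
          rw [enorm_smul]
          gcongr
          rw [← ofReal_norm]
          exact ENNReal.ofReal_le_ofReal (hζZ y)
      _ ≤ _ := by
          rw [lintegral_const_mul _ hmeas, ENNReal.mul_rpow_of_nonneg _ _ hq0.le, mul_assoc]
          gcongr
          refine (rpow_lintegral_le _ hmeas.aemeasurable hq).trans ?_
          simp
  calc _ ≤ ∫⁻ x in B, ENNReal.ofReal Z ^ q * volume B ^ (q - 1) *
        ∫⁻ y in B, ‖w x - w y‖ₑ ^ q := lintegral_mono fun x => hpt x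
    _ = ENNReal.ofReal Z ^ q * volume B ^ (q - 1) *
        ∫⁻ x in B, ∫⁻ y in B, ‖w x - w y‖ₑ ^ q := by
        rw [lintegral_const_mul']
        exact ENNReal.mul_ne_top (ENNReal.rpow_ne_top_of_nonneg hq0.le ENNReal.ofReal_ne_top)
          (ENNReal.rpow_ne_top_of_nonneg (by linarith) hBt)
    _ ≤ _ := by
        rw [hC, mul_assoc (ENNReal.ofReal Z ^ q * volume B ^ (q - 1))]
        exact mul_le_mul_right (lintegral_enorm_sub_rpow_le hw hq) _

/-- The fundamental theorem of calculus along the line. Dimension one is treated apart because no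
exponent satisfies 1 ≤ q' < n when n = 1. -/
theorem enorm_le_lintegral_fderiv_of_dim_one {F : Type*} [NormedAddCommGroup F] [NormedSpace ℝ F]
    {v : RVec 1 → F} (hv : ContDiff ℝ 1 v) (hc : HasCompactSupport v) (x : RVec 1) :
    ‖v x‖ₑ ≤ ∫⁻ y, ‖fderiv ℝ v y‖ₑ := by
  let L : ℝ ≃ₗᵢ[ℝ] RVec 1 := (OrthonormalBasis.singleton (Fin 1) ℝ).repr
  have hL : ∀ t, deriv (v ∘ L) t = fderiv ℝ v (L t) (L 1) := fun t => by
    have h1 : HasDerivAt L (L 1) t := by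
      have := (L.toContinuousLinearEquiv : ℝ →L[ℝ] RVec 1).hasDerivAt (x := t)
      exact this
    exact ((hv.differentiable one_ne_zero _).hasFDerivAt.comp_hasDerivAt t h1).deriv
  have h := HasCompactSupport.enorm_le_lintegral_Ici_deriv
    (hv.comp L.toContinuousLinearEquiv.contDiff)
    (hc.comp_homeomorph L.toHomeomorph) (L.symm x)
  have hx : (v ∘ ⇑L.toContinuousLinearEquiv) (L.symm x) = v x := by
    simp
  rw [hx] at h
  refine h.trans ((setLIntegral_le_lintegral _ _).trans ?_)
  rw [← L.measurePreserving.lintegral_comp_emb L.toHomeomorph.measurableEmbedding]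
  refine lintegral_mono fun t => ?_
  refine (congrArg _ (hL t)).trans_le ?_
  refine (ContinuousLinearMap.le_opENorm _ _).trans ?_
  have : ‖L 1‖ₑ = 1 := by
    rw [← ofReal_norm, L.norm_map]; simp
  rw [this, mul_one]

/-- Sobolev's inequality for functions supported in a fixed ball, in every dimension. -/
theorem exists_eLpNorm_le_eLpNorm_fderiv {n m : ℕ} (hn : 1 ≤ n) {q s : ℝ} (hq : 1 ≤ q)
    (hs : 0 < s) (hqs : 1 / q - 1 / (n : ℝ) ≤ 1 / s) (R : ℝ) :
    ∃ C : ℝ≥0, ∀ v : RVec n → RVec m, ContDiff ℝ 1 v →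
      Function.support v ⊆ Metric.closedBall 0 R →
      eLpNorm v (ENNReal.ofReal s) volume
        ≤ C * eLpNorm (fderiv ℝ v) (ENNReal.ofReal q) volume := by
  set B := Metric.closedBall (0 : RVec n) R with hB
  have hq0 : 0 < q := by linarith
  have hBt : volume B ≠ ⊤ := measure_closedBall_lt_top.ne
  have hsB : ∀ v : RVec n → RVec m, Function.support v ⊆ B →
      Function.support (fderiv ℝ v) ⊆ B := fun v hv =>
    (subset_tsupport _).trans ((tsupport_fderiv_subset ℝ).trans
      (closure_minimal hv Metric.isClosed_closedBall))
  have hholder : ∀ (q' : ℝ), 1 ≤ q' → q' ≤ q → ∀ v : RVec n → RVec m, ContDiff ℝ 1 v →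
      Function.support v ⊆ B → eLpNorm (fderiv ℝ v) (ENNReal.ofReal q') volume
        ≤ volume B ^ (1 / q' - 1 / q) * eLpNorm (fderiv ℝ v) (ENNReal.ofReal q) volume := by
    intro q' hq' hq'q v hv hvB
    have h := eLpNorm_le_eLpNorm_mul_rpow_measure_univ (μ := volume.restrict B)
      (ENNReal.ofReal_le_ofReal hq'q)
      (hv.continuous_fderiv one_ne_zero).aestronglyMeasurable
    have e (p : ℝ≥0∞) :
        eLpNorm (fderiv ℝ v) p (volume.restrict B) = eLpNorm (fderiv ℝ v) p volume :=
      eLpNorm_restrict_eq_of_support_subset (f := fderiv ℝ v) (hsB v hvB)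
    rw [e, e, Measure.restrict_apply_univ,
      ENNReal.toReal_ofReal (by linarith), ENNReal.toReal_ofReal hq0.le] at h
    rwa [mul_comm]
  have hexp : ∀ q' : ℝ, 0 < q' → q' ≤ q → 0 ≤ 1 / q' - 1 / q := fun q' h0 h =>
    sub_nonneg.2 (one_div_le_one_div_of_le h0 h)
  obtain rfl | hn2 := hn.eq_or_lt
  · set C : ℝ≥0∞ := volume B ^ (1 / s) * volume B ^ (1 / 1 - 1 / q) with hC
    have hCt : C ≠ ⊤ := ENNReal.mul_ne_top
      (ENNReal.rpow_ne_top_of_nonneg (by positivity) hBt)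
      (ENNReal.rpow_ne_top_of_nonneg (hexp 1 one_pos hq) hBt)
    refine ⟨C.toNNReal, fun v hv hvB => ?_⟩
    rw [ENNReal.coe_toNNReal hCt]
    have hc : HasCompactSupport v :=
      HasCompactSupport.of_support_subset_isCompact (isCompact_closedBall 0 R) hvB
    have h1 := hholder 1 le_rfl hq v hv hvB
    rw [ENNReal.ofReal_one, eLpNorm_one_eq_lintegral_enorm] at h1
    have hs0 : ENNReal.ofReal s ≠ 0 := by simpa using hs
    rw [← eLpNorm_restrict_eq_of_support_subset hvB]
    rw [eLpNorm_eq_lintegral_rpow_enorm_toReal hs0 ENNReal.ofReal_ne_top,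
      ENNReal.toReal_ofReal hs.le]
    calc _ ≤ (∫⁻ x in B, (∫⁻ y, ‖fderiv ℝ v y‖ₑ) ^ s) ^ (1 / s) := by
          gcongr with x
          exact enorm_le_lintegral_fderiv_of_dim_one hv hc x
      _ = volume B ^ (1 / s) * ∫⁻ y, ‖fderiv ℝ v y‖ₑ := by
          rw [setLIntegral_const, ENNReal.mul_rpow_of_nonneg _ _ (by positivity),
            ← ENNReal.rpow_mul, mul_one_div_cancel hs.ne', ENNReal.rpow_one, mul_comm]
      _ ≤ _ := by
          rw [hC, mul_assoc]
          gcongr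
  · have hnR : (1 : ℝ) < n := by exact_mod_cast hn2
    have hn0 : (0 : ℝ) < n := by linarith
    -- The exponent whose Sobolev conjugate is s, or 1 if that is larger. It is always below n, so
    -- Sobolev's inequality applies even when q ≥ n, and Hölder's inequality on the ball raises q'
    -- to q.
    set q' : ℝ := max 1 (n * s / (n + s)) with hq'
    have hq'1 : 1 ≤ q' := le_max_left _ _
    have hq'n : q' < n := max_lt hnR (by
      rw [div_lt_iff₀ (by positivity)]; nlinarith)
    have hinv : 1 / (n * s / (n + s)) = 1 / s + 1 / (n : ℝ) := by field_simp
    have hq'q : q' ≤ q := by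
      refine max_le hq ?_
      rw [← one_div_le_one_div hq0 (by positivity), hinv]
      linarith
    have hq's : (q' : ℝ)⁻¹ - (n : ℝ)⁻¹ ≤ s⁻¹ := by
      have : 1 / q' ≤ 1 / (n * s / (n + s)) :=
        one_div_le_one_div_of_le (by positivity) (le_max_right _ _)
      rw [hinv] at this
      simp only [one_div] at this
      linarith
    set K := eLpNormLESNormFDerivOfLeConst (RVec m) (volume : Measure (RVec n)) B
      q'.toNNReal s.toNNReal with hK
    set C : ℝ≥0∞ := K * volume B ^ (1 / q' - 1 / q) with hC
    have hCt : C ≠ ⊤ := ENNReal.mul_ne_top ENNReal.coe_ne_top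
      (ENNReal.rpow_ne_top_of_nonneg (hexp _ (by linarith) hq'q) hBt)
    refine ⟨C.toNNReal, fun v hv hvB => ?_⟩
    rw [ENNReal.coe_toNNReal hCt]
    have h := eLpNorm_le_eLpNorm_fderiv_of_le (volume : Measure (RVec n)) (p := q'.toNNReal)
      (q := s.toNNReal) hv hvB (Real.one_le_toNNReal.2 hq'1)
      (by rw [finrank_euclideanSpace_fin, ← NNReal.coe_lt_coe,
            Real.coe_toNNReal _ (by linarith)]; simpa using hq'n)
      (by rw [finrank_euclideanSpace_fin, NNReal.coe_inv, Real.coe_toNNReal _ (by linarith),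
            Real.coe_toNNReal _ hs.le]; exact hq's)
      Metric.isBounded_closedBall
    calc _ ≤ _ := h
      _ ≤ _ := by
        rw [hC, mul_assoc]
        gcongr
        exact hholder q' hq'1 hq'q v hv hvB

/-- The Sobolev–Poincaré inequality on a smaller ball, for weighted means. -/
theorem exists_lintegral_enorm_sub_mean_rpow_le {n m : ℕ} (hn : 1 ≤ n) {q s r R Z : ℝ} (hq : 1 ≤ q)
    (hs : 0 < s) (hqs : 1 / q - 1 / (n : ℝ) ≤ 1 / s) (hr : 0 < r) (hrR : r < R)
    {ζ : RVec n → ℝ} (hζ : Continuous ζ) (hζB : tsupport ζ ⊆ Metric.ball 0 R)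
    (hζZ : ∀ x, ‖ζ x‖ ≤ Z) (hζ1 : ∫ x, ζ x = 1) :
    ∃ C : ℝ≥0, ∀ w : RVec n → RVec m, ContDiff ℝ 1 w →
      ∫⁻ x in Metric.ball (0 : RVec n) r, ‖w x - ∫ y, ζ y • w y‖ₑ ^ s
        ≤ C * (∫⁻ x in Metric.ball (0 : RVec n) R, ‖fderiv ℝ w x‖ₑ ^ q) ^ (s / q) := by
  have hq0 : 0 < q := by linarith
  obtain ⟨C₁, hC₁⟩ := lintegral_enorm_sub_mean_rpow_le (F := RVec m) hq hζ hζB hζZ hζ1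
  obtain ⟨C₂, hC₂⟩ := exists_eLpNorm_le_eLpNorm_fderiv (m := m) hn hq hs hqs R
  -- Sobolev's inequality is applied to η(w - a); the term with Dη is controlled by the Poincaré
  -- inequality on the larger ball.
  let η : ContDiffBump (0 : RVec n) := ⟨r, (r + R) / 2, hr, by linarith⟩
  have hηR : Metric.closedBall (0 : RVec n) ((r + R) / 2) ⊆ Metric.ball 0 R :=
    Metric.closedBall_subset_ball (by linarith)
  have hη : ContDiff ℝ 1 η := η.contDiff
  obtain ⟨L, hL⟩ : ∃ L : ℝ, ∀ x, ‖fderiv ℝ η x‖ ≤ L :=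
    (hη.continuous_fderiv one_ne_zero).bounded_above_of_compact_support
      (η.hasCompactSupport.fderiv ℝ)
  set K : ℝ≥0∞ := 2 ^ (q - 1) * (1 + ENNReal.ofReal L ^ q * C₁) with hK
  have hKt : K ≠ ⊤ := ENNReal.mul_ne_top
    (ENNReal.rpow_ne_top_of_nonneg (by linarith) (by simp))
    (ENNReal.add_ne_top.2 ⟨by simp, ENNReal.mul_ne_top
      (ENNReal.rpow_ne_top_of_nonneg hq0.le ENNReal.ofReal_ne_top) (by simp)⟩)
  set C : ℝ≥0∞ := C₂ ^ s * K ^ (s / q) with hC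
  have hCt : C ≠ ⊤ := ENNReal.mul_ne_top
    (ENNReal.rpow_ne_top_of_nonneg hs.le (by simp))
    (ENNReal.rpow_ne_top_of_nonneg (by positivity) hKt)
  refine ⟨C.toNNReal, fun w hw => ?_⟩
  rw [ENNReal.coe_toNNReal hCt]
  set a := ∫ y, ζ y • w y with ha
  have hwa : ContDiff ℝ 1 fun x => w x - a := hw.sub contDiff_const
  set v : RVec n → RVec m := fun x => η x • (w x - a) with hv
  have hvc : ContDiff ℝ 1 v := hη.smul hwa
  have hvs : Function.support v ⊆ Metric.closedBall 0 ((r + R) / 2) := by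
    intro x hx
    by_contra h
    apply hx
    simp only [hv]
    rw [image_eq_zero_of_notMem_tsupport (f := η) (by rwa [η.tsupport_eq]), zero_smul]
  have hvR : Function.support v ⊆ Metric.closedBall 0 R :=
    hvs.trans (Metric.closedBall_subset_closedBall (by linarith))
  have hdv : ∀ x, ‖fderiv ℝ v x‖ₑ ^ q ≤ 2 ^ (q - 1) * (‖fderiv ℝ w x‖ₑ ^ q +
      ENNReal.ofReal L ^ q * ‖w x - a‖ₑ ^ q) := by
    intro x
    have e1 : fderiv ℝ v x = η x • fderiv ℝ w x + (fderiv ℝ η x).smulRight (w x - a) := by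
      have := fderiv_fun_smul (hη.differentiable one_ne_zero x) (hwa.differentiable one_ne_zero x)
      rw [fderiv_sub_const] at this
      exact this
    have e2 : ‖fderiv ℝ v x‖ₑ ≤ ‖fderiv ℝ w x‖ₑ + ENNReal.ofReal L * ‖w x - a‖ₑ := by
      rw [e1]
      refine (enorm_add_le (η x • fderiv ℝ w x)
        ((fderiv ℝ η x).smulRight (w x - a))).trans (add_le_add ?_ ?_)
      · rw [enorm_smul]
        refine mul_le_of_le_one_left' ?_
        rw [← ofReal_norm, Real.norm_of_nonneg η.nonneg]
        exact ENNReal.ofReal_le_one.2 η.le_one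
      · rw [← ofReal_norm, ContinuousLinearMap.norm_smulRight_apply, ENNReal.ofReal_mul
          (norm_nonneg _), ofReal_norm (w x - a)]
        gcongr
        exact hL x
    calc _ ≤ _ := ENNReal.rpow_le_rpow e2 hq0.le
      _ ≤ _ := ENNReal.rpow_add_le_mul_rpow_add_rpow _ _ hq
      _ = _ := by rw [ENNReal.mul_rpow_of_nonneg _ _ hq0.le]
  have hdvR : Function.support (fderiv ℝ v) ⊆ Metric.ball 0 R :=
    (subset_tsupport _).trans ((tsupport_fderiv_subset ℝ).trans
      ((closure_minimal hvs Metric.isClosed_closedBall).trans hηR))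
  have hmw : Measurable fun x => ‖fderiv ℝ w x‖ₑ :=
    (hw.continuous_fderiv one_ne_zero).enorm.measurable
  have hD : ∫⁻ x, ‖fderiv ℝ v x‖ₑ ^ q
      ≤ K * ∫⁻ x in Metric.ball (0 : RVec n) R, ‖fderiv ℝ w x‖ₑ ^ q := by
    rw [← setLIntegral_eq_of_support_subset (s := Metric.ball (0 : RVec n) R)]
    · calc _ ≤ ∫⁻ x in Metric.ball (0 : RVec n) R, 2 ^ (q - 1) * (‖fderiv ℝ w x‖ₑ ^ q +
            ENNReal.ofReal L ^ q * ‖w x - a‖ₑ ^ q) := lintegral_mono hdv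
        _ = 2 ^ (q - 1) * ((∫⁻ x in Metric.ball (0 : RVec n) R, ‖fderiv ℝ w x‖ₑ ^ q) +
            ENNReal.ofReal L ^ q * ∫⁻ x in Metric.ball (0 : RVec n) R, ‖w x - a‖ₑ ^ q) := by
          rw [lintegral_const_mul' _ _ (ENNReal.rpow_ne_top_of_nonneg (by linarith) (by simp)),
            lintegral_add_left (hmw.pow_const q), lintegral_const_mul' _ _
              (ENNReal.rpow_ne_top_of_nonneg hq0.le ENNReal.ofReal_ne_top)]
        _ ≤ _ := by
          rw [hK, mul_assoc, add_mul, one_mul, mul_assoc]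
          gcongr
          exact hC₁ w hw
    · intro x hx
      apply hdvR
      intro h0
      apply hx
      simp only [h0]
      rw [← ofReal_norm, ContinuousLinearMap.opNorm_zero, ENNReal.ofReal_zero,
        ENNReal.zero_rpow_of_pos hq0]
  have hS := hC₂ v hvc hvR
  have hs0 : ENNReal.ofReal s ≠ 0 := by simpa using hs
  have hq0' : ENNReal.ofReal q ≠ 0 := by simpa using hq0
  rw [eLpNorm_eq_lintegral_rpow_enorm_toReal hs0 ENNReal.ofReal_ne_top,
    eLpNorm_eq_lintegral_rpow_enorm_toReal hq0' ENNReal.ofReal_ne_top,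
    ENNReal.toReal_ofReal hs.le, ENNReal.toReal_ofReal hq0.le] at hS
  calc _ = ∫⁻ x in Metric.ball (0 : RVec n) r, ‖v x‖ₑ ^ s := by
        refine setLIntegral_congr_fun measurableSet_ball fun x hx => ?_
        have : η x = 1 := η.one_of_mem_closedBall (Metric.ball_subset_closedBall hx)
        simp only [hv, this, one_smul]
    _ ≤ ∫⁻ x, ‖v x‖ₑ ^ s := setLIntegral_le_lintegral _ _
    _ = ((∫⁻ x, ‖v x‖ₑ ^ s) ^ (1 / s)) ^ s := by
        rw [← ENNReal.rpow_mul, one_div_mul_cancel hs.ne', ENNReal.rpow_one]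
    _ ≤ (C₂ * (K * ∫⁻ x in Metric.ball (0 : RVec n) R, ‖fderiv ℝ w x‖ₑ ^ q) ^ (1 / q)) ^ s := by
        refine ENNReal.rpow_le_rpow (hS.trans ?_) hs.le
        gcongr
    _ = _ := by
        rw [ENNReal.mul_rpow_of_nonneg _ _ hs.le, ← ENNReal.rpow_mul, one_div_mul_eq_div,
          ENNReal.mul_rpow_of_nonneg _ _ (by positivity), hC, mul_assoc]

/-- Interpolation on a time slice. -/
theorem exists_lintegral_enorm_sub_mean_mul_le {n m : ℕ} (hn : 1 ≤ n) {q P r R Z : ℝ} (hq : 1 ≤ q)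
    (hP : 2 ≤ P) (hqP : q < P) (hPq : P - q ≤ 1) (hnq : n * P / (n + 2) ≤ q)
    (hr : 0 < r) (hrR : r < R)
    {ζ : RVec n → ℝ} (hζ : Continuous ζ) (hζB : tsupport ζ ⊆ Metric.ball 0 R)
    (hζZ : ∀ x, ‖ζ x‖ ≤ Z) (hζ1 : ∫ x, ζ x = 1) :
    ∃ C : ℝ≥0, ∀ w : RVec n → RVec m, ContDiff ℝ 1 w →
      ∀ ψ : RVec n → ℝ≥0∞, Measurable ψ → (∀ x, ψ x ≤ 1) → (∀ x ∉ Metric.ball 0 r, ψ x = 0) →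
      ∫⁻ x, ‖w x - ∫ y, ζ y • w y‖ₑ ^ P * ψ x ^ P
        ≤ C * (∫⁻ x, ‖w x - ∫ y, ζ y • w y‖ₑ ^ (2 : ℝ) * ψ x ^ (3 : ℝ)) ^ ((P - q) / 2) *
          ∫⁻ x in Metric.ball (0 : RVec n) R, ‖fderiv ℝ w x‖ₑ ^ q := by
  have hq0 : 0 < q := by linarith
  have hn0 : (0 : ℝ) < n := by exact_mod_cast hn
  -- Hölder between L² and L^s with P = 2θ + s(1-θ) and s(1-θ) = q, so that ∫|Dw|^q enters to the
  -- first power exactly. That s is in the Sobolev range is equivalent to nP/(n+2) ≤ q. Since 3θ ≤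
  -- 3/2 ≤ P, the weight ψ³ in the L² factor is enough.
  set θ := (P - q) / 2 with hθ
  have hθ0 : 0 < θ := by rw [hθ]; linarith
  have hθ1 : θ ≤ 1 / 2 := by rw [hθ]; linarith
  set s := q / (1 - θ) with hs
  have hs0 : 0 < s := div_pos hq0 (by linarith)
  have hsq : s * (1 - θ) = q := div_mul_cancel₀ _ (by linarith)
  have hqs : 1 / q - 1 / (n : ℝ) ≤ 1 / s := by
    rw [hs, one_div_div, hθ]
    rw [div_le_iff₀ (by positivity)] at hnq
    rw [sub_le_iff_le_add, div_add_div _ _ hq0.ne' hn0.ne', div_le_div_iff₀ hq0 (by positivity)]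
    nlinarith
  obtain ⟨C, hC⟩ := exists_lintegral_enorm_sub_mean_rpow_le (m := m) hn hq hs0 hqs hr hrR
    hζ hζB hζZ hζ1
  have hCt : (C : ℝ≥0∞) ^ (1 - θ) ≠ ⊤ := ENNReal.rpow_ne_top_of_nonneg (by linarith) (by simp)
  refine ⟨((C : ℝ≥0∞) ^ (1 - θ)).toNNReal, fun w hw ψ hψ hψ1 hψr => ?_⟩
  rw [ENNReal.coe_toNNReal hCt]
  set a := ∫ y, ζ y • w y with ha
  have hm : Measurable fun x => ‖w x - a‖ₑ :=
    (hw.continuous.sub continuous_const).enorm.measurable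
  set X := ∫⁻ x in Metric.ball (0 : RVec n) R, ‖fderiv ℝ w x‖ₑ ^ q with hX
  have hpt : ∀ x, ‖w x - a‖ₑ ^ P * ψ x ^ P ≤ (‖w x - a‖ₑ ^ (2 : ℝ) * ψ x ^ (3 : ℝ)) ^ θ *
      ((Metric.ball (0 : RVec n) r).indicator (fun x => ‖w x - a‖ₑ ^ s) x) ^ (1 - θ) := by
    intro x
    by_cases hx : x ∈ Metric.ball (0 : RVec n) r
    · rw [indicator_of_mem hx, ENNReal.mul_rpow_of_nonneg _ _ hθ0.le, ← ENNReal.rpow_mul,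
        ← ENNReal.rpow_mul, ← ENNReal.rpow_mul, hsq, mul_right_comm,
        ← ENNReal.rpow_add_of_nonneg _ _ (by positivity) hq0.le]
      have : 2 * θ + q = P := by rw [hθ]; ring
      rw [this]
      refine mul_le_mul_right ?_ _
      exact ENNReal.rpow_le_rpow_of_exponent_ge (hψ1 x) (by linarith)
    · rw [hψr x hx, ENNReal.zero_rpow_of_pos (by linarith), mul_zero]
      exact zero_le
  calc _ ≤ _ := lintegral_mono hpt
    _ ≤ _ := ENNReal.lintegral_mul_norm_pow_le
        ((hm.pow_const _).mul (hψ.pow_const _)).aemeasurable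
        ((hm.pow_const _).indicator measurableSet_ball).aemeasurable hθ0.le (by linarith) (by ring)
    _ ≤ (∫⁻ x, ‖w x - a‖ₑ ^ (2 : ℝ) * ψ x ^ (3 : ℝ)) ^ θ * (C * X ^ (s / q)) ^ (1 - θ) := by
        refine mul_le_mul_right (ENNReal.rpow_le_rpow ?_ (by linarith)) _
        rw [lintegral_indicator measurableSet_ball]
        exact hC w hw
    _ = _ := by
        rw [ENNReal.mul_rpow_of_nonneg _ _ (by linarith), ← ENNReal.rpow_mul]
        have : s / q * (1 - θ) = 1 := by
          rw [div_mul_eq_mul_div, hsq, div_self hq0.ne']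
        rw [this, ENNReal.rpow_one]
        ring

/-! ### From weak inequalities in time to increments. -/

theorem deriv_smoothTransition_eq_zero {s : ℝ} (hs : s ∉ Icc (0 : ℝ) 1) :
    deriv Real.smoothTransition s = 0 := by
  rw [mem_Icc, not_and_or, not_le, not_le] at hs
  rcases hs with hs | hs
  · have : Real.smoothTransition =ᶠ[nhds s] fun _ => 0 := by
      filter_upwards [Iio_mem_nhds hs] with x hx using Real.smoothTransition.zero_of_nonpos hx.le
    rw [this.deriv_eq, deriv_const]
  · have : Real.smoothTransition =ᶠ[nhds s] fun _ => 1 := by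
      filter_upwards [Ioi_mem_nhds hs] with x hx using Real.smoothTransition.one_of_one_le hx.le
    rw [this.deriv_eq, deriv_const]

theorem continuous_deriv_smoothTransition : Continuous (deriv Real.smoothTransition) :=
  (Real.smoothTransition.contDiff (n := 1)).continuous_deriv le_rfl

theorem integral_deriv_smoothTransition_div_mul {f : ℝ → ℝ} (t₁ : ℝ) {r : ℝ} (hr : 0 < r) :
    ∫ t, deriv Real.smoothTransition ((t - t₁) / r) / r * f t
      = ∫ s in Icc (0 : ℝ) 1, deriv Real.smoothTransition s * f (t₁ + r * s) := by
  rw [setIntegral_eq_integral_of_forall_compl_eq_zero (fun s hs => by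
    rw [deriv_smoothTransition_eq_zero hs, zero_mul])]
  have h1 := integral_sub_right_eq_self (μ := (volume : Measure ℝ)) (fun t =>
    (fun s => deriv Real.smoothTransition s * f (t₁ + r * s)) (t / r)) t₁
  have h2 := Measure.integral_comp_div
    (fun s => deriv Real.smoothTransition s * f (t₁ + r * s)) r
  rw [h2, abs_of_pos hr, smul_eq_mul] at h1
  rw [eq_comm, ← mul_right_inj' hr.ne', ← h1, ← integral_const_mul]
  congr 1
  ext t
  have : t₁ + r * ((t - t₁) / r) = t := by field_simp; ring
  simp only [this]
  field_simp

/-- The derivative of the smooth transition has integral one and lives on [0, 1], so its rescalings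
form an approximate identity looking only forward from t₁. -/
theorem tendsto_integral_deriv_smoothTransition {f : ℝ → ℝ} (hf : Continuous f) (t₁ : ℝ) :
    Filter.Tendsto (fun r => ∫ s in Icc (0 : ℝ) 1, deriv Real.smoothTransition s * f (t₁ + r * s))
      (nhdsWithin 0 (Ioi 0)) (nhds (f t₁)) := by
  have hc : Continuous fun r : ℝ =>
      ∫ s in Icc (0 : ℝ) 1, deriv Real.smoothTransition s * f (t₁ + r * s) := by
    refine continuous_parametric_integral_of_continuous (f := fun r s : ℝ =>
      deriv Real.smoothTransition s * f (t₁ + r * s)) ?_ isCompact_Icc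
    exact (continuous_deriv_smoothTransition.comp continuous_snd).mul
      (hf.comp (by fun_prop))
  have h0 : ∫ s in Icc (0 : ℝ) 1, deriv Real.smoothTransition s * f (t₁ + 0 * s) = f t₁ := by
    simp only [zero_mul, add_zero]
    rw [integral_mul_const, integral_Icc_eq_integral_Ioc, ← intervalIntegral.integral_of_le
      zero_le_one, intervalIntegral.integral_deriv_eq_sub]
    · rw [Real.smoothTransition.one, Real.smoothTransition.zero]; ring
    · exact fun x _ => (Real.smoothTransition.contDiff (n := 1)).differentiable one_ne_zero x
    · exact continuous_deriv_smoothTransition.intervalIntegrable _ _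
  have := hc.tendsto 0
  rw [h0] at this
  exact this.mono_left nhdsWithin_le_nhds

/-- A one-sided weak bound on a derivative controls increments. -/
theorem sub_le_of_forall_neg_integral_deriv_mul_le {f : ℝ → ℝ} (hf : Continuous f) {α β E : ℝ}
    (h : ∀ χ : ℝ → ℝ, ContDiff ℝ 1 χ → tsupport χ ⊆ Ioo α β → (∀ t, 0 ≤ χ t) → (∀ t, χ t ≤ 1) →
      -∫ t, deriv χ t * f t ≤ E) {t₁ t₂ : ℝ} (h1 : α < t₁) (h12 : t₁ ≤ t₂) (h2 : t₂ < β) :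
    f t₂ - f t₁ ≤ E := by
  refine le_of_tendsto ((tendsto_integral_deriv_smoothTransition hf t₂).sub
    (tendsto_integral_deriv_smoothTransition hf t₁)) ?_
  filter_upwards [Ioo_mem_nhdsGT (sub_pos.2 h2)] with r hr
  have hr0 : 0 < r := hr.1
  rw [← integral_deriv_smoothTransition_div_mul t₂ hr0,
    ← integral_deriv_smoothTransition_div_mul t₁ hr0]
  -- A smooth indicator of [t₁, t₂]: up within r after t₁, down within r after t₂. Testing with it
  -- yields the difference of two averages of f, which converges to f t₂ - f t₁.
  set χ : ℝ → ℝ := fun t => Real.smoothTransition ((t - t₁) / r) -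
    Real.smoothTransition ((t - t₂) / r) with hχ
  have hlin : ∀ b : ℝ, ContDiff ℝ 1 fun t : ℝ => (t - b) / r := fun b => by fun_prop
  have hχc : ContDiff ℝ 1 χ :=
    (Real.smoothTransition.contDiff.comp (hlin t₁)).sub
      (Real.smoothTransition.contDiff.comp (hlin t₂))
  have hder : ∀ b t : ℝ, HasDerivAt (fun t => Real.smoothTransition ((t - b) / r))
      (deriv Real.smoothTransition ((t - b) / r) / r) t := fun b t => by
    have h1 : HasDerivAt (fun t : ℝ => (t - b) / r) (1 / r) t :=
      ((hasDerivAt_id t).sub_const b).div_const r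
    have h2 := ((Real.smoothTransition.contDiff (n := 1)).differentiable one_ne_zero
      ((t - b) / r)).hasDerivAt.comp t h1
    rwa [mul_one_div] at h2
  have hsupp : tsupport χ ⊆ Icc t₁ (t₂ + r) := by
    refine closure_minimal (fun t ht => ?_) isClosed_Icc
    by_contra hn
    apply ht
    rw [mem_Icc, not_and_or, not_le, not_le] at hn
    rcases hn with hn | hn
    · simp only [hχ]
      rw [Real.smoothTransition.zero_of_nonpos (div_nonpos_of_nonpos_of_nonneg (by linarith) hr0.le),
        Real.smoothTransition.zero_of_nonpos (div_nonpos_of_nonpos_of_nonneg (by linarith) hr0.le),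
        sub_zero]
    · simp only [hχ]
      rw [Real.smoothTransition.one_of_one_le (by rw [le_div_iff₀ hr0]; linarith),
        Real.smoothTransition.one_of_one_le (by rw [le_div_iff₀ hr0]; linarith), sub_self]
  have hE := h χ hχc (hsupp.trans (Icc_subset_Ioo h1 (by linarith [hr.2])))
    (fun t => sub_nonneg.2 (Real.smoothTransition.monotone (by gcongr)))
    (fun t => by
      have := Real.smoothTransition.le_one ((t - t₁) / r)
      have := Real.smoothTransition.nonneg ((t - t₂) / r)
      simp only [hχ]; linarith)
  have hint : ∀ b, Integrable fun t => deriv Real.smoothTransition ((t - b) / r) / r * f t := by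
    intro b
    refine Continuous.integrable_of_hasCompactSupport (((continuous_deriv_smoothTransition.comp
      (hlin b).continuous).div_const r).mul hf) ?_
    refine HasCompactSupport.intro (isCompact_Icc (a := b) (b := b + r)) fun t ht => ?_
    rw [deriv_smoothTransition_eq_zero, zero_div, zero_mul]
    contrapose! ht
    rw [mem_Icc, le_div_iff₀ hr0, div_le_iff₀ hr0] at ht
    exact ⟨by linarith [ht.1], by linarith [ht.2]⟩
  rw [← integral_sub (hint t₂) (hint t₁)]
  refine le_trans (le_of_eq ?_) hE
  rw [← integral_neg]
  congr 1
  ext t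
  rw [show deriv χ t = _ from ((hder t₁ t).sub (hder t₂ t)).deriv]
  ring

/-! ### Calculus of classical derivatives and the energy identity. -/

/-- The bilinear product `b ⊗ g`. -/
def tensorGrad {m n : ℕ} (b : RVec m) (g : Fin n → ℝ) : RGrad m n :=
  WithLp.toLp 2 fun ij => b ij.1 * g ij.2

theorem norm_tensorGrad_le {m n : ℕ} (b : RVec m) {g : Fin n → ℝ} {L : ℝ}
    (hg : ∀ j, |g j| ≤ L) : ‖tensorGrad b g‖ ≤ n * L * ‖b‖ := by
  rcases Nat.eq_zero_or_pos n with rfl | hn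
  · have : tensorGrad b g = 0 := by ext ⟨i, j⟩; exact j.elim0
    simp [this]
  have hL : 0 ≤ L := (abs_nonneg _).trans (hg ⟨0, hn⟩)
  have hn1 : (1 : ℝ) ≤ n := by exact_mod_cast hn
  refine abs_le_of_sq_le_sq' ?_ (by positivity) |>.2
  rw [EuclideanSpace.norm_sq_eq, mul_pow, EuclideanSpace.norm_sq_eq, Fintype.sum_prod_type,
    Finset.mul_sum]
  refine Finset.sum_le_sum fun i _ => ?_
  calc ∑ j, ‖(tensorGrad b g) (i, j)‖ ^ 2 ≤ ∑ _j : Fin n, L ^ 2 * ‖b i‖ ^ 2 := by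
        refine Finset.sum_le_sum fun j _ => ?_
        simp only [tensorGrad, norm_mul, mul_pow, Real.norm_eq_abs]
        rw [mul_comm]
        gcongr
        exact hg j
    _ = n * (L ^ 2 * ‖b i‖ ^ 2) := by simp
    _ ≤ (n * L) ^ 2 * ‖b i‖ ^ 2 := by
        rw [mul_pow, mul_assoc]
        gcongr
        nlinarith

theorem norm_spaceDeriv_le {n : ℕ} {F : Type*} [NormedAddCommGroup F] [NormedSpace ℝ F]
    (φ : RVec n × ℝ → F) (j : Fin n) (z : RVec n × ℝ) :
    ‖spaceDeriv φ j z‖ ≤ ‖fderiv ℝ φ z‖ := by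
  refine (ContinuousLinearMap.le_opNorm _ _).trans (mul_le_of_le_one_right (norm_nonneg _) ?_)
  simp [Prod.norm_def]

theorem norm_timeDeriv_le {n : ℕ} {F : Type*} [NormedAddCommGroup F] [NormedSpace ℝ F]
    (φ : RVec n × ℝ → F) (z : RVec n × ℝ) : ‖timeDeriv φ z‖ ≤ ‖fderiv ℝ φ z‖ := by
  refine (ContinuousLinearMap.le_opNorm _ _).trans (mul_le_of_le_one_right (norm_nonneg _) ?_)
  simp [Prod.norm_def]

theorem norm_spaceDeriv_le_norm_spaceGrad {m n : ℕ} (φ : RVec n × ℝ → RVec m) (j : Fin n)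
    (z : RVec n × ℝ) : ‖spaceDeriv φ j z‖ ≤ ‖spaceGrad φ z‖ := by
  refine abs_le_of_sq_le_sq' ?_ (norm_nonneg _) |>.2
  rw [EuclideanSpace.norm_sq_eq, EuclideanSpace.norm_sq_eq, Fintype.sum_prod_type]
  exact Finset.sum_le_sum fun i _ => Finset.single_le_sum
    (f := fun j => ‖spaceGrad φ z (i, j)‖ ^ 2) (fun _ _ => by positivity) (Finset.mem_univ j)

theorem fderiv_slice {n : ℕ} {F : Type*} [NormedAddCommGroup F] [NormedSpace ℝ F]
    {w : RVec n × ℝ → F} (hw : ContDiff ℝ 1 w) (x : RVec n) (t : ℝ) :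
    fderiv ℝ (fun x => w (x, t)) x
      = (fderiv ℝ w (x, t)).comp (ContinuousLinearMap.inl ℝ (RVec n) ℝ) :=
  ((hw.differentiable one_ne_zero (x, t)).hasFDerivAt.comp x (hasFDerivAt_prodMk_left x t)).fderiv

theorem norm_fderiv_slice_le {m n : ℕ} {w : RVec n × ℝ → RVec m} (hw : ContDiff ℝ 1 w)
    (x : RVec n) (t : ℝ) : ‖fderiv ℝ (fun x => w (x, t)) x‖ ≤ n * ‖spaceGrad w (x, t)‖ := by
  rw [fderiv_slice hw]
  refine ContinuousLinearMap.opNorm_le_bound _ (by positivity) fun y => ?_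
  have hy : ((fderiv ℝ w (x, t)).comp (ContinuousLinearMap.inl ℝ (RVec n) ℝ)) y
      = ∑ j, y j • spaceDeriv w j (x, t) := by
    conv_lhs => rw [← (EuclideanSpace.basisFun (Fin n) ℝ).sum_repr y]
    simp [spaceDeriv]
  rw [hy]
  calc _ ≤ ∑ j : Fin n, ‖y‖ * ‖spaceGrad w (x, t)‖ := by
        refine (norm_sum_le _ _).trans (Finset.sum_le_sum fun j _ => ?_)
        rw [norm_smul]
        gcongr
        · exact PiLp.norm_apply_le y j
        · exact norm_spaceDeriv_le_norm_spaceGrad w j _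
    _ = _ := by simp; ring

instance volume_parabolic_isAddHaarMeasure {n : ℕ} :
    (volume : Measure (RVec n × ℝ)).IsAddHaarMeasure :=
  Measure.prod.instIsAddHaarMeasure _ _

theorem integral_timeDeriv_eq_zero {n : ℕ} {g : RVec n × ℝ → ℝ} (hg : ContDiff ℝ 1 g)
    (hc : HasCompactSupport g) : ∫ z, timeDeriv g z = 0 := by
  have hd : Integrable fun z => fderiv ℝ g z (0, 1) :=
    ((hg.continuous_fderiv one_ne_zero).clm_apply continuous_const).integrable_of_hasCompactSupport
      (hc.fderiv_apply ℝ _)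
  have := integral_mul_fderiv_eq_neg_fderiv_mul_of_integrable (𝕜 := ℝ)
    (μ := (volume : Measure (RVec n × ℝ))) (f := fun _ => (1 : ℝ)) (g := g) (v := ((0 : RVec n), 1))
    (by simp) (by simpa using hd)
    (by simpa using hg.continuous.integrable_of_hasCompactSupport hc)
    (fun _ _ => differentiableAt_const _) (fun z _ => hg.differentiable one_ne_zero z)
  simpa [timeDeriv] using this

section Product

variable {m n : ℕ} {κ : RVec n × ℝ → ℝ} {w : RVec n × ℝ → RVec m}

theorem timeDeriv_smul_sub (hκ : ContDiff ℝ 1 κ) (hw : ContDiff ℝ 1 w) (a : RVec m)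
    (z : RVec n × ℝ) :
    timeDeriv (fun z => κ z • (w z - a)) z
      = κ z • timeDeriv w z + timeDeriv κ z • (w z - a) := by
  have := fderiv_fun_smul (hκ.differentiable one_ne_zero z)
    ((hw.sub contDiff_const).differentiable one_ne_zero z : DifferentiableAt ℝ (fun z => w z - a) z)
  rw [timeDeriv, this, fderiv_sub_const]
  simp [timeDeriv]

theorem spaceDeriv_smul_sub (hκ : ContDiff ℝ 1 κ) (hw : ContDiff ℝ 1 w) (a : RVec m) (j : Fin n)
    (z : RVec n × ℝ) :
    spaceDeriv (fun z => κ z • (w z - a)) j z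
      = κ z • spaceDeriv w j z + spaceDeriv κ j z • (w z - a) := by
  have := fderiv_fun_smul (hκ.differentiable one_ne_zero z)
    ((hw.sub contDiff_const).differentiable one_ne_zero z : DifferentiableAt ℝ (fun z => w z - a) z)
  rw [spaceDeriv, this, fderiv_sub_const]
  simp [spaceDeriv]

theorem spaceGrad_smul_sub (hκ : ContDiff ℝ 1 κ) (hw : ContDiff ℝ 1 w) (a : RVec m)
    (z : RVec n × ℝ) :
    spaceGrad (fun z => κ z • (w z - a)) z
      = κ z • spaceGrad w z + tensorGrad (w z - a) (fun j => spaceDeriv κ j z) := by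
  ext ⟨i, j⟩
  simp only [spaceGrad, spaceDeriv_smul_sub hκ hw, tensorGrad, PiLp.add_apply, PiLp.smul_apply,
    smul_eq_mul]
  ring

/-- The energy identity behind testing a parabolic system with `κ (w - a)`. -/
theorem integral_inner_timeDeriv_smul_sub (hκ : ContDiff ℝ 1 κ) (hκc : HasCompactSupport κ)
    (hw : ContDiff ℝ 1 w) (a : RVec m) :
    ∫ z, inner ℝ (w z) (timeDeriv (fun z => κ z • (w z - a)) z)
      = 1 / 2 * ∫ z, timeDeriv κ z * ‖w z - a‖ ^ 2 := by
  -- The integrand differs from ½ κ_t |w - a|² by ∂_t g, and g has compact support. The second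
  -- summand is needed because the pairing is with w and not with w - a.
  set g : RVec n × ℝ → ℝ := fun z => κ z * (1 / 2 * ‖w z - a‖ ^ 2 + inner ℝ a (w z - a)) with hg
  have hwa : ContDiff ℝ 1 fun z => w z - a := hw.sub contDiff_const
  have hgc : ContDiff ℝ 1 g :=
    hκ.mul ((contDiff_const.mul (hwa.norm_sq ℝ)).add (contDiff_const.inner ℝ hwa))
  have hgs : HasCompactSupport g := hκc.mul_right
  have hpt : ∀ z, inner ℝ (w z) (timeDeriv (fun z => κ z • (w z - a)) z)
      = timeDeriv g z + 1 / 2 * (timeDeriv κ z * ‖w z - a‖ ^ 2) := by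
    intro z
    have hdκ := (hκ.differentiable one_ne_zero z).hasFDerivAt
    have hdw := (hw.differentiable one_ne_zero z).hasFDerivAt.sub_const a
    have hdg := hdκ.mul (((hdw.norm_sq).const_mul (1 / 2)).add
      ((hasFDerivAt_const a z).inner ℝ hdw))
    rw [timeDeriv_smul_sub hκ hw]
    have hv : timeDeriv g z = κ z * (inner ℝ (w z - a) (timeDeriv w z) +
        inner ℝ a (timeDeriv w z)) +
        (1 / 2 * ‖w z - a‖ ^ 2 + inner ℝ a (w z - a)) * timeDeriv κ z := by
      rw [timeDeriv, show fderiv ℝ g z = _ from hdg.fderiv]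
      simp [timeDeriv, inner_sub_left]
      ring
    rw [hv, ← inner_add_left, sub_add_cancel, inner_add_right, inner_smul_right, inner_smul_right]
    have : inner ℝ (w z) (w z - a) = ‖w z - a‖ ^ 2 + inner ℝ a (w z - a) := by
      rw [← real_inner_self_eq_norm_sq, ← inner_add_left, sub_add_cancel]
    rw [this]
    ring
  simp_rw [hpt]
  have hct : Continuous fun z => timeDeriv g z :=
    (hgc.continuous_fderiv one_ne_zero).clm_apply continuous_const
  have hκt : Continuous fun z => timeDeriv κ z :=
    (hκ.continuous_fderiv one_ne_zero).clm_apply continuous_const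
  have hκts : HasCompactSupport fun z => timeDeriv κ z := hκc.fderiv_apply ℝ _
  rw [integral_add, integral_timeDeriv_eq_zero hgc hgs, zero_add, integral_const_mul]
  · exact hct.integrable_of_hasCompactSupport (hgs.fderiv_apply ℝ _)
  · refine Integrable.const_mul ?_ _
    exact (hκt.mul (hwa.continuous.norm.pow 2)).integrable_of_hasCompactSupport hκts.mul_right

end Product

/-! ### Young-type inequalities. -/

/-- Split at y = e^{1/r}, below which y^r ≤ e. It trades any lower power for a small constant plus
the top power P. -/
theorem exists_rpow_le_add_mul_rpow {r P : ℝ} (hr : 0 < r) (hrP : r ≤ P) {e : ℝ} (he : 0 < e) :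
    ∃ C : ℝ, 0 ≤ C ∧ ∀ y : ℝ, 0 ≤ y → y ^ r ≤ e + C * y ^ P := by
  refine ⟨(e ^ (1 / r)) ^ (r - P), by positivity, fun y hy => ?_⟩
  rcases le_total y (e ^ (1 / r)) with h | h
  · have : y ^ r ≤ e := by
      calc y ^ r ≤ (e ^ (1 / r)) ^ r := Real.rpow_le_rpow hy h hr.le
        _ = e := by rw [← Real.rpow_mul he.le, one_div_mul_cancel hr.ne', Real.rpow_one]
    have : 0 ≤ (e ^ (1 / r)) ^ (r - P) * y ^ P := by positivity
    linarith
  · have hy0 : 0 < y := lt_of_lt_of_le (by positivity) h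
    calc y ^ r = y ^ (r - P) * y ^ P := by rw [← Real.rpow_add hy0]; ring_nf
      _ ≤ (e ^ (1 / r)) ^ (r - P) * y ^ P := by
        gcongr ?_ * _
        exact Real.rpow_le_rpow_of_nonpos (by positivity) h (by linarith)
      _ ≤ _ := by linarith

theorem exists_mul_le_mul_rpow_add {p : ℝ} (hp : 1 < p) {e : ℝ} (he : 0 < e) :
    ∃ C : ℝ, 0 ≤ C ∧ ∀ g y : ℝ, 0 ≤ g → 0 ≤ y → g * y ≤ e * g ^ (p / (p - 1)) + C * y ^ p := by
  refine ⟨(1 / e) ^ (p - 1), by positivity, fun g y hg hy => ?_⟩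
  have hp1 : 0 < p - 1 := by linarith
  have hpos : 0 ≤ (1 / e) ^ (p - 1) * y ^ p := by positivity
  have hpos' : 0 ≤ e * g ^ (p / (p - 1)) := by positivity
  rcases hg.eq_or_lt with rfl | hg0
  · rw [zero_mul]; linarith
  rcases hy.eq_or_lt with rfl | hy0
  · rw [mul_zero]; linarith
  rcases le_total y (e * g ^ (1 / (p - 1))) with h | h
  · have : g * y ≤ e * g ^ (p / (p - 1)) := by
      calc g * y ≤ g * (e * g ^ (1 / (p - 1))) := by gcongr
        _ = e * (g ^ (1 : ℝ) * g ^ (1 / (p - 1))) := by rw [Real.rpow_one]; ring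
        _ = _ := by
          rw [← Real.rpow_add hg0]
          congr 2
          field_simp
          ring
    linarith
  · have h1 : g ≤ (1 / e * y) ^ (p - 1) := by
      calc g = (g ^ (1 / (p - 1))) ^ (p - 1) := by
            rw [← Real.rpow_mul hg, one_div_mul_cancel hp1.ne', Real.rpow_one]
        _ ≤ _ := by
            gcongr
            rw [one_div_mul_eq_div, le_div_iff₀ he]
            linarith
    calc g * y ≤ (1 / e * y) ^ (p - 1) * y := by gcongr
      _ = (1 / e) ^ (p - 1) * (y ^ (p - 1) * y ^ (1 : ℝ)) := by
        rw [Real.mul_rpow (by positivity) hy, Real.rpow_one]; ring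
      _ = (1 / e) ^ (p - 1) * y ^ p := by rw [← Real.rpow_add hy0]; ring_nf
      _ ≤ _ := by linarith

/-- With y = ψ|w - a| and g the size of the flux, the left side is what the derivatives of the
cutoff produce. P = max(p, 2) is the smallest power that controls both y² and y^p in this form. -/
theorem exists_sq_add_mul_le {p P : ℝ} (hp : 1 < p) (hpP : p ≤ P) (hP : 2 ≤ P) {e : ℝ}
    (he : 0 < e) :
    ∃ C : ℝ, 0 ≤ C ∧ ∀ g y : ℝ, 0 ≤ g → 0 ≤ y →
      y ^ 2 + g * y ≤ e * (1 + g ^ (p / (p - 1))) + C * y ^ P := by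
  obtain ⟨C₁, hC₁, h₁⟩ := exists_rpow_le_add_mul_rpow two_pos hP (half_pos he)
  obtain ⟨C₂, hC₂, h₂⟩ := exists_mul_le_mul_rpow_add hp he
  obtain ⟨C₃, hC₃, h₃⟩ := exists_rpow_le_add_mul_rpow (by linarith : 0 < p) hpP
    (e := e / 2 / (C₂ + 1)) (by positivity)
  refine ⟨C₁ + C₂ * C₃, by positivity, fun g y hg hy => ?_⟩
  have a := h₁ y hy
  rw [Real.rpow_two] at a
  have b := h₂ g y hg hy
  have c : C₂ * y ^ p ≤ e / 2 + C₂ * C₃ * y ^ P := by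
    have h := mul_le_mul_of_nonneg_left (h₃ y hy) hC₂
    have : C₂ * (e / 2 / (C₂ + 1)) ≤ e / 2 := by
      rw [mul_div_assoc', div_le_iff₀ (by positivity)]
      nlinarith
    linarith
  linarith

/-! ### Continuity, supports and integrability on open cylinders. -/

theorem Continuous.integrableOn_parCylInt {n : ℕ} {F : Type*} [NormedAddCommGroup F]
    {f : RVec n × ℝ → F} (hf : Continuous f) (x : RVec n) (t R ρ : ℝ) :
    IntegrableOn f (parCylInt x t R ρ) := by
  refine (hf.continuousOn.integrableOn_compact
    ((isCompact_closedBall x R).prod (isCompact_Icc (a := t - ρ) (b := t)))).mono_set ?_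
  exact prod_mono Metric.ball_subset_closedBall Ioo_subset_Icc_self

theorem measurableSet_parCylInt {n : ℕ} (x : RVec n) (t R ρ : ℝ) :
    MeasurableSet (parCylInt x t R ρ) :=
  measurableSet_ball.prod measurableSet_Ioo

theorem mem_parCylInt {n : ℕ} {x : RVec n} {t R ρ : ℝ} {z : RVec n × ℝ} :
    z ∈ parCylInt x t R ρ ↔ dist z.1 x < R ∧ t - ρ < z.2 ∧ z.2 < t := by
  simp [parCylInt, mem_prod]

theorem measureReal_parCylInt_le {n : ℕ} {β : ℝ} (hβ : β ≤ 0) :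
    volume.real (parCylInt (0 : RVec n) β (3 / 2) (β + 2))
      ≤ 2 * volume.real (Metric.ball (0 : RVec n) (3 / 2)) := by
  have : (volume : Measure (RVec n × ℝ)) = volume.prod volume := rfl
  rw [parCylInt, this, measureReal_prod_prod, mul_comm]
  gcongr
  rw [Real.volume_real_Ioo]
  exact max_le (by linarith) two_pos.le

theorem continuous_timeDeriv {n : ℕ} {F : Type*} [NormedAddCommGroup F] [NormedSpace ℝ F]
    {φ : RVec n × ℝ → F} (hφ : ContDiff ℝ 1 φ) : Continuous (timeDeriv φ) :=
  (hφ.continuous_fderiv one_ne_zero).clm_apply continuous_const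

theorem continuous_spaceDeriv {n : ℕ} {F : Type*} [NormedAddCommGroup F] [NormedSpace ℝ F]
    {φ : RVec n × ℝ → F} (hφ : ContDiff ℝ 1 φ) (j : Fin n) : Continuous (spaceDeriv φ j) :=
  (hφ.continuous_fderiv one_ne_zero).clm_apply continuous_const

theorem continuous_spaceGrad {m n : ℕ} {φ : RVec n × ℝ → RVec m} (hφ : ContDiff ℝ 1 φ) :
    Continuous (spaceGrad φ) := by
  refine (PiLp.continuous_toLp 2 _).comp (continuous_pi fun ij => ?_)
  exact (EuclideanSpace.proj ij.1 : RVec m →L[ℝ] ℝ).continuous.comp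
    (continuous_spaceDeriv hφ ij.2)

theorem HasCompactSupport.timeDeriv {n : ℕ} {F : Type*} [NormedAddCommGroup F] [NormedSpace ℝ F]
    {φ : RVec n × ℝ → F} (hφ : HasCompactSupport φ) : HasCompactSupport (timeDeriv φ) :=
  hφ.fderiv_apply ℝ _

theorem fderiv_eq_zero_of_notMem_tsupport {n : ℕ} {F : Type*} [NormedAddCommGroup F]
    [NormedSpace ℝ F] {φ : RVec n × ℝ → F} {z : RVec n × ℝ} (hz : z ∉ tsupport φ) :
    fderiv ℝ φ z = 0 :=
  image_eq_zero_of_notMem_tsupport fun h => hz (tsupport_fderiv_subset ℝ h)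

theorem timeDeriv_eq_zero_of_notMem_tsupport {n : ℕ} {F : Type*} [NormedAddCommGroup F]
    [NormedSpace ℝ F] {φ : RVec n × ℝ → F} {z : RVec n × ℝ} (hz : z ∉ tsupport φ) :
    timeDeriv φ z = 0 := by
  rw [timeDeriv, fderiv_eq_zero_of_notMem_tsupport hz, _root_.zero_apply]

theorem spaceGrad_eq_zero_of_notMem_tsupport {m n : ℕ} {φ : RVec n × ℝ → RVec m}
    {z : RVec n × ℝ} (hz : z ∉ tsupport φ) : spaceGrad φ z = 0 := by
  ext ij
  simp [spaceGrad, spaceDeriv, fderiv_eq_zero_of_notMem_tsupport hz]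

theorem HasCompactSupport.spaceGrad {m n : ℕ} {φ : RVec n × ℝ → RVec m}
    (hφ : HasCompactSupport φ) : HasCompactSupport (spaceGrad φ) :=
  HasCompactSupport.intro hφ fun _ hz => spaceGrad_eq_zero_of_notMem_tsupport hz

/-! ### Smooth approximate solutions: drift of means and energy inequality. -/

/-- `w` and `G` satisfy `w_t = div G` up to a small error. -/
def IsApproxDivSol {m n : ℕ} (p c : ℝ) (x : RVec n) (t R ρ : ℝ) (w : RVec n × ℝ → RVec m)
    (G : RVec n × ℝ → RGrad m n) : Prop :=
  ∀ φ : RVec n × ℝ → RVec m, IsTestFun x t R ρ φ →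
    |∫ z, (-inner ℝ (w z) (timeDeriv φ z) + inner ℝ (G z) (spaceGrad φ z))|
      ≤ c * (1 + ∫ z, ‖spaceGrad φ z‖ ^ p)

theorem IsApproxDivSol.abs_neg_add_le {m n : ℕ} {p c : ℝ} {x : RVec n} {t R ρ : ℝ}
    {w : RVec n × ℝ → RVec m} {G : RVec n × ℝ → RGrad m n} (h : IsApproxDivSol p c x t R ρ w G)
    (hw : Continuous w) (hG : Continuous G) {φ : RVec n × ℝ → RVec m}
    (hφ : IsTestFun x t R ρ φ) :
    |-(∫ z, inner ℝ (w z) (timeDeriv φ z)) + ∫ z, inner ℝ (G z) (spaceGrad φ z)|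
      ≤ c * (1 + ∫ z, ‖spaceGrad φ z‖ ^ p) := by
  rw [← integral_neg, ← integral_add]
  · exact h φ hφ
  · refine ((hw.inner (continuous_timeDeriv hφ.contDiff)).integrable_of_hasCompactSupport ?_).neg
    exact HasCompactSupport.intro hφ.compactSupport fun z hz => by
      rw [timeDeriv_eq_zero_of_notMem_tsupport hz, inner_zero_right]
  · refine (hG.inner (continuous_spaceGrad hφ.contDiff)).integrable_of_hasCompactSupport ?_
    exact HasCompactSupport.intro hφ.compactSupport fun z hz => by
      rw [spaceGrad_eq_zero_of_notMem_tsupport hz, inner_zero_right]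

section Means

variable {m n : ℕ} {ζ : RVec n → ℝ}

theorem continuous_integral_smul_slice (hζ : Continuous ζ) {R : ℝ}
    (hζR : tsupport ζ ⊆ Metric.ball 0 R) {w : RVec n × ℝ → RVec m} (hw : Continuous w) :
    Continuous fun t => ∫ x, ζ x • w (x, t) := by
  have h : ∀ t, ∫ x, ζ x • w (x, t) = ∫ x in Metric.closedBall 0 R, ζ x • w (x, t) := fun t => by
    rw [setIntegral_eq_integral_of_forall_compl_eq_zero]
    intro x hx
    rw [image_eq_zero_of_notMem_tsupport fun h => hx (Metric.ball_subset_closedBall (hζR h)),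
      zero_smul]
  simp_rw [h]
  exact continuous_parametric_integral_of_continuous (f := fun t x => ζ x • w (x, t))
    ((hζ.comp continuous_snd).smul (hw.comp (by fun_prop))) (isCompact_closedBall 0 R)

/-- Weighted means of an approximate solution change slowly in time. -/
theorem exists_norm_mean_sub_mean_le {p : ℝ} (hp : 1 < p) (hζ : ContDiff ℝ 1 ζ)
    (hζR : tsupport ζ ⊆ Metric.ball 0 (3 / 2)) :
    ∃ C : ℝ, 0 ≤ C ∧ ∀ c β : ℝ, 0 ≤ c → β ≤ 0 → ∀ (w : RVec n × ℝ → RVec m)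
      (G : RVec n × ℝ → RGrad m n), Continuous w → Continuous G →
      IsApproxDivSol p c 0 β (3 / 2) (β + 2) w G →
      ∫ z in parCylInt 0 β (3 / 2) (β + 2), ‖G z‖ ≤ c →
      ∀ t ∈ Ioo (-2) β, ∀ t' ∈ Ioo (-2) β,
        ‖(∫ x, ζ x • w (x, t)) - ∫ x, ζ x • w (x, t')‖ ≤ C * c := by
  have hζc : HasCompactSupport ζ :=
    HasCompactSupport.of_support_subset_isCompact (isCompact_closedBall 0 (3 / 2))
      ((subset_tsupport ζ).trans (hζR.trans Metric.ball_subset_closedBall))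
  obtain ⟨L₀, hL₀⟩ : ∃ L : ℝ, ∀ x, ‖fderiv ℝ ζ x‖ ≤ L :=
    (hζ.continuous_fderiv one_ne_zero).bounded_above_of_compact_support (hζc.fderiv ℝ)
  obtain ⟨L, hL0, hL⟩ : ∃ L : ℝ, 0 ≤ L ∧ ∀ x, ‖fderiv ℝ ζ x‖ ≤ L :=
    ⟨max L₀ 0, le_max_right _ _, fun x => (hL₀ x).trans (le_max_left _ _)⟩
  set V := 2 * volume.real (Metric.ball (0 : RVec n) (3 / 2)) with hV
  have hV0 : 0 ≤ V := by positivity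
  refine ⟨1 + V * (n * L) ^ p + n * L, by positivity, ?_⟩
  intro c β hc hβ w G hw hG hsol hGc
  set D := parCylInt (0 : RVec n) β (3 / 2) (β + 2) with hD
  have hDV : volume.real D ≤ V := measureReal_parCylInt_le hβ
  set a : ℝ → RVec m := fun t => ∫ x, ζ x • w (x, t) with ha
  have hac : Continuous a := continuous_integral_smul_slice hζ.continuous hζR hw
  have key : ∀ b : RVec m, ‖b‖ = 1 → ∀ t₁ t₂, -2 < t₁ → t₁ ≤ t₂ → t₂ < β →
      inner ℝ (a t₂) b - inner ℝ (a t₁) b ≤ (1 + V * (n * L) ^ p + n * L) * c := by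
    intro b hb t₁ t₂ h1 h12 h2
    refine sub_le_of_forall_neg_integral_deriv_mul_le (f := fun t => inner ℝ (a t) b)
      (hac.inner continuous_const) (fun χ hχ hχs hχ0 hχ1 => ?_) h1 h12 h2
    -- With this test function the time term is the weak derivative of t ↦ ⟨a(t), b⟩. The gradient
    -- of φ is bounded independently of χ', so the rest is at most a constant times c.
    set φ : RVec n × ℝ → RVec m := fun z => (χ z.2 * ζ z.1) • b with hφ
    have hφc : ContDiff ℝ 1 φ :=
      ((hχ.comp contDiff_snd).mul (hζ.comp contDiff_fst)).smul contDiff_const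
    have hdφ : ∀ z : RVec n × ℝ, HasFDerivAt φ ((χ z.2 • (fderiv ℝ ζ z.1).comp
        (ContinuousLinearMap.fst ℝ (RVec n) ℝ) + ζ z.1 •
        (deriv χ z.2 • ContinuousLinearMap.snd ℝ (RVec n) ℝ)).smulRight b) z := by
      intro z
      have h1 : HasFDerivAt (fun z : RVec n × ℝ => χ z.2)
          (deriv χ z.2 • ContinuousLinearMap.snd ℝ (RVec n) ℝ) z :=
        ((hχ.differentiable one_ne_zero z.2).hasDerivAt).comp_hasFDerivAt z hasFDerivAt_snd
      have h2 : HasFDerivAt (fun z : RVec n × ℝ => ζ z.1)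
          ((fderiv ℝ ζ z.1).comp (ContinuousLinearMap.fst ℝ (RVec n) ℝ)) z :=
        (hζ.differentiable one_ne_zero z.1).hasFDerivAt.comp z hasFDerivAt_fst
      exact (h1.mul h2).smul_const b
    have htd : ∀ z, timeDeriv φ z = (deriv χ z.2 * ζ z.1) • b := fun z => by
      rw [timeDeriv, (hdφ z).fderiv]
      simp [mul_comm]
    have hsd : ∀ z, spaceGrad φ z
        = tensorGrad b (fun j => χ z.2 * fderiv ℝ ζ z.1 (EuclideanSpace.single j 1)) := fun z => by
      ext ⟨i, j⟩
      simp only [spaceGrad, spaceDeriv, tensorGrad]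
      rw [(hdφ z).fderiv]
      simp [mul_comm]
    have hts : tsupport φ ⊆ tsupport ζ ×ˢ tsupport χ := by
      refine closure_minimal (fun z hz => ?_)
        ((isClosed_tsupport ζ).prod (isClosed_tsupport χ))
      have hz' : χ z.2 * ζ z.1 ≠ 0 := fun h => hz (by simp only [hφ, h, zero_smul])
      exact ⟨subset_tsupport _ (right_ne_zero_of_mul hz'),
        subset_tsupport _ (left_ne_zero_of_mul hz')⟩
    have hχI : HasCompactSupport χ :=
      HasCompactSupport.of_support_subset_isCompact isCompact_Icc
        ((subset_tsupport χ).trans (hχs.trans Ioo_subset_Icc_self))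
    have htest : IsTestFun 0 β (3 / 2) (β + 2) φ := by
      refine ⟨hφc, ?_, ?_⟩
      · exact (hζc.isCompact.prod hχI.isCompact).of_isClosed_subset (isClosed_tsupport _) hts
      · refine hts.trans (prod_mono hζR (hχs.trans ?_))
        rw [sub_add_cancel_left]
    have hφD : ∀ z ∉ D, spaceGrad φ z = 0 := fun z hz =>
      spaceGrad_eq_zero_of_notMem_tsupport fun h => hz (htest.support_subset h)
    have hbd : ∀ z, ‖spaceGrad φ z‖ ≤ n * L := fun z => by
      rw [hsd]
      refine (norm_tensorGrad_le (L := L) b fun j => ?_).trans_eq (by rw [hb, mul_one])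
      rw [abs_mul, abs_of_nonneg (hχ0 _)]
      refine (mul_le_of_le_one_left (abs_nonneg _) (hχ1 _)).trans ?_
      have := (fderiv ℝ ζ z.1).le_opNorm (EuclideanSpace.single j (1 : ℝ))
      rw [PiLp.norm_single, norm_one, mul_one] at this
      exact this.trans (hL z.1)
    have hmain := hsol.abs_neg_add_le hw hG htest
    have e1 : ∫ z, inner ℝ (w z) (timeDeriv φ z) = ∫ t, deriv χ t * inner ℝ (a t) b := by
      have hint : Integrable (fun z => inner ℝ (w z) (timeDeriv φ z)) := by
        refine (hw.inner (continuous_timeDeriv hφc)).integrable_of_hasCompactSupport ?_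
        exact HasCompactSupport.intro htest.compactSupport fun z hz => by
          rw [timeDeriv_eq_zero_of_notMem_tsupport hz, inner_zero_right]
      have := integral_prod_symm (μ := (volume : Measure (RVec n))) (ν := (volume : Measure ℝ))
        (fun z => inner ℝ (w z) (timeDeriv φ z)) hint
      refine this.trans ?_
      congr 1
      ext t
      have hi : Integrable fun x => ζ x • w (x, t) :=
        (hζ.continuous.smul (hw.comp (by fun_prop))).integrable_of_hasCompactSupport hζc.smul_right
      rw [real_inner_comm, ha, ← integral_inner hi, ← integral_const_mul]
      congr 1
      ext x
      rw [htd, inner_smul_right, inner_smul_right, real_inner_comm]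
      ring
    have e2 : |∫ z, inner ℝ (G z) (spaceGrad φ z)| ≤ n * L * c := by
      rw [← setIntegral_eq_integral_of_forall_compl_eq_zero (s := D)
        (fun z hz => by rw [hφD z hz, inner_zero_right])]
      calc _ ≤ ∫ z in D, n * L * ‖G z‖ := by
            rw [← Real.norm_eq_abs]
            refine norm_integral_le_of_norm_le
              ((hG.norm.integrableOn_parCylInt _ _ _ _).const_mul _)
              (Filter.Eventually.of_forall fun z => ?_)
            refine (norm_inner_le_norm _ _).trans ?_
            rw [mul_comm]
            gcongr
            exact hbd z
        _ ≤ _ := by rw [integral_const_mul]; gcongr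
    have e3 : ∫ z, ‖spaceGrad φ z‖ ^ p ≤ V * (n * L) ^ p := by
      rw [← setIntegral_eq_integral_of_forall_compl_eq_zero (s := D)
        (fun z hz => by rw [hφD z hz, norm_zero, Real.zero_rpow (by linarith)])]
      calc _ ≤ ∫ z in D, (n * L : ℝ) ^ p := by
            refine integral_mono_of_nonneg (Filter.Eventually.of_forall fun z => by positivity)
              (continuous_const.integrableOn_parCylInt _ _ _ _)
              (Filter.Eventually.of_forall fun z => ?_)
            exact Real.rpow_le_rpow (norm_nonneg _) (hbd z) (by linarith)
        _ ≤ _ := by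
            rw [setIntegral_const, smul_eq_mul]
            gcongr
    rw [e1] at hmain
    have h3 := (abs_le.1 hmain).2
    have h4 := (abs_le.1 e2).1
    have h5 := mul_le_mul_of_nonneg_left e3 hc
    linarith
  have key' : ∀ t₁ t₂, -2 < t₁ → t₁ ≤ t₂ → t₂ < β →
      ‖a t₂ - a t₁‖ ≤ (1 + V * (n * L) ^ p + n * L) * c := by
    intro t₁ t₂ h1 h12 h2
    -- Choosing b along the increment recovers its norm from the directional bounds.
    rcases eq_or_ne (a t₂ - a t₁) 0 with h0 | h0
    · rw [h0, norm_zero]; positivity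
    · have := key (‖a t₂ - a t₁‖⁻¹ • (a t₂ - a t₁)) (norm_smul_inv_norm h0) t₁ t₂ h1 h12 h2
      rwa [← inner_sub_left, inner_smul_right, real_inner_self_eq_norm_sq, sq, ← mul_assoc,
        inv_mul_cancel₀ (norm_ne_zero_iff.2 h0), one_mul] at this
  intro t ht t' ht'
  rcases le_total t t' with h | h
  · rw [norm_sub_rev]
    exact key' t t' ht.1 h ht'.2
  · exact key' t' t ht'.1 h ht.2

end Means

section Energy

variable {m n : ℕ} {ψ : RVec n × ℝ → ℝ} {χ : ℝ → ℝ}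

theorem hasFDerivAt_cutoff (hψ : ContDiff ℝ 1 ψ) (hχ : ContDiff ℝ 1 χ) (z : RVec n × ℝ) :
    HasFDerivAt (fun z : RVec n × ℝ => χ z.2 * ψ z ^ 3)
      (χ z.2 • ((3 * ψ z ^ 2) • fderiv ℝ ψ z) +
        ψ z ^ 3 • (deriv χ z.2 • ContinuousLinearMap.snd ℝ (RVec n) ℝ)) z := by
  have h1 : HasFDerivAt (fun z : RVec n × ℝ => χ z.2)
      (deriv χ z.2 • ContinuousLinearMap.snd ℝ (RVec n) ℝ) z :=
    ((hχ.differentiable one_ne_zero z.2).hasDerivAt).comp_hasFDerivAt z hasFDerivAt_snd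
  have h2 := (hψ.differentiable one_ne_zero z).hasFDerivAt.pow 3
  exact h1.mul (by simpa using h2)

theorem timeDeriv_cutoff (hψ : ContDiff ℝ 1 ψ) (hχ : ContDiff ℝ 1 χ) (z : RVec n × ℝ) :
    timeDeriv (fun z : RVec n × ℝ => χ z.2 * ψ z ^ 3) z
      = deriv χ z.2 * ψ z ^ 3 + 3 * χ z.2 * ψ z ^ 2 * timeDeriv ψ z := by
  rw [timeDeriv, (hasFDerivAt_cutoff hψ hχ z).fderiv]
  simp [timeDeriv]
  ring

theorem spaceDeriv_cutoff (hψ : ContDiff ℝ 1 ψ) (hχ : ContDiff ℝ 1 χ) (j : Fin n)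
    (z : RVec n × ℝ) :
    spaceDeriv (fun z : RVec n × ℝ => χ z.2 * ψ z ^ 3) j z
      = 3 * χ z.2 * ψ z ^ 2 * spaceDeriv ψ j z := by
  rw [spaceDeriv, (hasFDerivAt_cutoff hψ hχ z).fderiv]
  simp [spaceDeriv]
  ring

theorem tsupport_cutoff_subset {β : ℝ}
    (hψs : tsupport ψ ⊆ Metric.closedBall 0 (5 / 4)) (hχs : tsupport χ ⊆ Ioo (-2) β) :
    tsupport (fun z : RVec n × ℝ => χ z.2 * ψ z ^ 3) ⊆ parCylInt 0 β (3 / 2) (β + 2) := by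
  have h : tsupport (fun z : RVec n × ℝ => χ z.2 * ψ z ^ 3)
      ⊆ tsupport ψ ∩ Prod.snd ⁻¹' tsupport χ := by
    refine closure_minimal (fun z hz => ?_)
      ((isClosed_tsupport ψ).inter ((isClosed_tsupport χ).preimage continuous_snd))
    have hz' : χ z.2 * ψ z ^ 3 ≠ 0 := hz
    exact ⟨subset_tsupport _ (pow_ne_zero_iff three_ne_zero |>.1 (right_ne_zero_of_mul hz')),
      subset_tsupport _ (left_ne_zero_of_mul hz')⟩
  intro z hz
  obtain ⟨h1, h2⟩ := h hz
  have h3 := hψs h1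
  rw [mem_closedBall_zero_iff] at h3
  have h4 := hχs h2
  rw [mem_parCylInt, dist_zero_right]
  exact ⟨by linarith [norm_fst_le z], by linarith [h4.1], h4.2⟩

theorem rpow_le_of_le_add {p P C₁ s d y L : ℝ} (hp : 0 < p) (hs : 0 ≤ s) (hd : 0 ≤ d)
    (hy : 0 ≤ y) (hL : 0 ≤ L) (hC : y ^ p ≤ 1 + C₁ * y ^ P) (h : s ≤ d + L * y) :
    s ^ p ≤ 2 ^ p * (d ^ p + L ^ p * (1 + C₁ * y ^ P)) := by
  have hLy : 0 ≤ L * y := mul_nonneg hL hy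
  have hle2 : s ≤ 2 * max d (L * y) :=
    h.trans (by linarith [le_max_left d (L * y), le_max_right d (L * y)])
  calc s ^ p ≤ (2 * max d (L * y)) ^ p := Real.rpow_le_rpow hs hle2 hp.le
    _ = 2 ^ p * (max d (L * y)) ^ p := Real.mul_rpow two_pos.le (le_max_of_le_right hLy)
    _ ≤ 2 ^ p * (d ^ p + L ^ p * y ^ p) := by
        gcongr
        rw [← Real.mul_rpow hL hy]
        have h1 : 0 ≤ d ^ p := by positivity
        have h2 : 0 ≤ (L * y) ^ p := by positivity
        rcases max_choice d (L * y) with h | h <;> rw [h] <;> linarith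
    _ ≤ _ := by gcongr

theorem add_le_mul_one_add_add {A B V C d W : ℝ} (hA : 0 ≤ A) (hB : 0 ≤ B) (hV : 0 ≤ V)
    (hC : 0 ≤ C) (hd : 0 ≤ d) (hW : 0 ≤ W) :
    1 + A * (d + B * (V + C * W)) ≤ (1 + A * (1 + B * (V + C))) * (1 + d + W) := by
  have h4 : 0 ≤ A * (B * V * (d + W)) := by positivity
  have h5 : 0 ≤ A * (B * C * (1 + d)) := by positivity
  have h6 : 0 ≤ A * (1 + W) := by positivity
  linarith

/-- Pointwise bound for the cutoff errors: k, t, v, x stand for χ, ψ_t, |w - a| and the flux paired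
with the gradient of the cutoff, whose tensor has size T. -/
theorem cutoff_terms_le {q P C e k t y v g L N T x ψ : ℝ} (hk0 : 0 ≤ k) (hk1 : k ≤ 1) (ht : t ≤ L)
    (hL : 0 ≤ L) (hN : 0 ≤ N) (hy : y = ψ * v) (hy0 : 0 ≤ y) (hg : 0 ≤ g) (hx : -x ≤ g * T)
    (hT : T ≤ N * (3 * L) * y)
    (hC : y ^ 2 + g * y ≤ e * (1 + g ^ q) + C * y ^ P) :
    3 / 2 * k * ψ ^ 2 * t * v ^ 2 - x ≤ 3 * (N + 1) * L * (e * (1 + g ^ q) + C * y ^ P) := by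
  have h1 : 3 / 2 * k * ψ ^ 2 * t * v ^ 2 ≤ 3 / 2 * L * y ^ 2 := by
    have h2 : k * t ≤ L :=
      (mul_le_mul_of_nonneg_left ht hk0).trans (mul_le_of_le_one_left hL hk1)
    calc _ = 3 / 2 * (ψ ^ 2 * v ^ 2) * (k * t) := by ring
      _ ≤ 3 / 2 * (ψ ^ 2 * v ^ 2) * L := by gcongr
      _ = _ := by rw [hy]; ring
  have h2 : -x ≤ N * (3 * L) * (g * y) :=
    hx.trans ((mul_le_mul_of_nonneg_left hT hg).trans_eq (by ring))
  refine le_trans ?_ (mul_le_mul_of_nonneg_left hC (by positivity))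
  have h3 : 0 ≤ L * (g * y) := by positivity
  have h4 : 0 ≤ L * y ^ 2 := by positivity
  have h5 : 0 ≤ N * (L * y ^ 2) := by positivity
  linarith

theorem setIntegral_mul_add_mul {α : Type*} [MeasurableSpace α] {μ : Measure α} {D : Set α}
    (hD : μ D ≠ ⊤) {f g : α → ℝ} (hf : IntegrableOn f D μ) (hg : IntegrableOn g D μ)
    (A B C V : ℝ) :
    IntegrableOn (fun z => A * (f z + B * (V + C * g z))) D μ ∧
    ∫ z in D, A * (f z + B * (V + C * g z)) ∂μ
      = A * ((∫ z in D, f z ∂μ) + B * (V * μ.real D + C * ∫ z in D, g z ∂μ)) := by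
  have h1 : IntegrableOn (fun _ => V) D μ := integrableOn_const hD
  have h2 : IntegrableOn (fun z => V + C * g z) D μ := h1.add (hg.const_mul C)
  have h3 : IntegrableOn (fun z => f z + B * (V + C * g z)) D μ := hf.add (h2.const_mul B)
  refine ⟨h3.const_mul A, ?_⟩
  rw [integral_const_mul, integral_add hf (h2.const_mul B), integral_const_mul,
    integral_add h1 (hg.const_mul C), integral_const_mul, setIntegral_const, smul_eq_mul,
    mul_comm V]

set_option maxHeartbeats 1000000 in
/-- The energy estimate for smooth approximate solutions. -/
theorem exists_energy_estimate {p P : ℝ} (hp : 1 < p) (hpP : p ≤ P) (hP : 2 ≤ P)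
    (hψ : ContDiff ℝ 1 ψ) (hψs : tsupport ψ ⊆ Metric.closedBall 0 (5 / 4))
    (hψ0 : ∀ z, 0 ≤ ψ z) (hψ1 : ∀ z, ψ z ≤ 1) :
    ∃ C₀ : ℝ, 0 ≤ C₀ ∧ ∀ e : ℝ, 0 < e → ∃ C : ℝ, 0 ≤ C ∧
      ∀ c β : ℝ, 0 ≤ c → β ≤ 0 → ∀ (w : RVec n × ℝ → RVec m)
      (G : RVec n × ℝ → RGrad m n), ContDiff ℝ 1 w → Continuous G →
      IsApproxDivSol p c 0 β (3 / 2) (β + 2) w G → ∀ (a : RVec m) (χ : ℝ → ℝ), ContDiff ℝ 1 χ →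
      tsupport χ ⊆ Ioo (-2) β → (∀ t, 0 ≤ χ t) → (∀ t, χ t ≤ 1) →
      -(1 / 2) * (∫ z : RVec n × ℝ, deriv χ z.2 * (ψ z ^ 3 * ‖w z - a‖ ^ 2)) +
        ∫ z : RVec n × ℝ, χ z.2 * ψ z ^ 3 * inner ℝ (G z) (spaceGrad w z)
      ≤ C₀ * e * (1 + ∫ z in parCylInt 0 β (3 / 2) (β + 2), ‖G z‖ ^ (p / (p - 1))) +
        C * (∫ z in parCylInt 0 β (3 / 2) (β + 2), (ψ z * ‖w z - a‖) ^ P) +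
        C₀ * c * (1 + (∫ z in parCylInt 0 β (3 / 2) (β + 2), ‖spaceGrad w z‖ ^ p) +
          ∫ z in parCylInt 0 β (3 / 2) (β + 2), (ψ z * ‖w z - a‖) ^ P) := by
  have hψc : HasCompactSupport ψ :=
    (isCompact_closedBall _ _).of_isClosed_subset (isClosed_tsupport _) hψs
  obtain ⟨L₀, hL₀⟩ : ∃ L : ℝ, ∀ x, ‖fderiv ℝ ψ x‖ ≤ L :=
    (hψ.continuous_fderiv one_ne_zero).bounded_above_of_compact_support (hψc.fderiv ℝ)
  obtain ⟨L, hL0, hL⟩ : ∃ L : ℝ, 0 ≤ L ∧ ∀ x, ‖fderiv ℝ ψ x‖ ≤ L :=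
    ⟨max L₀ 0, le_max_right _ _, fun x => (hL₀ x).trans (le_max_left _ _)⟩
  set V := 2 * volume.real (Metric.ball (0 : RVec n) (3 / 2)) with hV
  have hV0 : 0 ≤ V := by positivity
  obtain ⟨C₁, hC₁0, hC₁⟩ := exists_rpow_le_add_mul_rpow (by linarith : 0 < p) hpP one_pos
  set L' : ℝ := 3 * (n + 1) * L with hL'
  have hL'0 : 0 ≤ L' := by positivity
  set C₂ : ℝ := 1 + 2 ^ p * (1 + L' ^ p * (V + C₁)) with hC₂
  -- C₀ is fixed before e, so the flux term C₀ e can be made small later; only the constant in front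
  -- of ∫(ψ|w - a|)^P depends on e.
  refine ⟨L' * (V + 1) + C₂, by positivity, fun e he => ?_⟩
  obtain ⟨C₃, hC₃0, hC₃⟩ := exists_sq_add_mul_le hp hpP hP he
  refine ⟨L' * C₃, by positivity, ?_⟩
  intro c β hc hβ w G hw hG hsol a χ hχ hχs hχ0 hχ1
  set D := parCylInt (0 : RVec n) β (3 / 2) (β + 2) with hD
  have hDV : volume.real D ≤ V := measureReal_parCylInt_le hβ
  -- The cube leaves ψ² in every derivative falling on ψ. Hence the time term is a multiple of y²
  -- and the space term at most a multiple of y, where y = ψ|w - a|.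
  set κ : RVec n × ℝ → ℝ := fun z => χ z.2 * ψ z ^ 3 with hκ
  have hκc : ContDiff ℝ 1 κ := (hχ.comp contDiff_snd).mul (hψ.pow 3)
  have hκD : tsupport κ ⊆ D := tsupport_cutoff_subset hψs hχs
  have hκs : HasCompactSupport κ := (hψc.comp_left (g := fun x : ℝ => x ^ 3) (by simp)).mul_left
  set φ : RVec n × ℝ → RVec m := fun z => κ z • (w z - a) with hφ
  have hwa : ContDiff ℝ 1 fun z => w z - a := hw.sub contDiff_const
  have htest : IsTestFun 0 β (3 / 2) (β + 2) φ :=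
    ⟨hκc.smul hwa, hκs.smul_right, (tsupport_smul_subset_left _ _).trans hκD⟩
  have hφD : ∀ z ∉ D, spaceGrad φ z = 0 := fun z hz =>
    spaceGrad_eq_zero_of_notMem_tsupport fun h => hz (htest.support_subset h)
  set y : RVec n × ℝ → ℝ := fun z => ψ z * ‖w z - a‖ with hy
  have hy0 : ∀ z, 0 ≤ y z := fun z => mul_nonneg (hψ0 z) (norm_nonneg _)
  have hyc : Continuous y := hψ.continuous.mul hwa.continuous.norm
  set τ : RVec n × ℝ → RGrad m n :=
    fun z => tensorGrad (w z - a) (fun j => spaceDeriv κ j z) with hτ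
  have hgrad : ∀ z, spaceGrad φ z = κ z • spaceGrad w z + τ z := fun z =>
    spaceGrad_smul_sub hκc hw a z
  have hκ0 : ∀ z, 0 ≤ κ z := fun z => mul_nonneg (hχ0 _) (pow_nonneg (hψ0 z) 3)
  have hκ1 : ∀ z, κ z ≤ 1 := fun z =>
    mul_le_one₀ (hχ1 _) (pow_nonneg (hψ0 z) 3) (pow_le_one₀ (hψ0 z) (hψ1 z))
  have hsq : ∀ z, χ z.2 * ψ z ^ 2 ≤ ψ z := fun z =>
    (mul_le_of_le_one_left (by positivity) (hχ1 _)).trans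
      (by nlinarith [hψ0 z, hψ1 z])
  have hτy : ∀ z, ‖τ z‖ ≤ n * (3 * L) * y z := fun z => by
    refine (norm_tensorGrad_le (L := 3 * L * ψ z) _ fun j => ?_).trans_eq
      (by simp only [hy]; ring)
    rw [spaceDeriv_cutoff hψ hχ, abs_mul, abs_of_nonneg
      (by have := hχ0 z.2; positivity)]
    have h1 := (norm_spaceDeriv_le ψ j z).trans (hL z)
    rw [Real.norm_eq_abs] at h1
    calc 3 * χ z.2 * ψ z ^ 2 * |spaceDeriv ψ j z| = 3 * (χ z.2 * ψ z ^ 2) * |spaceDeriv ψ j z| := by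
          ring
      _ ≤ 3 * ψ z * L := by
          have := hψ0 z
          have := hsq z
          gcongr
      _ = _ := by ring
  have hcw : Continuous (spaceGrad w) := continuous_spaceGrad hw
  have hcφ : Continuous (spaceGrad φ) := continuous_spaceGrad htest.contDiff
  have hmain := (abs_le.1 (hsol.abs_neg_add_le hw.continuous hG htest)).2
  rw [integral_inner_timeDeriv_smul_sub hκc hκs hw a] at hmain
  have hPc : Continuous fun z => y z ^ P := hyc.rpow_const fun _ => Or.inr (by linarith)
  have hdp : Continuous fun z => ‖spaceGrad w z‖ ^ p :=
    hcw.norm.rpow_const fun _ => Or.inr (by linarith)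
  have hgp : Continuous fun z => ‖G z‖ ^ (p / (p - 1)) :=
    hG.norm.rpow_const fun _ => Or.inr (div_nonneg (by linarith) (by linarith))
  have hW0 : 0 ≤ ∫ z in D, y z ^ P :=
    integral_nonneg fun z => Real.rpow_nonneg (hy0 z) _
  have hd0 : 0 ≤ ∫ z in D, ‖spaceGrad w z‖ ^ p := integral_nonneg fun z => by positivity
  have hg0 : 0 ≤ ∫ z in D, ‖G z‖ ^ (p / (p - 1)) := integral_nonneg fun z => by positivity
  have hnL : n * (3 * L) ≤ L' := by rw [hL']; nlinarith
  have hDt : volume D ≠ ⊤ := by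
    refine ne_top_of_le_ne_top ((isCompact_closedBall (0 : RVec n) (3 / 2)).prod
      (isCompact_Icc (a := β - (β + 2)) (b := β))).measure_lt_top.ne
      (measure_mono (prod_mono Metric.ball_subset_closedBall Ioo_subset_Icc_self))
  have iP := hPc.integrableOn_parCylInt 0 β (3 / 2) (β + 2)
  have id := hdp.integrableOn_parCylInt 0 β (3 / 2) (β + 2)
  have ig := hgp.integrableOn_parCylInt 0 β (3 / 2) (β + 2)
  have e3 : ∫ z, ‖spaceGrad φ z‖ ^ p ≤ 2 ^ p * ((∫ z in D, ‖spaceGrad w z‖ ^ p) +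
      L' ^ p * (V + C₁ * ∫ z in D, y z ^ P)) := by
    rw [← setIntegral_eq_integral_of_forall_compl_eq_zero (s := D)
      (fun z hz => by rw [hφD z hz, norm_zero, Real.zero_rpow (by linarith)])]
    obtain ⟨hi, he⟩ := setIntegral_mul_add_mul hDt id iP (2 ^ p) (L' ^ p) C₁ 1
    calc _ ≤ ∫ z in D, 2 ^ p * (‖spaceGrad w z‖ ^ p + L' ^ p * (1 + C₁ * y z ^ P)) := by
          refine integral_mono_of_nonneg (Filter.Eventually.of_forall fun z => by positivity)
            hi (Filter.Eventually.of_forall fun z => ?_)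
          refine rpow_le_of_le_add (by linarith) (norm_nonneg _) (norm_nonneg _) (hy0 z) hL'0
            (hC₁ _ (hy0 z)) ?_
          rw [hgrad]
          refine (norm_add_le _ _).trans (add_le_add ?_ ((hτy z).trans
            (mul_le_mul_of_nonneg_right hnL (hy0 z))))
          rw [norm_smul, Real.norm_of_nonneg (hκ0 z)]
          exact mul_le_of_le_one_left (norm_nonneg _) (hκ1 z)
      _ ≤ _ := by
          rw [he, one_mul]
          gcongr
  have e4 : c * (1 + ∫ z, ‖spaceGrad φ z‖ ^ p) ≤ C₂ * c * (1 + (∫ z in D, ‖spaceGrad w z‖ ^ p) +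
      ∫ z in D, y z ^ P) := by
    rw [mul_comm C₂, mul_assoc]
    refine mul_le_mul_of_nonneg_left ((add_le_add_right e3 1).trans ?_) hc
    exact add_le_mul_one_add_add (by positivity) (by positivity) hV0 hC₁0 hd0 hW0
  -- The terms in which a derivative falls on ψ. The left-hand side of the claim is the tested
  -- equation plus ∫J.
  set J : RVec n × ℝ → ℝ := fun z =>
    3 / 2 * χ z.2 * ψ z ^ 2 * timeDeriv ψ z * ‖w z - a‖ ^ 2 - inner ℝ (G z) (τ z) with hJ
  have hJle : ∀ z, J z ≤ L' * (C₃ * y z ^ P + e * (1 + 1 * ‖G z‖ ^ (p / (p - 1)))) := fun z => by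
    rw [one_mul, add_comm (C₃ * y z ^ P)]
    exact cutoff_terms_le (hχ0 _) (hχ1 _)
      ((le_abs_self _).trans ((norm_timeDeriv_le ψ z).trans (hL z))) hL0 n.cast_nonneg rfl
      (hy0 z) (norm_nonneg _) ((neg_le_abs _).trans (abs_real_inner_le_norm _ _)) (hτy z)
      (hC₃ ‖G z‖ (y z) (norm_nonneg _) (hy0 z))
  have hJ0 : ∀ z ∉ D, J z = 0 := by
    intro z hz
    have hz1 : z ∉ tsupport κ := fun h => hz (hκD h)
    have h1 : τ z = 0 := by
      have h2 := hφD z hz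
      rw [hgrad, image_eq_zero_of_notMem_tsupport (f := κ) hz1, zero_smul, zero_add] at h2
      exact h2
    have h2 : χ z.2 * ψ z ^ 3 = 0 := image_eq_zero_of_notMem_tsupport (f := κ) hz1
    have h3 : χ z.2 * ψ z ^ 2 = 0 := by
      rcases mul_eq_zero.1 h2 with h | h
      · rw [h, zero_mul]
      · rw [pow_eq_zero_iff three_ne_zero] at h
        rw [h]; ring
    simp only [hJ]
    rw [h1, inner_zero_right, mul_assoc (3 / 2 : ℝ), h3]
    ring
  have hpc : Continuous fun z : RVec n × ℝ => χ z.2 := hχ.continuous.comp continuous_snd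
  have hdpc : Continuous fun z : RVec n × ℝ => deriv χ z.2 :=
    (hχ.continuous_deriv le_rfl).comp continuous_snd
  have hτc : Continuous τ := by
    have : τ = fun z => spaceGrad φ z - κ z • spaceGrad w z := by
      ext1 z; rw [hgrad]; abel
    rw [this]
    exact hcφ.sub (hκc.continuous.smul hcw)
  have hJc : Continuous J := by
    have h1 := continuous_timeDeriv hψ
    have h2 := hψ.continuous
    have h3 := hwa.continuous
    exact ((((continuous_const.mul hpc).mul (h2.pow 2)).mul h1).mul (h3.norm.pow 2)).sub
      (hG.inner hτc)
  have hJint : ∫ z, J z ≤ L' * (C₃ * (∫ z in D, y z ^ P) +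
      e * (V + ∫ z in D, ‖G z‖ ^ (p / (p - 1)))) := by
    rw [← setIntegral_eq_integral_of_forall_compl_eq_zero (s := D) hJ0]
    obtain ⟨hi, he'⟩ := setIntegral_mul_add_mul hDt (iP.const_mul C₃) ig L' e 1 1
    calc _ ≤ ∫ z in D, L' * (C₃ * y z ^ P + e * (1 + 1 * ‖G z‖ ^ (p / (p - 1)))) :=
          integral_mono (hJc.integrableOn_parCylInt _ _ _ _) hi hJle
      _ ≤ _ := by
          rw [he', one_mul, one_mul, integral_const_mul]
          gcongr
  have hcs : ∀ {f : RVec n × ℝ → ℝ}, Continuous f → (∀ z, ψ z = 0 → f z = 0) → Integrable f :=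
    fun {f} hf h0 => hf.integrable_of_hasCompactSupport (HasCompactSupport.intro hψc fun z hz =>
      h0 z (image_eq_zero_of_notMem_tsupport hz))
  have hψ3 : ∀ z, ψ z = 0 → ψ z ^ 3 = 0 := fun z h => by rw [h]; ring
  have i1 : Integrable fun z : RVec n × ℝ => deriv χ z.2 * (ψ z ^ 3 * ‖w z - a‖ ^ 2) :=
    hcs (hdpc.mul ((hψ.continuous.pow 3).mul (hwa.continuous.norm.pow 2)))
      fun z h => by rw [hψ3 z h]; ring
  have i2 : Integrable fun z : RVec n × ℝ => χ z.2 * ψ z ^ 3 * inner ℝ (G z) (spaceGrad w z) :=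
    hcs ((hpc.mul (hψ.continuous.pow 3)).mul (hG.inner hcw)) fun z h => by rw [hψ3 z h]; ring
  have i3 : Integrable fun z => timeDeriv κ z * ‖w z - a‖ ^ 2 :=
    ((continuous_timeDeriv hκc).mul (hwa.continuous.norm.pow 2)).integrable_of_hasCompactSupport
      hκs.timeDeriv.mul_right
  have i4 : Integrable fun z => inner ℝ (G z) (spaceGrad φ z) :=
    (hG.inner hcφ).integrable_of_hasCompactSupport (HasCompactSupport.intro
      htest.compactSupport fun z hz => by
        rw [spaceGrad_eq_zero_of_notMem_tsupport hz, inner_zero_right])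
  have hid : -(1 / 2) * (∫ z : RVec n × ℝ, deriv χ z.2 * (ψ z ^ 3 * ‖w z - a‖ ^ 2)) +
        ∫ z : RVec n × ℝ, χ z.2 * ψ z ^ 3 * inner ℝ (G z) (spaceGrad w z)
      = (-(1 / 2 * ∫ z, timeDeriv κ z * ‖w z - a‖ ^ 2) +
        ∫ z, inner ℝ (G z) (spaceGrad φ z)) + ∫ z, J z := by
    have hJi : Integrable J := hcs hJc fun z hz => by
      have h1 : spaceDeriv κ = fun j z => 3 * χ z.2 * ψ z ^ 2 * spaceDeriv ψ j z := by
        ext j z; exact spaceDeriv_cutoff hψ hχ j z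
      have h2 : τ z = 0 := by
        ext ⟨i, j⟩
        simp [hτ, tensorGrad, h1, hz]
      simp only [hJ]
      rw [h2, hz, inner_zero_right]; ring
    have i5 : Integrable fun z => -(1 / 2) * (timeDeriv κ z * ‖w z - a‖ ^ 2) +
        inner ℝ (G z) (spaceGrad φ z) := (i3.const_mul _).add i4
    rw [← neg_mul, ← integral_const_mul, ← integral_const_mul,
      ← integral_add (i1.const_mul _) i2, ← integral_add (i3.const_mul _) i4,
      ← integral_add i5 hJi]
    congr 1
    ext z
    simp only [hJ]
    rw [timeDeriv_cutoff hψ hχ, hgrad, inner_add_right, inner_smul_right]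
    simp only [hκ]
    ring
  rw [hid]
  have hfin : L' * (e * (V + ∫ z in D, ‖G z‖ ^ (p / (p - 1)))) ≤ L' * (V + 1) * e *
      (1 + ∫ z in D, ‖G z‖ ^ (p / (p - 1))) := by
    rw [mul_assoc L' (V + 1), mul_assoc L']
    refine mul_le_mul_of_nonneg_left ?_ hL'0
    rw [mul_comm (V + 1) e, mul_assoc]
    refine mul_le_mul_of_nonneg_left ?_ he.le
    linarith [mul_nonneg hV0 hg0]
  have hC₂0 : 0 ≤ C₂ := by positivity
  have f1 : 0 ≤ C₂ * e * (1 + ∫ z in D, ‖G z‖ ^ (p / (p - 1))) := by positivity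
  have f2 : 0 ≤ L' * (V + 1) * c * (1 + (∫ z in D, ‖spaceGrad w z‖ ^ p) + ∫ z in D, y z ^ P) := by
    positivity
  linarith

end Energy

/-! ### Oscillation bounded by the gradient and the time slices. -/

theorem setLIntegral_parCylInt {n : ℕ} {f : RVec n × ℝ → ℝ≥0∞} (hf : Measurable f) (x : RVec n)
    (t R ρ : ℝ) :
    ∫⁻ z in parCylInt x t R ρ, f z
      = ∫⁻ s in Ioo (t - ρ) t, ∫⁻ y in Metric.ball x R, f (y, s) := by
  rw [parCylInt, Measure.volume_eq_prod, ← Measure.prod_restrict,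
    lintegral_prod_symm' _ hf]

/-- The oscillation `∫ |ψ(w - a)|^P` is controlled by the gradient and by the time slices. -/
theorem exists_lintegral_oscillation_le {m n : ℕ} (hn : 1 ≤ n) {q P Z : ℝ} (hq : 1 ≤ q)
    (hP : 2 ≤ P) (hqP : q < P) (hPq : P - q ≤ 1) (hnq : n * P / (n + 2) ≤ q)
    {ζ : RVec n → ℝ} (hζ : Continuous ζ) (hζB : tsupport ζ ⊆ Metric.ball 0 (3 / 2))
    (hζZ : ∀ x, ‖ζ x‖ ≤ Z) (hζ1 : ∫ x, ζ x = 1)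
    {ψ : RVec n × ℝ → ℝ} (hψ : Continuous ψ) (hψs : tsupport ψ ⊆ Metric.closedBall 0 (5 / 4))
    (hψ1 : ∀ z, ψ z ≤ 1) :
    ∃ C : ℝ≥0, ∀ β : ℝ, β ≤ 0 → ∀ w : RVec n × ℝ → RVec m, ContDiff ℝ 1 w →
      ∀ (a : RVec m) (S T : ℝ≥0),
      (∀ t ∈ Ioo (-2) β,
        ∫⁻ x, ‖w (x, t) - a‖ₑ ^ (2 : ℝ) * ENNReal.ofReal (ψ (x, t)) ^ (3 : ℝ) ≤ S) →
      (∀ t ∈ Ioo (-2) β, ‖(∫ x, ζ x • w (x, t)) - a‖ₑ ≤ T) →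
      ∫⁻ z in parCylInt 0 β (3 / 2) (β + 2), ‖w z - a‖ₑ ^ P * ENNReal.ofReal (ψ z) ^ P
        ≤ C * ((1 + S + T ^ (2 : ℝ)) *
          (∫⁻ z in parCylInt 0 β (3 / 2) (β + 2), ‖spaceGrad w z‖ₑ ^ q) + T ^ P) := by
  have hq0 : 0 < q := by linarith
  -- The inner radius 11/8 lies strictly between 5/4, where ψ stops, and the outer radius 3/2. On
  -- each slice w is compared with its own mean b, and the drift |b - a| ≤ T is paid for separately.
  obtain ⟨C₁, hC₁⟩ := exists_lintegral_enorm_sub_mean_mul_le (m := m) hn hq hP hqP hPq hnq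
    (by norm_num : (0 : ℝ) < 11 / 8) (by norm_num : (11 / 8 : ℝ) < 3 / 2) hζ hζB hζZ hζ1
  obtain ⟨v, hv⟩ : ∃ v : ℝ≥0, (v : ℝ≥0∞) = volume (Metric.ball (0 : RVec n) (3 / 2)) :=
    ⟨_, ENNReal.coe_toNNReal measure_ball_lt_top.ne⟩
  set C : ℝ≥0 := 2 ^ (P - 1) * (C₁ * (2 + 2 * v) * (n : ℝ≥0) ^ q + 2 * v) with hC
  refine ⟨C, fun β hβ w hw a S T hS hT => ?_⟩
  have hψ0 : ∀ x : RVec n, x ∉ Metric.ball (0 : RVec n) (11 / 8) → ∀ t, ψ (x, t) = 0 := by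
    intro x hx t
    refine image_eq_zero_of_notMem_tsupport fun h => hx ?_
    have := hψs h
    rw [mem_closedBall_zero_iff] at this
    rw [mem_ball_zero_iff]
    exact (norm_fst_le (x, t)).trans_lt (this.trans_lt (by norm_num))
  have hwc := hw.continuous
  have hslice : ∀ t ∈ Ioo (-2) β,
      ∫⁻ x in Metric.ball (0 : RVec n) (3 / 2),
        ‖w (x, t) - a‖ₑ ^ P * ENNReal.ofReal (ψ (x, t)) ^ P
      ≤ 2 ^ (P - 1) * (C₁ * (1 + (2 * S + 2 * T ^ (2 : ℝ) * v)) * ((n : ℝ≥0∞) ^ q *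
        ∫⁻ x in Metric.ball (0 : RVec n) (3 / 2), ‖spaceGrad w (x, t)‖ₑ ^ q) + T ^ P * v) := by
    intro t ht
    set b := ∫ x, ζ x • w (x, t) with hb
    have hwt : ContDiff ℝ 1 fun x => w (x, t) := hw.comp (by fun_prop)
    have hψt : Measurable fun x => ENNReal.ofReal (ψ (x, t)) :=
      (hψ.comp (by fun_prop : Continuous fun x : RVec n => (x, t))).measurable.ennreal_ofReal
    have hψt1 : ∀ x, ENNReal.ofReal (ψ (x, t)) ≤ 1 := fun x => ENNReal.ofReal_le_one.2 (hψ1 _)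
    have h1 := hC₁ _ hwt (fun x => ENNReal.ofReal (ψ (x, t))) hψt hψt1
      (fun x hx => by rw [hψ0 x hx, ENNReal.ofReal_zero])
    simp only [← hb] at h1
    have hψv : ∀ r : ℝ, 0 < r → ∀ x, ENNReal.ofReal (ψ (x, t)) ^ r
        ≤ (Metric.ball (0 : RVec n) (3 / 2)).indicator (fun _ => 1) x := by
      intro r hr x
      by_cases hx : x ∈ Metric.ball (0 : RVec n) (3 / 2)
      · rw [indicator_of_mem hx]
        exact ENNReal.rpow_le_one (hψt1 x) hr.le
      · rw [hψ0 x (fun h => hx (Metric.ball_subset_ball (by norm_num) h)), ENNReal.ofReal_zero,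
          ENNReal.zero_rpow_of_pos hr]
        exact zero_le
    have hψint : ∀ r : ℝ, 0 < r → ∫⁻ x, ENNReal.ofReal (ψ (x, t)) ^ r ≤ v := fun r hr => by
      refine (lintegral_mono (hψv r hr)).trans_eq ?_
      rw [lintegral_indicator measurableSet_ball, setLIntegral_one, hv]
    have hpow : ∀ r : ℝ, 1 ≤ r → ∀ x y y' : RVec m, ‖y - y'‖ₑ ≤ T →
        ‖x - y‖ₑ ^ r ≤ 2 ^ (r - 1) * (‖x - y'‖ₑ ^ r + T ^ r) := by
      intro r hr x y y' hy
      refine le_trans (ENNReal.rpow_le_rpow (z := r) ?_ (by linarith))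
        (ENNReal.rpow_add_le_mul_rpow_add_rpow _ _ hr)
      calc ‖x - y‖ₑ = ‖(x - y') - (y - y')‖ₑ := by rw [sub_sub_sub_cancel_right]
        _ ≤ ‖x - y'‖ₑ + ‖y - y'‖ₑ := enorm_sub_le
        _ ≤ _ := by gcongr
    have hba : ‖a - b‖ₑ ≤ T := by rw [enorm_sub_rev]; exact hT t ht
    have hm : ∀ (y : RVec m) (r : ℝ), Measurable fun x => ‖w (x, t) - y‖ₑ ^ r := fun y r =>
      (hwt.continuous.sub continuous_const).enorm.measurable.pow_const r
    have hψr : ∀ r : ℝ, Measurable fun x => ENNReal.ofReal (ψ (x, t)) ^ r := fun r =>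
      hψt.pow_const r
    have hm2 : ∀ (y : RVec m) (r r' : ℝ),
        Measurable fun x => ‖w (x, t) - y‖ₑ ^ r * ENNReal.ofReal (ψ (x, t)) ^ r' := fun y r r' =>
      (hm y r).mul (hψr r')
    have h2 : ∫⁻ x, ‖w (x, t) - b‖ₑ ^ (2 : ℝ) * ENNReal.ofReal (ψ (x, t)) ^ (3 : ℝ)
        ≤ 2 * S + 2 * T ^ (2 : ℝ) * v := by
      calc _ ≤ ∫⁻ x, 2 * (‖w (x, t) - a‖ₑ ^ (2 : ℝ) * ENNReal.ofReal (ψ (x, t)) ^ (3 : ℝ)) +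
            2 * T ^ (2 : ℝ) * ENNReal.ofReal (ψ (x, t)) ^ (3 : ℝ) := by
            refine lintegral_mono fun x => ?_
            have h3 := hpow 2 one_le_two (w (x, t)) b a (hT t ht)
            norm_num at h3
            calc _ ≤ 2 * (‖w (x, t) - a‖ₑ ^ (2 : ℝ) + T ^ (2 : ℝ)) *
                  ENNReal.ofReal (ψ (x, t)) ^ (3 : ℝ) := by
                  refine mul_le_mul_left ?_ _
                  simpa using h3
              _ = _ := by ring
        _ ≤ _ := by
            rw [lintegral_add_left ((hm2 a 2 3).const_mul 2), lintegral_const_mul _ (hm2 a 2 3),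
              lintegral_const_mul _ (hψr 3)]
            gcongr
            · exact hS t ht
            · exact hψint 3 three_pos
    calc _ ≤ ∫⁻ x, ‖w (x, t) - a‖ₑ ^ P * ENNReal.ofReal (ψ (x, t)) ^ P :=
          setLIntegral_le_lintegral _ _
      _ ≤ ∫⁻ x, 2 ^ (P - 1) * (‖w (x, t) - b‖ₑ ^ P * ENNReal.ofReal (ψ (x, t)) ^ P +
            T ^ P * ENNReal.ofReal (ψ (x, t)) ^ P) := by
          refine lintegral_mono fun x => ?_
          rw [← add_mul, ← mul_assoc]
          exact mul_le_mul_left (hpow P (by linarith) (w (x, t)) a b hba) _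
      _ = 2 ^ (P - 1) * ((∫⁻ x, ‖w (x, t) - b‖ₑ ^ P * ENNReal.ofReal (ψ (x, t)) ^ P) +
            T ^ P * ∫⁻ x, ENNReal.ofReal (ψ (x, t)) ^ P) := by
          have h3 : Measurable fun x => ‖w (x, t) - b‖ₑ ^ P * ENNReal.ofReal (ψ (x, t)) ^ P +
              T ^ P * ENNReal.ofReal (ψ (x, t)) ^ P := (hm2 b P P).add ((hψr P).const_mul _)
          rw [lintegral_const_mul _ h3, lintegral_add_left (hm2 b P P),
            lintegral_const_mul _ (hψr P)]
      _ ≤ _ := by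
          gcongr
          · refine h1.trans ?_
            gcongr
            · refine le_trans (ENNReal.rpow_le_rpow h2 (by linarith)) ?_
              -- The exponent (P - q)/2 is at most 1, so the power is bounded by 1 + y. This linear
              -- dependence on the slice bound is what makes W absorbable.
              generalize (2 * (S : ℝ≥0∞) + 2 * T ^ (2 : ℝ) * v) = y
              rcases le_total y 1 with h | h
              · exact (ENNReal.rpow_le_one h (by linarith)).trans le_self_add
              · refine (ENNReal.rpow_le_rpow_of_exponent_le h
                  (by linarith : (P - q) / 2 ≤ 1)).trans ?_
                rw [ENNReal.rpow_one]
                exact le_add_self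
            · rw [← lintegral_const_mul' _ _ (ENNReal.rpow_ne_top_of_nonneg hq0.le (by simp))]
              refine lintegral_mono fun x => ?_
              rw [← ENNReal.mul_rpow_of_nonneg _ _ hq0.le]
              refine ENNReal.rpow_le_rpow ?_ hq0.le
              rw [← ofReal_norm, ← ofReal_norm, ← ENNReal.ofReal_natCast,
                ← ENNReal.ofReal_mul n.cast_nonneg]
              exact ENNReal.ofReal_le_ofReal (norm_fderiv_slice_le hw x t)
          · exact hψint P (by linarith)
  have hmX : Measurable fun z => ‖spaceGrad w z‖ₑ ^ q :=
    (continuous_spaceGrad hw).enorm.measurable.pow_const q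
  have hmW : Measurable fun z => ‖w z - a‖ₑ ^ P * ENNReal.ofReal (ψ z) ^ P :=
    ((hwc.sub continuous_const).enorm.measurable.pow_const P).mul
      (hψ.measurable.ennreal_ofReal.pow_const P)
  rw [setLIntegral_parCylInt hmX, setLIntegral_parCylInt hmW, sub_add_cancel_left]
  have hmg : Measurable fun t => ∫⁻ x in Metric.ball (0 : RVec n) (3 / 2),
      ‖spaceGrad w (x, t)‖ₑ ^ q := hmX.lintegral_prod_left'
  have hvI : volume (Ioo (-2) β) ≤ 2 := by
    rw [Real.volume_Ioo]
    refine (ENNReal.ofReal_le_ofReal (by linarith : β - -2 ≤ 2)).trans_eq (by simp)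
  calc _ ≤ ∫⁻ t in Ioo (-2) β, 2 ^ (P - 1) * (C₁ * (1 + (2 * S + 2 * T ^ (2 : ℝ) * v)) *
        ((n : ℝ≥0∞) ^ q *
        ∫⁻ x in Metric.ball (0 : RVec n) (3 / 2), ‖spaceGrad w (x, t)‖ₑ ^ q) + T ^ P * v) :=
        setLIntegral_mono' measurableSet_Ioo hslice
    _ = 2 ^ (P - 1) * (C₁ * (1 + (2 * S + 2 * T ^ (2 : ℝ) * v)) * ((n : ℝ≥0∞) ^ q *
        ∫⁻ t in Ioo (-2) β, ∫⁻ x in Metric.ball (0 : RVec n) (3 / 2),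
          ‖spaceGrad w (x, t)‖ₑ ^ q) + T ^ P * v * volume (Ioo (-2) β)) := by
        rw [lintegral_const_mul _ (((hmg.const_mul _).const_mul _).add_const _),
          lintegral_add_left ((hmg.const_mul _).const_mul _), setLIntegral_const,
          lintegral_const_mul _ (hmg.const_mul _), lintegral_const_mul _ hmg]
    _ ≤ _ := by
        generalize (∫⁻ t in Ioo (-2) β, ∫⁻ x in Metric.ball (0 : RVec n) (3 / 2),
          ‖spaceGrad w (x, t)‖ₑ ^ q) = X
        have e2 : (2 : ℝ≥0∞) ^ (P - 1) = ((2 ^ (P - 1) : ℝ≥0) : ℝ≥0∞) := by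
          rw [ENNReal.coe_rpow_of_nonneg _ (by linarith)]; simp
        have en : (n : ℝ≥0∞) ^ q = (((n : ℝ≥0) ^ q : ℝ≥0) : ℝ≥0∞) := by
          rw [ENNReal.coe_rpow_of_nonneg _ hq0.le]; simp
        have hCe : (C : ℝ≥0∞) = 2 ^ (P - 1) * (C₁ * (2 + 2 * v) * (n : ℝ≥0∞) ^ q + 2 * v) := by
          rw [e2, en, hC]
          push_cast
          rfl
        rw [hCe, mul_assoc ((2 : ℝ≥0∞) ^ (P - 1))]
        refine mul_le_mul_right ?_ _
        calc _ ≤ C₁ * ((2 + 2 * v) * (1 + S + T ^ (2 : ℝ))) * ((n : ℝ≥0∞) ^ q * X) +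
              T ^ P * v * 2 := by
              gcongr
              have h1 : (1 : ℝ≥0∞) + (2 * S + 2 * T ^ (2 : ℝ) * v) ≤
                  1 + (2 * S + 2 * T ^ (2 : ℝ) * v) +
                  (1 + 2 * T ^ (2 : ℝ) + 2 * v * (1 + S)) := le_self_add
              refine h1.trans (le_of_eq ?_)
              ring
          _ = C₁ * (2 + 2 * v) * (n : ℝ≥0∞) ^ q * ((1 + S + T ^ (2 : ℝ)) * X) + 2 * v * T ^ P := by
              ring
          _ ≤ _ := by
              refine le_trans (le_self_add (b := C₁ * (2 + 2 * v) * (n : ℝ≥0∞) ^ q * T ^ P +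
                2 * v * ((1 + S + T ^ (2 : ℝ)) * X))) (le_of_eq ?_)
              ring

theorem Continuous.setLIntegral_enorm_rpow_parCylInt {n : ℕ} {F : Type*} [NormedAddCommGroup F]
    {f : RVec n × ℝ → F} (hf : Continuous f) {q : ℝ} (hq : 0 ≤ q) (x : RVec n) (t R ρ : ℝ) :
    ∫⁻ z in parCylInt x t R ρ, ‖f z‖ₑ ^ q
      = ENNReal.ofReal (∫ z in parCylInt x t R ρ, ‖f z‖ ^ q) := by
  rw [ofReal_integral_eq_lintegral_ofReal]
  · congr 1
    ext z
    rw [← ofReal_norm, ENNReal.ofReal_rpow_of_nonneg (norm_nonneg _) hq]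
  · exact (hf.norm.rpow_const fun _ => Or.inr hq).integrableOn_parCylInt _ _ _ _
  · exact Filter.Eventually.of_forall fun z => by positivity

/-! ### Smallness of the energy for smooth approximate solutions. -/

section SmoothDecay

variable {m n : ℕ} {ψ : RVec n × ℝ → ℝ}

theorem eq_zero_of_tsupport_subset_closedBall (hψs : tsupport ψ ⊆ Metric.closedBall 0 (5 / 4))
    {z : RVec n × ℝ} (hz : 5 / 4 < ‖z.1‖ ∨ 5 / 4 < |z.2|) : ψ z = 0 := by
  refine image_eq_zero_of_notMem_tsupport fun h => ?_
  have h1 := hψs h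
  rw [mem_closedBall_zero_iff] at h1
  have h2 : |z.2| ≤ ‖z‖ := norm_snd_le z
  rcases hz with hz | hz <;> linarith [norm_fst_le z]

theorem continuous_cutoff_energy (hψ : Continuous ψ)
    (hψs : tsupport ψ ⊆ Metric.closedBall 0 (5 / 4)) {w : RVec n × ℝ → RVec m} (hw : Continuous w)
    (a : RVec m) : Continuous fun t => ∫ x, ψ (x, t) ^ 3 * ‖w (x, t) - a‖ ^ 2 := by
  have h : ∀ t, ∫ x, ψ (x, t) ^ 3 * ‖w (x, t) - a‖ ^ 2
      = ∫ x in Metric.closedBall 0 (5 / 4), ψ (x, t) ^ 3 * ‖w (x, t) - a‖ ^ 2 := fun t => by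
    rw [setIntegral_eq_integral_of_forall_compl_eq_zero]
    intro x hx
    rw [mem_closedBall_zero_iff, not_le] at hx
    rw [eq_zero_of_tsupport_subset_closedBall (z := (x, t)) hψs (Or.inl hx)]
    ring
  simp_rw [h]
  have hc : Continuous fun z : RVec n × ℝ => ψ z ^ 3 * ‖w z - a‖ ^ 2 :=
    (hψ.pow 3).mul ((hw.sub continuous_const).norm.pow 2)
  exact continuous_parametric_integral_of_continuous (X := ℝ)
    (f := fun t x => ψ (x, t) ^ 3 * ‖w (x, t) - a‖ ^ 2) (hc.comp continuous_swap)
    (isCompact_closedBall 0 _)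

theorem integral_deriv_mul_cutoff_energy (hψ : Continuous ψ)
    (hψs : tsupport ψ ⊆ Metric.closedBall 0 (5 / 4)) {w : RVec n × ℝ → RVec m} (hw : Continuous w)
    (a : RVec m) {χ : ℝ → ℝ} (hχ : ContDiff ℝ 1 χ) :
    ∫ z : RVec n × ℝ, deriv χ z.2 * (ψ z ^ 3 * ‖w z - a‖ ^ 2)
      = ∫ t, deriv χ t * ∫ x, ψ (x, t) ^ 3 * ‖w (x, t) - a‖ ^ 2 := by
  have hψc : HasCompactSupport ψ :=
    (isCompact_closedBall _ _).of_isClosed_subset (isClosed_tsupport _) hψs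
  have hc : Continuous fun z : RVec n × ℝ => deriv χ z.2 * (ψ z ^ 3 * ‖w z - a‖ ^ 2) :=
    ((hχ.continuous_deriv le_rfl).comp continuous_snd).mul
      ((hψ.pow 3).mul ((hw.sub continuous_const).norm.pow 2))
  have hint := hc.integrable_of_hasCompactSupport (μ := (volume : Measure (RVec n × ℝ)))
    (HasCompactSupport.intro hψc fun z hz => by
      rw [image_eq_zero_of_notMem_tsupport hz]; ring)
  refine (integral_prod_symm (μ := (volume : Measure (RVec n))) (ν := (volume : Measure ℝ))
    _ hint).trans ?_
  congr 1
  ext t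
  rw [← integral_const_mul]

variable {p P : ℝ}

/-- Bound for the time slices of a smooth approximate solution. -/
theorem exists_cutoff_energy_le (hp : 1 < p) (hpP : p ≤ P) (hP : 2 ≤ P)
    (hψ : ContDiff ℝ 1 ψ) (hψs : tsupport ψ ⊆ Metric.closedBall 0 (5 / 4))
    (hψ0 : ∀ z, 0 ≤ ψ z) (hψ1 : ∀ z, ψ z ≤ 1) {K : ℝ} (hK : 0 ≤ K) :
    ∃ S : ℝ, 0 ≤ S ∧ ∀ c β : ℝ, 0 ≤ c → c ≤ 1 → β ≤ 0 → ∀ (w : RVec n × ℝ → RVec m)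
      (G : RVec n × ℝ → RGrad m n), ContDiff ℝ 1 w → Continuous G →
      IsApproxDivSol p c 0 β (3 / 2) (β + 2) w G →
      ∫ z in parCylInt 0 β (3 / 2) (β + 2), ‖spaceGrad w z‖ ^ p ≤ K →
      ∫ z in parCylInt 0 β (3 / 2) (β + 2), ‖G z‖ ^ (p / (p - 1)) ≤ K →
      ∀ a : RVec m, ∀ t ∈ Ioo (-2) β, ∫ x, ψ (x, t) ^ 3 * ‖w (x, t) - a‖ ^ 2
        ≤ S * (1 + ∫ z in parCylInt 0 β (3 / 2) (β + 2), (ψ z * ‖w z - a‖) ^ P) := by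
  obtain ⟨C₀, hC₀, hE⟩ := exists_energy_estimate (m := m) hp hpP hP hψ hψs hψ0 hψ1
  obtain ⟨C₁, hC₁, hE⟩ := hE 1 one_pos
  obtain ⟨C₂, hC₂, hY⟩ := exists_mul_le_mul_rpow_add hp one_pos
  refine ⟨2 * (2 * C₀ * (1 + K) + C₁ + C₀ + K + C₂ * K), by positivity, ?_⟩
  intro c β hc hc1 hβ w G hw hG hsol hwK hGK a t ht
  set D := parCylInt (0 : RVec n) β (3 / 2) (β + 2) with hD
  have hW0 : 0 ≤ ∫ z in D, (ψ z * ‖w z - a‖) ^ P :=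
    integral_nonneg fun z => Real.rpow_nonneg (mul_nonneg (hψ0 z) (norm_nonneg _)) _
  generalize hWd : (∫ z in D, (ψ z * ‖w z - a‖) ^ P) = W at hW0 ⊢
  -- The cutoff ψ has not yet started, so the slice energy is zero at time -3/2 and every slice is
  -- bounded by its increment from there.
  have hvan : ∀ s, s ≤ -(3 / 2) → ∫ x, ψ (x, s) ^ 3 * ‖w (x, s) - a‖ ^ 2 = 0 := by
    intro s hs
    refine integral_eq_zero_of_ae (Filter.Eventually.of_forall fun x => ?_)
    have : ψ (x, s) = 0 := eq_zero_of_tsupport_subset_closedBall hψs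
      (Or.inr (by rw [abs_of_nonpos (by linarith)]; simp only; linarith))
    simp [this]
  rcases le_total t (-(3 / 2)) with h | h
  · rw [hvan t h]; positivity
  have hmain : ∀ χ : ℝ → ℝ, ContDiff ℝ 1 χ → tsupport χ ⊆ Ioo (-2) β → (∀ t, 0 ≤ χ t) →
      (∀ t, χ t ≤ 1) → -∫ t, deriv χ t * (∫ x, ψ (x, t) ^ 3 * ‖w (x, t) - a‖ ^ 2)
        ≤ 2 * (2 * C₀ * (1 + K) + C₁ + C₀ + K + C₂ * K) * (1 + W) := by
    intro χ hχ hχs hχ0 hχ1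
    have h1 := hE c β hc hβ w G hw hG hsol a χ hχ hχs hχ0 hχ1
    rw [integral_deriv_mul_cutoff_energy hψ.continuous hψs hw.continuous a hχ, hWd] at h1
    have hcw := continuous_spaceGrad hw
    have hdp : Continuous fun z => ‖spaceGrad w z‖ ^ p :=
      hcw.norm.rpow_const fun _ => Or.inr (by linarith)
    have hgp : Continuous fun z => ‖G z‖ ^ (p / (p - 1)) :=
      hG.norm.rpow_const fun _ => Or.inr (div_nonneg (by linarith) (by linarith))
    have h2 : -(K + C₂ * K)
        ≤ ∫ z : RVec n × ℝ, χ z.2 * ψ z ^ 3 * inner ℝ (G z) (spaceGrad w z) := by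
      rw [← setIntegral_eq_integral_of_forall_compl_eq_zero (s := D) fun z hz => by
        rw [image_eq_zero_of_notMem_tsupport (f := fun z : RVec n × ℝ => χ z.2 * ψ z ^ 3)
          fun h => hz (tsupport_cutoff_subset hψs hχs h), zero_mul]]
      rw [neg_le]
      refine (neg_le_abs _).trans ?_
      rw [← Real.norm_eq_abs]
      calc _ ≤ ∫ z in D, (1 * ‖G z‖ ^ (p / (p - 1)) + C₂ * ‖spaceGrad w z‖ ^ p) := by
            refine norm_integral_le_of_norm_le
              (((hgp.integrableOn_parCylInt _ _ _ _).const_mul _).add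
              ((hdp.integrableOn_parCylInt _ _ _ _).const_mul _))
              (Filter.Eventually.of_forall fun z => ?_)
            refine le_trans ?_ (hY ‖G z‖ ‖spaceGrad w z‖ (norm_nonneg _) (norm_nonneg _))
            rw [norm_mul]
            refine (mul_le_of_le_one_left (norm_nonneg _) ?_).trans (norm_inner_le_norm _ _)
            rw [Real.norm_of_nonneg (mul_nonneg (hχ0 _) (pow_nonneg (hψ0 _) _))]
            exact mul_le_one₀ (hχ1 _) (pow_nonneg (hψ0 z) 3) (pow_le_one₀ (hψ0 z) (hψ1 z))
        _ ≤ _ := by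
            rw [integral_add ((hgp.integrableOn_parCylInt _ _ _ _).const_mul _)
              ((hdp.integrableOn_parCylInt _ _ _ _).const_mul _), integral_const_mul,
              integral_const_mul, one_mul]
            gcongr
    have h3 : C₀ * 1 * (1 + ∫ z in D, ‖G z‖ ^ (p / (p - 1))) ≤ C₀ * (1 + K) := by
      rw [mul_one]; gcongr
    have h4 : C₀ * c * (1 + (∫ z in D, ‖spaceGrad w z‖ ^ p) + W) ≤ C₀ * (1 + K + W) := by
      have h5 : 0 ≤ ∫ z in D, ‖spaceGrad w z‖ ^ p := integral_nonneg fun z => by positivity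
      rw [mul_assoc]
      refine mul_le_mul_of_nonneg_left ?_ hC₀
      exact (mul_le_of_le_one_left (by positivity) hc1).trans (by gcongr)
    have h6 : 0 ≤ C₀ * (1 + K) * W := by positivity
    have h7 : 0 ≤ (K + C₂ * K) * W := by positivity
    linarith
  have := sub_le_of_forall_neg_integral_deriv_mul_le
    (continuous_cutoff_energy hψ.continuous hψs hw.continuous a) hmain
    (by norm_num : (-2 : ℝ) < -(3 / 2)) h ht.2
  rwa [hvan _ le_rfl, sub_zero] at this

set_option maxHeartbeats 1000000 in
/-- For smooth approximate solutions with bounded energy, smallness of lower order norms makes the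
energy small. -/
theorem exists_smooth_energy_small (hn : 1 ≤ n) {q Z : ℝ} (hp : 1 < p) (hpP : p ≤ P) (hP : 2 ≤ P)
    (hq : 1 ≤ q) (hqP : q < P) (hPq : P - q ≤ 1) (hnq : n * P / (n + 2) ≤ q)
    {ζ : RVec n → ℝ} (hζ : ContDiff ℝ 1 ζ) (hζB : tsupport ζ ⊆ Metric.ball 0 (3 / 2))
    (hζZ : ∀ x, ‖ζ x‖ ≤ Z) (hζ1 : ∫ x, ζ x = 1)
    (hψ : ContDiff ℝ 1 ψ) (hψs : tsupport ψ ⊆ Metric.closedBall 0 (5 / 4))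
    (hψ0 : ∀ z, 0 ≤ ψ z) (hψ1 : ∀ z, ψ z ≤ 1) {K : ℝ} (hK : 0 ≤ K) {ε : ℝ} (hε : 0 < ε) :
    ∃ c : ℝ, 0 < c ∧ ∀ β : ℝ, -1 < β → β ≤ 0 → ∀ (w : RVec n × ℝ → RVec m)
      (G : RVec n × ℝ → RGrad m n), ContDiff ℝ 1 w → Continuous G →
      IsApproxDivSol p c 0 β (3 / 2) (β + 2) w G →
      ∫ z in parCylInt 0 β (3 / 2) (β + 2), ‖spaceGrad w z‖ ^ p ≤ K →
      ∫ z in parCylInt 0 β (3 / 2) (β + 2), ‖G z‖ ^ (p / (p - 1)) ≤ K →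
      ∫ z in parCylInt 0 β (3 / 2) (β + 2), ‖spaceGrad w z‖ ^ q ≤ c →
      ∫ z in parCylInt 0 β (3 / 2) (β + 2), ‖G z‖ ≤ c →
      ∀ χ : ℝ → ℝ, ContDiff ℝ 1 χ → tsupport χ ⊆ Ioo (-2) β → (∀ t, 0 ≤ χ t) → (∀ t, χ t ≤ 1) →
      (∀ t, -(5 / 4) ≤ t → deriv χ t ≤ 0) →
      ∫ z : RVec n × ℝ, χ z.2 * ψ z ^ 3 * inner ℝ (G z) (spaceGrad w z) ≤ ε := by
  have hq0 : 0 < q := by linarith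
  obtain ⟨C₀, hC₀, hE⟩ := exists_energy_estimate (m := m) hp hpP hP hψ hψs hψ0 hψ1
  obtain ⟨S, hS0, hS⟩ := exists_cutoff_energy_le (m := m) hp hpP hP hψ hψs hψ0 hψ1 hK
  obtain ⟨C₃, hC₃, hT⟩ := exists_norm_mean_sub_mean_le (m := m) hp hζ hζB
  obtain ⟨C₂, hW⟩ := exists_lintegral_oscillation_le (m := m) hn hq hP hqP hPq hnq hζ.continuous
    hζB hζZ hζ1 hψ.continuous hψs hψ1
  -- The flux term, which is only bounded and not small, then costs at most ε/2.
  obtain ⟨C₁, hC₁, hE⟩ := hE (ε / 2 / (C₀ * (1 + K) + 1)) (by positivity)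
  have hC₂0 : (0 : ℝ) ≤ C₂ := C₂.coe_nonneg
  set C₅ : ℝ := 1 + S + C₃ ^ (2 : ℝ) + C₃ ^ P with hC₅
  have hC₅0 : 0 < C₅ := by positivity
  set N : ℝ := (C₁ + C₀) * (2 * C₂ * C₅) + C₀ * (1 + K) with hN
  have hN0 : 0 ≤ N := by positivity
  -- The second entry allows W to be absorbed; the third makes all terms of order c at most ε/2.
  set c : ℝ := min 1 (min (1 / (2 * C₂ * S + 1)) (ε / 2 / (N + 1))) with hc
  have hc0 : 0 < c := by positivity
  have hc1 : c ≤ 1 := min_le_left _ _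
  have hc2 : c * (2 * C₂ * S + 1) ≤ 1 := by
    rw [← le_div_iff₀ (by positivity)]
    exact (min_le_right _ _).trans (min_le_left _ _)
  have hc3 : c * (N + 1) ≤ ε / 2 := by
    rw [← le_div_iff₀ (by positivity)]
    exact (min_le_right _ _).trans (min_le_right _ _)
  refine ⟨c, hc0, ?_⟩
  clear_value c
  intro β hβ1 hβ w G hw hG hsol hwK hGK hwq hGc χ hχ hχs hχ0 hχ1 hχd
  have ht₀ : (-(3 / 2) : ℝ) ∈ Ioo (-2) β := ⟨by norm_num, by linarith⟩
  -- Any fixed time would do as reference; the means at all other times differ from a by at most C₃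
  -- c.
  obtain ⟨a, ha⟩ : ∃ a : RVec m, a = ∫ x, ζ x • w (x, -(3 / 2)) := ⟨_, rfl⟩
  have hTa := hT c β hc0.le hβ w G hw.continuous hG hsol hGc
  have hSa := hS c β hc0.le hc1 hβ w G hw hG hsol hwK hGK a
  have hW0 : 0 ≤ ∫ z in parCylInt (0 : RVec n) β (3 / 2) (β + 2), (ψ z * ‖w z - a‖) ^ P :=
    integral_nonneg fun z => Real.rpow_nonneg (mul_nonneg (hψ0 z) (norm_nonneg _)) _
  have hψc := hψ.continuous
  have hwc := hw.continuous
  have hX0 : 0 ≤ ∫ z in parCylInt (0 : RVec n) β (3 / 2) (β + 2), ‖spaceGrad w z‖ ^ q :=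
    integral_nonneg fun z => by positivity
  have hWle := hW β hβ w hw a
    (Real.toNNReal (S * (1 + ∫ z in parCylInt 0 β (3 / 2) (β + 2), (ψ z * ‖w z - a‖) ^ P)))
    (Real.toNNReal (C₃ * c)) ?_ ?_
  rotate_left
  · intro t ht
    have hc' : Continuous fun z : RVec n × ℝ => ψ z ^ 3 * ‖w z - a‖ ^ 2 :=
      (hψc.pow 3).mul ((hwc.sub continuous_const).norm.pow 2)
    have hi : Integrable fun x => ψ (x, t) ^ 3 * ‖w (x, t) - a‖ ^ 2 := by
      refine (hc'.comp (Continuous.prodMk_left t)).integrable_of_hasCompactSupport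
        (HasCompactSupport.intro (isCompact_closedBall (0 : RVec n) (5 / 4)) fun x hx => ?_)
      rw [mem_closedBall_zero_iff, not_le] at hx
      simp only [Function.comp_apply]
      rw [eq_zero_of_tsupport_subset_closedBall (z := (x, t)) hψs (Or.inl hx)]
      ring
    calc _ = ∫⁻ x, ENNReal.ofReal (ψ (x, t) ^ 3 * ‖w (x, t) - a‖ ^ 2) := by
          congr 1
          ext x
          rw [ENNReal.ofReal_mul (pow_nonneg (hψ0 _) 3), mul_comm,
            ENNReal.ofReal_pow (hψ0 _), ENNReal.ofReal_pow (norm_nonneg _), ofReal_norm]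
          norm_cast
      _ = ENNReal.ofReal (∫ x, ψ (x, t) ^ 3 * ‖w (x, t) - a‖ ^ 2) :=
          (ofReal_integral_eq_lintegral_ofReal hi (Filter.Eventually.of_forall fun x =>
            mul_nonneg (pow_nonneg (hψ0 _) 3) (by positivity))).symm
      _ ≤ _ := ENNReal.ofReal_le_ofReal (hSa t ht)
  · intro t ht
    rw [← ofReal_norm]
    refine ENNReal.ofReal_le_ofReal ?_
    rw [ha]
    exact hTa t ht _ ht₀
  have hWe : ∫⁻ z in parCylInt (0 : RVec n) β (3 / 2) (β + 2),
      ‖w z - a‖ₑ ^ P * ENNReal.ofReal (ψ z) ^ P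
      = ENNReal.ofReal (∫ z in parCylInt 0 β (3 / 2) (β + 2), (ψ z * ‖w z - a‖) ^ P) := by
    have hc' : Continuous fun z => ψ z * ‖w z - a‖ :=
      hψc.mul (hwc.sub continuous_const).norm
    have := hc'.setLIntegral_enorm_rpow_parCylInt (by linarith : 0 ≤ P) 0 β (3 / 2) (β + 2)
    calc _ = ∫⁻ z in parCylInt (0 : RVec n) β (3 / 2) (β + 2), ‖ψ z * ‖w z - a‖‖ₑ ^ P := by
          congr 1
          ext z
          rw [enorm_mul, enorm_norm, ENNReal.mul_rpow_of_nonneg _ _ (by linarith),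
            Real.enorm_of_nonneg (hψ0 z), mul_comm]
      _ = _ := this
      _ = _ := by
          congr 2
          ext z
          rw [Real.norm_of_nonneg (mul_nonneg (hψ0 z) (norm_nonneg _))]
  rw [hWe, (continuous_spaceGrad hw).setLIntegral_enorm_rpow_parCylInt hq0.le] at hWle
  have hE' := hE c β hc0.le hβ w G hw hG hsol a χ hχ hχs hχ0 hχ1
  generalize (∫ z in parCylInt (0 : RVec n) β (3 / 2) (β + 2), (ψ z * ‖w z - a‖) ^ P) = W
    at hW0 hWle hE'
  generalize (∫ z in parCylInt (0 : RVec n) β (3 / 2) (β + 2), ‖spaceGrad w z‖ ^ q) = X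
    at hX0 hWle hwq
  have hSW : 0 ≤ S * (1 + W) := by positivity
  have hCc : 0 ≤ C₃ * c := by positivity
  have hWreal : W ≤ C₂ * ((1 + S * (1 + W) + (C₃ * c) ^ (2 : ℝ)) * X + (C₃ * c) ^ P) := by
    have e1 : (Real.toNNReal (S * (1 + W)) : ℝ≥0∞) = ENNReal.ofReal (S * (1 + W)) := rfl
    have e2 : (Real.toNNReal (C₃ * c) : ℝ≥0∞) = ENNReal.ofReal (C₃ * c) := rfl
    have e3 : (C₂ : ℝ≥0∞) = ENNReal.ofReal C₂ := (ENNReal.ofReal_coe_nnreal).symm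
    rw [e1, e2, e3, ENNReal.ofReal_rpow_of_nonneg hCc two_pos.le,
      ENNReal.ofReal_rpow_of_nonneg hCc (by linarith), ← ENNReal.ofReal_one,
      ← ENNReal.ofReal_add zero_le_one hSW, ← ENNReal.ofReal_add (by positivity) (by positivity),
      ← ENNReal.ofReal_mul (by positivity), ← ENNReal.ofReal_add (by positivity) (by positivity),
      ← ENNReal.ofReal_mul hC₂0] at hWle
    exact (ENNReal.ofReal_le_ofReal_iff (by positivity)).1 hWle
  have hpow2 : (C₃ * c) ^ (2 : ℝ) ≤ C₃ ^ (2 : ℝ) :=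
    Real.rpow_le_rpow hCc (mul_le_of_le_one_right hC₃ hc1) two_pos.le
  have hpowP : (C₃ * c) ^ P ≤ C₃ ^ P * c := by
    rw [Real.mul_rpow hC₃ hc0.le]
    refine mul_le_mul_of_nonneg_left ?_ (by positivity)
    calc c ^ P ≤ c ^ (1 : ℝ) := Real.rpow_le_rpow_of_exponent_ge hc0 hc1 (by linarith)
      _ = c := Real.rpow_one c
  -- W occurs on the right only as C₂ S X W with X ≤ c, which the choice of c makes at most W/2.
  have hWc : W ≤ 2 * C₂ * C₅ * c := by
    have h1 : W ≤ C₂ * ((1 + S * (1 + W) + C₃ ^ (2 : ℝ)) * c + C₃ ^ P * c) := by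
      refine hWreal.trans ?_
      gcongr
    have h2 : W * (c * (2 * C₂ * S + 1)) ≤ W * 1 := mul_le_mul_of_nonneg_left hc2 hW0
    have h3 : 0 ≤ W * c := by positivity
    rw [hC₅]
    linarith
  -- χ increases only at times where ψ = 0, so this term has the good sign and is dropped.
  have hdχ : 0 ≤ -(1 / 2) * ∫ z : RVec n × ℝ, deriv χ z.2 * (ψ z ^ 3 * ‖w z - a‖ ^ 2) := by
    refine mul_nonneg_of_nonpos_of_nonpos (by norm_num) (integral_nonpos fun z => ?_)
    by_cases hz : 5 / 4 < |z.2|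
    · simp only [eq_zero_of_tsupport_subset_closedBall hψs (Or.inr hz)]
      simp
    · refine mul_nonpos_of_nonpos_of_nonneg (hχd _ ?_)
        (mul_nonneg (pow_nonneg (hψ0 z) 3) (by positivity))
      exact (abs_le.1 (not_lt.1 hz)).1
  have hf1 : C₀ * (ε / 2 / (C₀ * (1 + K) + 1)) *
      (1 + ∫ z in parCylInt 0 β (3 / 2) (β + 2), ‖G z‖ ^ (p / (p - 1))) ≤ ε / 2 := by
    calc _ ≤ C₀ * (ε / 2 / (C₀ * (1 + K) + 1)) * (1 + K) := by gcongr
      _ = C₀ * (1 + K) * (ε / 2) / (C₀ * (1 + K) + 1) := by ring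
      _ ≤ ε / 2 := by
        rw [div_le_iff₀ (by positivity)]
        have : 0 ≤ C₀ * (1 + K) := by positivity
        linarith
  have hf2 : C₀ * c * (1 + (∫ z in parCylInt 0 β (3 / 2) (β + 2), ‖spaceGrad w z‖ ^ p) + W)
      ≤ C₀ * c * (1 + K) + C₀ * W := by
    have : C₀ * c * W ≤ C₀ * W := by
      rw [mul_assoc]
      exact mul_le_mul_of_nonneg_left (mul_le_of_le_one_left hW0 hc1) hC₀
    have : C₀ * c * (1 + ∫ z in parCylInt 0 β (3 / 2) (β + 2), ‖spaceGrad w z‖ ^ p)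
        ≤ C₀ * c * (1 + K) := by gcongr
    linarith
  have hf3 : (C₁ + C₀) * W ≤ (C₁ + C₀) * (2 * C₂ * C₅ * c) := by gcongr
  have hf4 : c * N ≤ ε / 2 := by linarith
  rw [hN] at hf4
  linarith

end SmoothDecay

/-! ### Mollification. -/

section Mollify

open scoped Convolution Pointwise

set_option linter.unusedSectionVars false

variable {G : Type*} [NormedAddCommGroup G] [NormedSpace ℝ G] [FiniteDimensional ℝ G]
  [MeasureSpace G] [BorelSpace G] [(volume : Measure G).IsAddHaarMeasure]
variable {F F' : Type*} [NormedAddCommGroup F] [NormedSpace ℝ F] [NormedAddCommGroup F']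
  [NormedSpace ℝ F']

/-- An even, nonnegative, `C¹` mollifier of mass one supported in the ball of radius `h`. -/
structure IsMollifier (ρ : G → ℝ) (h : ℝ) : Prop where
  contDiff : ContDiff ℝ 1 ρ
  nonneg : ∀ x, 0 ≤ ρ x
  integral_eq_one : ∫ x, ρ x = 1
  neg_eq : ∀ x, ρ (-x) = ρ x
  support_subset : Function.support ρ ⊆ Metric.ball 0 h

/-- The convolution of `f` with `ρ`. -/
def mollify (ρ : G → ℝ) (f : G → F) : G → F :=
  ρ ⋆[ContinuousLinearMap.lsmul ℝ ℝ, volume] f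

theorem ContDiffBump.isMollifier (φ : ContDiffBump (0 : G)) :
    IsMollifier (φ.normed volume) φ.rOut where
  contDiff := φ.contDiff_normed
  nonneg := φ.nonneg_normed
  integral_eq_one := φ.integral_normed
  neg_eq := φ.normed_neg
  support_subset := φ.support_normed_eq.subset

variable {ρ : G → ℝ} {h : ℝ}

theorem mollify_apply (f : G → F) (z : G) : mollify ρ f z = ∫ t, ρ t • f (z - t) := rfl

theorem mollify_eq_swap (f : G → F) (z : G) : mollify ρ f z = ∫ y, ρ (z - y) • f y :=
  convolution_lsmul_swap

theorem IsMollifier.hasCompactSupport (hρ : IsMollifier ρ h) : HasCompactSupport ρ :=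
  HasCompactSupport.of_support_subset_isCompact (isCompact_closedBall 0 h)
    (hρ.support_subset.trans Metric.ball_subset_closedBall)

theorem IsMollifier.contDiff_mollify (hρ : IsMollifier ρ h) {f : G → F}
    (hf : LocallyIntegrable f) : ContDiff ℝ 1 (mollify ρ f) :=
  hρ.hasCompactSupport.contDiff_convolution_left (n := 1) _ hρ.contDiff hf

theorem IsMollifier.convolutionExists (hρ : IsMollifier ρ h) {f : G → F}
    (hf : LocallyIntegrable f) :
    ConvolutionExists ρ f (ContinuousLinearMap.lsmul ℝ ℝ) volume :=
  hρ.hasCompactSupport.convolutionExists_left _ hρ.contDiff.continuous hf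

theorem IsMollifier.clm_mollify [CompleteSpace F] [CompleteSpace F'] (hρ : IsMollifier ρ h)
    {f : G → F} (hf : LocallyIntegrable f) (L : F →L[ℝ] F') (z : G) :
    L (mollify ρ f z) = mollify ρ (fun y => L (f y)) z := by
  have hi : Integrable fun t => ρ t • f (z - t) := hρ.convolutionExists hf z
  rw [mollify_apply, mollify_apply, ← L.integral_comp_comm hi]
  simp

/-- The derivative falls on the mollifier, so f need only be locally integrable. This form meets the
definition of the weak gradient, with ρ(z - ·) as test function. -/
theorem IsMollifier.fderiv_mollify_left (hρ : IsMollifier ρ h) {f : G → F}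
    (hf : LocallyIntegrable f) (z v : G) :
    fderiv ℝ (mollify ρ f) z v = ∫ y, fderiv ℝ ρ (z - y) v • f y := by
  have h1 : mollify ρ f = f ⋆[(ContinuousLinearMap.lsmul ℝ ℝ).flip, volume] ρ := by
    rw [mollify, convolution_flip]
  rw [h1, (hρ.hasCompactSupport.hasFDerivAt_convolution_right _ hf hρ.contDiff z).fderiv,
    convolution_precompR_apply _ hf (hρ.hasCompactSupport.fderiv ℝ)
      (hρ.contDiff.continuous_fderiv one_ne_zero)]
  rfl

theorem IsMollifier.fderiv_mollify_right (hρ : IsMollifier ρ h) {φ : G → F}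
    (hφ : ContDiff ℝ 1 φ) (hφc : HasCompactSupport φ) (z v : G) :
    fderiv ℝ (mollify ρ φ) z v = mollify ρ (fun y => fderiv ℝ φ y v) z := by
  rw [mollify, (hφc.hasFDerivAt_convolution_right _
    hρ.contDiff.continuous.locallyIntegrable hφ z).fderiv,
    convolution_precompR_apply _ hρ.contDiff.continuous.locallyIntegrable (hφc.fderiv ℝ)
      (hφ.continuous_fderiv one_ne_zero)]
  rfl

theorem support_mollify_subset (f : G → F) :
    Function.support (mollify ρ f) ⊆ Function.support ρ + Function.support f :=
  support_convolution_subset _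

theorem IsMollifier.mollify_sub (hρ : IsMollifier ρ h) {f g : G → F}
    (hf : LocallyIntegrable f) (hg : LocallyIntegrable g) :
    mollify ρ (f - g) = mollify ρ f - mollify ρ g := by
  ext z
  have i1 : Integrable fun t => ρ t • f (z - t) := hρ.convolutionExists hf z
  have i2 : Integrable fun t => ρ t • g (z - t) := hρ.convolutionExists hg z
  rw [Pi.sub_apply, mollify_apply, mollify_apply, mollify_apply, ← integral_sub i1 i2]
  simp [smul_sub]

theorem mollify_congr {f g : G → F} (hfg : f =ᵐ[volume] g) : mollify ρ f = mollify ρ g :=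
  convolution_congr _ Filter.EventuallyEq.rfl hfg

/-- Young's inequality for mollification. -/
theorem IsMollifier.lintegral_mollify_rpow_le (hρ : IsMollifier ρ h) {f : G → F}
    (hf : AEStronglyMeasurable f volume) {r : ℝ} (hr : 1 ≤ r) :
    ∫⁻ z, ‖mollify ρ f z‖ₑ ^ r ≤ ∫⁻ z, ‖f z‖ₑ ^ r := by
  -- A strongly measurable representative makes (z, t) ↦ f(z - t) jointly measurable, as needed for
  -- the interchange of integrals. After that the estimate is Jensen's inequality for the
  -- probability density ρ.
  wlog hsm : StronglyMeasurable f
  · have h1 := this hρ hf.stronglyMeasurable_mk.aestronglyMeasurable hr hf.stronglyMeasurable_mk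
    rw [← mollify_congr hf.ae_eq_mk] at h1
    refine h1.trans_eq (lintegral_congr_ae ?_)
    filter_upwards [hf.ae_eq_mk] with z hz
    rw [← hz]
  have hρm : Measurable fun t => ENNReal.ofReal (ρ t) :=
    hρ.contDiff.continuous.measurable.ennreal_ofReal
  have hmass : ∫⁻ t, ENNReal.ofReal (ρ t) = 1 := by
    rw [← ofReal_integral_eq_lintegral_ofReal (integrable_of_integral_eq_one hρ.integral_eq_one)
      (Filter.Eventually.of_forall hρ.nonneg), hρ.integral_eq_one, ENNReal.ofReal_one]
  set μ := (volume : Measure G).withDensity fun t => ENNReal.ofReal (ρ t) with hμ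
  have hμ1 : μ univ = 1 := by
    rw [hμ, withDensity_apply _ MeasurableSet.univ, Measure.restrict_univ, hmass]
  have hfm : Measurable fun z => ‖f z‖ₑ := hsm.enorm
  have hpt : ∀ z, ‖mollify ρ f z‖ₑ ^ r ≤ ∫⁻ t, ENNReal.ofReal (ρ t) * ‖f (z - t)‖ₑ ^ r := by
    intro z
    have hfz : Measurable fun t => ‖f (z - t)‖ₑ := hfm.comp (measurable_const.sub measurable_id)
    have h1 : ‖mollify ρ f z‖ₑ ≤ ∫⁻ t, ‖f (z - t)‖ₑ ∂μ := by
      rw [hμ, lintegral_withDensity_eq_lintegral_mul _ hρm hfz, mollify_apply]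
      refine (enorm_integral_le_lintegral_enorm _).trans (lintegral_mono fun t => ?_)
      rw [enorm_smul, Real.enorm_of_nonneg (hρ.nonneg t), Pi.mul_apply]
    refine (ENNReal.rpow_le_rpow h1 (by linarith)).trans
      ((rpow_lintegral_le μ hfz.aemeasurable hr).trans_eq ?_)
    rw [hμ1, ENNReal.one_rpow, one_mul, hμ,
      lintegral_withDensity_eq_lintegral_mul _ hρm (hfz.pow_const r)]
    rfl
  have hm2 : Measurable fun p : G × G => ENNReal.ofReal (ρ p.2) * ‖f (p.1 - p.2)‖ₑ ^ r :=
    (hρm.comp measurable_snd).mul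
      ((hfm.comp (measurable_fst.sub measurable_snd)).pow_const r)
  calc _ ≤ ∫⁻ z, ∫⁻ t, ENNReal.ofReal (ρ t) * ‖f (z - t)‖ₑ ^ r := lintegral_mono hpt
    _ = ∫⁻ t, ∫⁻ z, ENNReal.ofReal (ρ t) * ‖f (z - t)‖ₑ ^ r :=
        lintegral_lintegral_swap (f := fun z t => ENNReal.ofReal (ρ t) * ‖f (z - t)‖ₑ ^ r)
          hm2.aemeasurable
    _ = ∫⁻ t, ENNReal.ofReal (ρ t) * ∫⁻ z, ‖f z‖ₑ ^ r := by
        congr 1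
        ext t
        rw [lintegral_const_mul' _ _ ENNReal.ofReal_ne_top,
          lintegral_sub_right_eq_self (fun z => ‖f z‖ₑ ^ r) t]
    _ = _ := by rw [lintegral_mul_const _ hρm, hmass, one_mul]

theorem IsMollifier.eLpNorm_mollify_le (hρ : IsMollifier ρ h) {f : G → F}
    (hf : AEStronglyMeasurable f volume) {r : ℝ} (hr : 1 ≤ r) :
    eLpNorm (mollify ρ f) (ENNReal.ofReal r) volume ≤ eLpNorm f (ENNReal.ofReal r) volume := by
  have hr0 : 0 < r := by linarith
  have h0 : ENNReal.ofReal r ≠ 0 := by simpa using hr0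
  rw [eLpNorm_eq_lintegral_rpow_enorm_toReal h0 ENNReal.ofReal_ne_top,
    eLpNorm_eq_lintegral_rpow_enorm_toReal h0 ENNReal.ofReal_ne_top, ENNReal.toReal_ofReal hr0.le]
  exact ENNReal.rpow_le_rpow (hρ.lintegral_mollify_rpow_le hf hr) (by positivity)

/-- Mollification is self-adjoint. -/
theorem IsMollifier.integral_inner_mollify {F : Type*} [NormedAddCommGroup F]
    [InnerProductSpace ℝ F] [CompleteSpace F] (hρ : IsMollifier ρ h) {f g : G → F}
    (hf : Integrable f) (hg : Continuous g) (hgc : HasCompactSupport g) :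
    ∫ z, inner ℝ (mollify ρ f z) (g z) = ∫ y, inner ℝ (f y) (mollify ρ g y) := by
  have hgi : Integrable g := hg.integrable_of_hasCompactSupport hgc
  obtain ⟨B, hB⟩ : ∃ B, ∀ x, ‖ρ x‖ ≤ B :=
    hρ.contDiff.continuous.bounded_above_of_compact_support hρ.hasCompactSupport
  have hint : Integrable (fun p : G × G => ρ (p.1 - p.2) * inner ℝ (f p.2) (g p.1))
      (volume.prod volume) := by
    have h1 : Integrable (fun p : G × G => ‖g p.1‖ * ‖f p.2‖) (volume.prod volume) :=
      hgi.norm.mul_prod hf.norm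
    refine (h1.const_mul B).mono' ?_ (Filter.Eventually.of_forall fun p => ?_)
    · exact (hρ.contDiff.continuous.comp (continuous_fst.sub continuous_snd)).aestronglyMeasurable.mul
        (hf.aestronglyMeasurable.comp_snd.inner hgi.aestronglyMeasurable.comp_fst)
    · rw [norm_mul]
      have h2 : ‖inner ℝ (f p.2) (g p.1)‖ ≤ ‖g p.1‖ * ‖f p.2‖ :=
        (norm_inner_le_norm _ _).trans_eq (mul_comm _ _)
      exact mul_le_mul (hB _) h2 (norm_nonneg _) ((norm_nonneg _).trans (hB 0))
  have e1 : ∀ z, inner ℝ (mollify ρ f z) (g z) = ∫ y, ρ (z - y) * inner ℝ (f y) (g z) := by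
    intro z
    have hi : Integrable fun y => ρ (z - y) • f y :=
      (hρ.convolutionExists hf.locallyIntegrable z).integrable_swap
    rw [mollify_eq_swap, real_inner_comm, ← integral_inner hi]
    congr 1
    ext y
    rw [inner_smul_right, real_inner_comm]
  have e2 : ∀ y, inner ℝ (f y) (mollify ρ g y) = ∫ z, ρ (z - y) * inner ℝ (f y) (g z) := by
    intro y
    have hi : Integrable fun z => ρ (y - z) • g z :=
      (hρ.convolutionExists hgi.locallyIntegrable y).integrable_swap
    rw [mollify_eq_swap, ← integral_inner hi]
    congr 1
    ext z
    rw [inner_smul_right, ← hρ.neg_eq, neg_sub]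
  simp_rw [e1, e2]
  exact integral_integral_swap hint

/-- Approximate f in L^r by a continuous g of compact support. Mollification contracts L^r and
converges uniformly on g, with supports in a fixed ball; each of the three errors is at most ε/3. -/
theorem tendsto_eLpNorm_mollify_sub [CompleteSpace F] {ρ : ℕ → G → ℝ} {h : ℕ → ℝ}
    (hρ : ∀ k, IsMollifier (ρ k) (h k)) (hh : Filter.Tendsto h Filter.atTop (nhds 0))
    {r : ℝ} (hr : 1 ≤ r) {f : G → F} (hf : MemLp f (ENNReal.ofReal r) volume) :
    Filter.Tendsto (fun k => eLpNorm (mollify (ρ k) f - f) (ENNReal.ofReal r) volume)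
      Filter.atTop (nhds 0) := by
  have hr1 : (1 : ℝ≥0∞) ≤ ENNReal.ofReal r := ENNReal.one_le_ofReal.2 hr
  rw [ENNReal.tendsto_nhds_zero]
  intro ε hε
  have hε3 : ε / 3 ≠ 0 := (ENNReal.div_pos hε.ne' (by simp)).ne'
  obtain ⟨g, hgc, hfg, hg, hgLp⟩ := hf.exists_hasCompactSupport_eLpNorm_sub_le
    ENNReal.ofReal_ne_top hε3
  obtain ⟨R, hR⟩ := hgc.isCompact.isBounded.subset_closedBall (0 : G)
  set B := Metric.closedBall (0 : G) (R + 1) with hB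
  have hVt : (volume B) ^ (ENNReal.ofReal r).toReal⁻¹ ≠ ⊤ :=
    ENNReal.rpow_ne_top_of_nonneg (by positivity) measure_closedBall_lt_top.ne
  obtain ⟨η, hη, hηV⟩ := ENNReal.exists_nnreal_pos_mul_lt hVt hε3
  have huc := hg.uniformContinuous_of_tendsto_cocompact
    (by simpa using! hgc.is_zero_at_infty)
  obtain ⟨d, hd, hdg⟩ := Metric.uniformContinuous_iff.1 huc η hη
  filter_upwards [hh.eventually (gt_mem_nhds (lt_min hd one_pos))] with k hk
  have hbd : ∀ z, ‖(mollify (ρ k) g - g) z‖ ≤ η := by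
    intro z
    rw [Pi.sub_apply, ← dist_eq_norm]
    refine dist_convolution_le η.coe_nonneg (hρ k).support_subset (hρ k).nonneg
      (hρ k).integral_eq_one hg.aestronglyMeasurable fun x hx => ?_
    rw [Metric.mem_ball] at hx
    exact (hdg (hx.trans (hk.trans_le (min_le_left _ _)))).le
  have hgsupp : Function.support g ⊆ Metric.closedBall 0 R := (subset_tsupport g).trans hR
  have hsupp : Function.support (mollify (ρ k) g - g) ⊆ B := by
    refine (Function.support_sub _ _).trans (union_subset ?_ ?_)
    · intro z hz
      obtain ⟨a, ha, b, hb, rfl⟩ := support_mollify_subset g hz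
      have h1 := (hρ k).support_subset ha
      have h2 := hgsupp hb
      rw [mem_ball_zero_iff] at h1
      rw [mem_closedBall_zero_iff] at h2 ⊢
      have h3 : h k < 1 := hk.trans_le (min_le_right _ _)
      exact (norm_add_le a b).trans (by linarith)
    · exact hgsupp.trans (Metric.closedBall_subset_closedBall (by linarith))
  have h2 : eLpNorm (mollify (ρ k) g - g) (ENNReal.ofReal r) volume ≤ ε / 3 := by
    rw [← eLpNorm_restrict_eq_of_support_subset hsupp]
    refine (eLpNorm_le_of_ae_bound (Filter.Eventually.of_forall hbd)).trans ?_
    rw [Measure.restrict_apply_univ, mul_comm]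
    simpa using hηV.le
  have hfl : LocallyIntegrable f := hf.locallyIntegrable hr1
  have hgl : LocallyIntegrable g := hgLp.locallyIntegrable hr1
  have hms : AEStronglyMeasurable (mollify (ρ k) (f - g)) volume :=
    ((hρ k).contDiff_mollify (hfl.sub hgl)).continuous.aestronglyMeasurable
  have hmg : AEStronglyMeasurable (mollify (ρ k) g - g) volume :=
    (((hρ k).contDiff_mollify hgl).continuous.sub hg).aestronglyMeasurable
  have hdecomp : mollify (ρ k) f - f
      = mollify (ρ k) (f - g) + ((mollify (ρ k) g - g) - (f - g)) := by
    rw [(hρ k).mollify_sub hfl hgl]; abel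
  rw [hdecomp]
  calc _ ≤ eLpNorm (mollify (ρ k) (f - g)) (ENNReal.ofReal r) volume +
        eLpNorm ((mollify (ρ k) g - g) - (f - g)) (ENNReal.ofReal r) volume :=
        eLpNorm_add_le hms (hmg.sub (hf.sub hgLp).aestronglyMeasurable) hr1
    _ ≤ ε / 3 + (ε / 3 + ε / 3) := by
        refine add_le_add (((hρ k).eLpNorm_mollify_le (hf.sub hgLp).aestronglyMeasurable hr).trans
          hfg) ?_
        exact (eLpNorm_sub_le hmg (hf.sub hgLp).aestronglyMeasurable hr1).trans
          (add_le_add h2 hfg)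
    _ = ε := by rw [← add_assoc]; exact ENNReal.add_thirds ε

end Mollify

/-! ### Mollifying an approximate weak solution. -/

theorem integral_norm_rpow_eq_toReal {α F : Type*} [MeasurableSpace α] {μ : Measure α}
    [NormedAddCommGroup F] {f : α → F} (hf : AEStronglyMeasurable f μ) {r : ℝ} (hr : 0 ≤ r) :
    ∫ z, ‖f z‖ ^ r ∂μ = (∫⁻ z, ‖f z‖ₑ ^ r ∂μ).toReal := by
  rw [integral_eq_lintegral_of_nonneg_ae (Filter.Eventually.of_forall fun z => by positivity)
    (hf.norm.aemeasurable.pow_const r).aestronglyMeasurable]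
  congr 2
  ext z
  rw [← ofReal_norm, ENNReal.ofReal_rpow_of_nonneg (norm_nonneg _) hr]

theorem EllipticE.norm_le {m n : ℕ} {p lam Lam : ℝ} {A : RVec m → RGrad m n → RGrad m n}
    (hA : EllipticE p lam Lam A) (hLam : 0 ≤ Lam) (w : RVec m) (ζ : RGrad m n) :
    ‖A w ζ‖ ≤ Lam * ‖ζ‖ ^ (p - 1) := by
  have h := hA.upper w ζ (A w ζ)
  rw [real_inner_self_eq_norm_sq, abs_of_nonneg (by positivity), sq] at h
  rcases (norm_nonneg (A w ζ)).eq_or_lt with h0 | h0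
  · rw [← h0]
    positivity
  · exact le_of_mul_le_mul_right h h0

/-- The uniform L² bound on slices gives L² on the cylinder, hence L¹, as the cylinder has finite
measure. -/
theorem MemVp.integrableOn {m n : ℕ} {p : ℝ} {x₀ : RVec n} {t₀ R ρ : ℝ}
    {u : RVec n × ℝ → RVec m} {Du : RVec n × ℝ → RGrad m n} (hu : MemVp p x₀ t₀ R ρ u Du) :
    IntegrableOn u (parCyl x₀ t₀ R ρ) := by
  refine ⟨hu.aestronglyMeasurable, ?_⟩
  obtain ⟨K, hK⟩ := hu.sup_sq
  have hm : AEMeasurable (fun z => ‖u z‖ₑ ^ 2) (volume.restrict (parCyl x₀ t₀ R ρ)) :=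
    hu.aestronglyMeasurable.enorm.pow_const 2
  have hv : (volume : Measure (RVec n × ℝ)).restrict (parCyl x₀ t₀ R ρ)
      = (volume.restrict (Metric.ball x₀ R)).prod (volume.restrict (Icc (t₀ - ρ) t₀)) := by
    rw [parCyl, Measure.volume_eq_prod, Measure.prod_restrict]
  have h2 : ∫⁻ z in parCyl x₀ t₀ R ρ, ‖u z‖ₑ ^ 2 ≤ K * volume (Icc (t₀ - ρ) t₀) := by
    rw [hv] at hm ⊢
    rw [lintegral_prod_symm _ hm]
    calc _ ≤ ∫⁻ _ in Icc (t₀ - ρ) t₀, (K : ℝ≥0∞) := lintegral_mono_ae hK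
      _ = _ := setLIntegral_const _ _
  calc ∫⁻ z in parCyl x₀ t₀ R ρ, ‖u z‖ₑ ≤ ∫⁻ z in parCyl x₀ t₀ R ρ, (1 + ‖u z‖ₑ ^ 2) := by
        refine lintegral_mono fun z => ?_
        rcases le_total ‖u z‖ₑ 1 with h | h
        · exact h.trans le_self_add
        · refine le_trans ?_ le_add_self
          rw [sq]
          exact le_mul_of_one_le_left' h
    _ = volume (parCyl x₀ t₀ R ρ) + ∫⁻ z in parCyl x₀ t₀ R ρ, ‖u z‖ₑ ^ 2 := by
        rw [lintegral_add_left measurable_const, setLIntegral_one]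
    _ < ⊤ := ENNReal.add_lt_top.2 ⟨(volume_parCyl_ne_top _ _ _ _).lt_top,
        h2.trans_lt (ENNReal.mul_lt_top ENNReal.coe_lt_top measure_Icc_lt_top)⟩


theorem fderiv_comp_const_sub {E F : Type*} [NormedAddCommGroup E] [NormedSpace ℝ E]
    [NormedAddCommGroup F] [NormedSpace ℝ F] {ρ : E → F} (hρ : Differentiable ℝ ρ) (z y v : E) :
    fderiv ℝ (fun y => ρ (z - y)) y v = -fderiv ℝ ρ (z - y) v := by
  have h : HasFDerivAt (fun y => ρ (z - y)) _ y :=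
    (hρ (z - y)).hasFDerivAt.comp y ((hasFDerivAt_id y).const_sub z)
  rw [h.fderiv]
  simp

section Mollified

open scoped Pointwise

variable {m n : ℕ} {p : ℝ} {u : RVec n × ℝ → RVec m} {Du : RVec n × ℝ → RGrad m n}
  {ρ : RVec n × ℝ → ℝ} {h : ℝ}

/-- The mollifier also looks forward in time by h, so the final time of the smaller cylinder is
lowered to -h. This is why the estimates for smooth solutions carry a free top time β. -/
theorem closedBall_subset_parCylInt_of_mem (h0 : 0 < h) (h4 : h ≤ 1 / 4) {z : RVec n × ℝ}
    (hz : z ∈ parCylInt 0 (-h) (3 / 2) (-h + 2)) {y : RVec n × ℝ} (hy : ‖y‖ ≤ h) :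
    z + y ∈ parCylInt 0 0 2 4 := by
  rw [mem_parCylInt, dist_zero_right] at hz ⊢
  have h1 := (norm_fst_le y).trans hy
  have h2 : |y.2| ≤ h := (norm_snd_le y).trans hy
  rw [abs_le] at h2
  refine ⟨?_, ?_, ?_⟩
  · exact (norm_add_le z.1 y.1).trans_lt (by linarith [hz.1])
  · simp only [Prod.snd_add]
    linarith [hz.2.1]
  · simp only [Prod.snd_add]
    linarith [hz.2.2]

theorem isTestFun_const_sub (hρ : IsMollifier ρ h) (h0 : 0 < h) (h4 : h ≤ 1 / 4)
    {z : RVec n × ℝ} (hz : z ∈ parCylInt 0 (-h) (3 / 2) (-h + 2)) :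
    IsTestFun 0 0 2 4 fun y => ρ (z - y) := by
  have hts : tsupport (fun y => ρ (z - y)) ⊆ Metric.closedBall z h := by
    refine closure_minimal (fun y hy => ?_) Metric.isClosed_closedBall
    have := hρ.support_subset (show z - y ∈ Function.support ρ from hy)
    rw [mem_ball_zero_iff] at this
    rw [Metric.mem_closedBall, dist_comm, dist_eq_norm]
    exact this.le
  refine ⟨hρ.contDiff.comp (contDiff_const.sub contDiff_id), ?_, fun y hy => ?_⟩
  · exact (isCompact_closedBall z h).of_isClosed_subset (isClosed_tsupport _) hts
  · have h1 := hts hy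
    rw [Metric.mem_closedBall, dist_eq_norm] at h1
    have := closedBall_subset_parCylInt_of_mem h0 h4 hz h1
    rwa [add_sub_cancel] at this

/-- The gradient of the mollification is the mollification of the weak gradient. -/
theorem MemVp.spaceGrad_mollify (hp : 1 < p) (hu : MemVp p 0 0 2 4 u Du)
    (hρ : IsMollifier ρ h) (h0 : 0 < h) (h4 : h ≤ 1 / 4)
    {z : RVec n × ℝ} (hz : z ∈ parCylInt 0 (-h) (3 / 2) (-h + 2)) :
    spaceGrad (mollify ρ ((parCyl 0 0 2 4).indicator u)) z
      = mollify ρ ((parCyl 0 0 2 4).indicator Du) z := by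
  have hQ : MeasurableSet (parCyl (0 : RVec n) 0 2 4) := measurableSet_parCyl _ _ _ _
  have hUi : Integrable ((parCyl 0 0 2 4).indicator u) :=
    (integrable_indicator_iff hQ).2 hu.integrableOn
  have : IsFiniteMeasure (volume.restrict (parCyl (0 : RVec n) 0 2 4)) :=
    ⟨by simpa using (volume_parCyl_ne_top (0 : RVec n) 0 2 4).lt_top⟩
  have hDi : Integrable ((parCyl 0 0 2 4).indicator Du) :=
    (integrable_indicator_iff hQ).2 (hu.memLp_grad.integrable (ENNReal.one_le_ofReal.2 hp.le))
  have htest := isTestFun_const_sub hρ h0 h4 hz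
  have hρd : Differentiable ℝ ρ := hρ.contDiff.differentiable one_ne_zero
  ext ⟨i, j⟩
  have hw := hu.weak_grad _ htest i j
  have e1 : ∀ y, spaceDeriv (fun y => ρ (z - y)) j y
      = -fderiv ℝ ρ (z - y) (EuclideanSpace.single j 1, 0) := fun y =>
    fderiv_comp_const_sub hρd z y _
  simp_rw [e1, mul_neg] at hw
  rw [integral_neg, neg_inj] at hw
  have hd : Continuous fun y => fderiv ℝ ρ (z - y) (EuclideanSpace.single j 1, 0) :=
    ((hρ.contDiff.continuous_fderiv one_ne_zero).comp
      (continuous_const.sub continuous_id)).clm_apply continuous_const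
  have hdc : HasCompactSupport fun y => fderiv ℝ ρ (z - y) (EuclideanSpace.single j 1, 0) := by
    have : (fun y => fderiv ℝ ρ (z - y) (EuclideanSpace.single j 1, 0))
        = -fun y => fderiv ℝ (fun y => ρ (z - y)) y (EuclideanSpace.single j 1, 0) := by
      ext1 y
      simp [fderiv_comp_const_sub hρd]
    rw [this]
    exact (htest.compactSupport.fderiv_apply ℝ _).neg
  have hdi : Integrable fun y => fderiv ℝ ρ (z - y) (EuclideanSpace.single j 1, 0) •
      (parCyl 0 0 2 4).indicator u y := by
    obtain ⟨B, hB⟩ := hd.bounded_above_of_compact_support hdc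
    exact hUi.bdd_smul B hd.aestronglyMeasurable (Filter.Eventually.of_forall hB)
  have hri : Integrable fun y => ρ (z - y) • (parCyl 0 0 2 4).indicator Du y :=
    (hρ.convolutionExists hDi.locallyIntegrable z).integrable_swap
  calc spaceGrad (mollify ρ ((parCyl 0 0 2 4).indicator u)) z (i, j)
      = (EuclideanSpace.proj i : RVec m →L[ℝ] ℝ)
        (∫ y, fderiv ℝ ρ (z - y) (EuclideanSpace.single j 1, 0) •
          (parCyl 0 0 2 4).indicator u y) := by
        rw [← hρ.fderiv_mollify_left hUi.locallyIntegrable]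
        rfl
    _ = ∫ y in parCyl 0 0 2 4, u y i * fderiv ℝ ρ (z - y) (EuclideanSpace.single j 1, 0) := by
        rw [← ContinuousLinearMap.integral_comp_comm _ hdi, ← integral_indicator hQ]
        congr 1
        ext1 y
        by_cases hy : y ∈ parCyl (0 : RVec n) 0 2 4 <;> simp [hy, mul_comm]
    _ = ∫ y in parCyl 0 0 2 4, Du y (i, j) * ρ (z - y) := hw
    _ = (EuclideanSpace.proj (i, j) : RGrad m n →L[ℝ] ℝ)
        (∫ y, ρ (z - y) • (parCyl 0 0 2 4).indicator Du y) := by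
        rw [← ContinuousLinearMap.integral_comp_comm _ hri, ← integral_indicator hQ]
        congr 1
        ext1 y
        by_cases hy : y ∈ parCyl (0 : RVec n) 0 2 4 <;> simp [hy, mul_comm]
    _ = _ := by rw [← mollify_eq_swap]; rfl

theorem IsMollifier.timeDeriv_mollify (hρ : IsMollifier ρ h) {φ : RVec n × ℝ → RVec m}
    (hφ : ContDiff ℝ 1 φ) (hφc : HasCompactSupport φ) :
    timeDeriv (mollify ρ φ) = mollify ρ (timeDeriv φ) := by
  ext1 z
  exact hρ.fderiv_mollify_right hφ hφc z _

theorem IsMollifier.spaceGrad_mollify (hρ : IsMollifier ρ h) {φ : RVec n × ℝ → RVec m}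
    (hφ : ContDiff ℝ 1 φ) (hφc : HasCompactSupport φ) :
    spaceGrad (mollify ρ φ) = mollify ρ (spaceGrad φ) := by
  ext1 z
  ext ⟨i, j⟩
  have h1 : LocallyIntegrable (spaceDeriv φ j) := (continuous_spaceDeriv hφ j).locallyIntegrable
  have h2 : LocallyIntegrable (spaceGrad φ) := (continuous_spaceGrad hφ).locallyIntegrable
  calc spaceGrad (mollify ρ φ) z (i, j)
      = (EuclideanSpace.proj i : RVec m →L[ℝ] ℝ) (mollify ρ (spaceDeriv φ j) z) := by
        rw [show spaceDeriv φ j = fun y => fderiv ℝ φ y (EuclideanSpace.single j 1, 0) from rfl,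
          ← hρ.fderiv_mollify_right hφ hφc]
        rfl
    _ = (EuclideanSpace.proj (i, j) : RGrad m n →L[ℝ] ℝ) (mollify ρ (spaceGrad φ) z) := by
        rw [hρ.clm_mollify h1, hρ.clm_mollify h2]
        rfl
    _ = _ := rfl

theorem IsTestFun.mollify (hρ : IsMollifier ρ h) (h0 : 0 < h) (h4 : h ≤ 1 / 4)
    {φ : RVec n × ℝ → RVec m} (hφ : IsTestFun 0 (-h) (3 / 2) (-h + 2) φ) :
    IsTestFun 0 0 2 4 (mollify ρ φ) := by
  refine ⟨hρ.contDiff_mollify hφ.contDiff.continuous.locallyIntegrable,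
    hρ.hasCompactSupport.convolution _ hφ.compactSupport, ?_⟩
  have hc : IsClosed (Metric.closedBall (0 : RVec n × ℝ) h + tsupport φ) :=
    ((isCompact_closedBall _ _).add hφ.compactSupport.isCompact).isClosed
  have hsub : tsupport (_root_.mollify ρ φ) ⊆ Metric.closedBall (0 : RVec n × ℝ) h + tsupport φ :=
    closure_minimal ((support_mollify_subset φ).trans (add_subset_add
      (hρ.support_subset.trans Metric.ball_subset_closedBall) (subset_tsupport φ))) hc
  intro z hz
  obtain ⟨a, ha, b, hb, rfl⟩ := hsub hz
  rw [mem_closedBall_zero_iff] at ha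
  simp only
  rw [add_comm]
  exact closedBall_subset_parCylInt_of_mem h0 h4 (hφ.support_subset hb) ha

/-- Mollification turns an approximate weak solution into a smooth one. -/
theorem IsApproxWeakSol.isApproxDivSol_mollify {δ c : ℝ} {A : RVec m → RGrad m n → RGrad m n}
    (hp : 1 < p) (hsol : IsApproxWeakSol p δ A 0 0 2 4 u Du) (hδ : 0 ≤ δ)
    (hAi : IntegrableOn (fun z => A (u z) (Du z)) (parCyl 0 0 2 4))
    (hc : δ * ((∫ z in parCyl 0 0 2 4, ‖Du z‖ ^ p) ^ (1 / p)) ^ (p - 1) ≤ c)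
    (hρ : IsMollifier ρ h) (h0 : 0 < h) (h4 : h ≤ 1 / 4) :
    IsApproxDivSol p c 0 (-h) (3 / 2) (-h + 2) (mollify ρ ((parCyl 0 0 2 4).indicator u))
      (mollify ρ ((parCyl 0 0 2 4).indicator fun z => A (u z) (Du z))) := by
  intro φ hφ
  have hQ : MeasurableSet (parCyl (0 : RVec n) 0 2 4) := measurableSet_parCyl _ _ _ _
  have hUi : Integrable ((parCyl 0 0 2 4).indicator u) :=
    (integrable_indicator_iff hQ).2 hsol.memVp.integrableOn
  have hGi : Integrable ((parCyl 0 0 2 4).indicator fun z => A (u z) (Du z)) :=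
    (integrable_indicator_iff hQ).2 hAi
  have htest := hφ.mollify hρ h0 h4
  have hct := continuous_timeDeriv hφ.contDiff
  have hcs := continuous_spaceGrad hφ.contDiff
  have hts := hφ.compactSupport.timeDeriv
  have hss := hφ.compactSupport.spaceGrad
  have hw := (hρ.contDiff_mollify hUi.locallyIntegrable).continuous
  have hG := (hρ.contDiff_mollify hGi.locallyIntegrable).continuous
  have i1 := (hw.inner (𝕜 := ℝ) hct).integrable_of_hasCompactSupport
    (μ := (volume : Measure (RVec n × ℝ))) (HasCompactSupport.intro hts fun z hz => by
      rw [image_eq_zero_of_notMem_tsupport hz, inner_zero_right])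
  have i2 := (hG.inner (𝕜 := ℝ) hcs).integrable_of_hasCompactSupport
    (μ := (volume : Measure (RVec n × ℝ))) (HasCompactSupport.intro hss fun z hz => by
      rw [image_eq_zero_of_notMem_tsupport hz, inner_zero_right])
  have hct' := continuous_timeDeriv htest.contDiff
  have hcs' := continuous_spaceGrad htest.contDiff
  have hbi : ∀ {F : Type} [NormedAddCommGroup F] [InnerProductSpace ℝ F] [CompleteSpace F]
      {f g : RVec n × ℝ → F},
      Integrable f → Continuous g → HasCompactSupport g →
      Integrable fun z => inner ℝ (f z) (g z) := by
    intro F _ _ _ f g hf hg hgc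
    obtain ⟨B, hB⟩ := hg.bounded_above_of_compact_support hgc
    refine (hf.norm.const_mul B).mono' (hf.aestronglyMeasurable.inner hg.aestronglyMeasurable)
      (Filter.Eventually.of_forall fun z => ?_)
    refine (norm_inner_le_norm _ _).trans ?_
    rw [mul_comm]
    gcongr
    exact hB z
  have hlhs : ∫ z, (-inner ℝ (mollify ρ ((parCyl 0 0 2 4).indicator u) z) (timeDeriv φ z) +
      inner ℝ (mollify ρ ((parCyl 0 0 2 4).indicator fun z => A (u z) (Du z)) z) (spaceGrad φ z))
      = ∫ z in parCyl 0 0 2 4, (-inner ℝ (u z) (timeDeriv (mollify ρ φ) z) +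
        inner ℝ (A (u z) (Du z)) (spaceGrad (mollify ρ φ) z)) := by
    have i1' : Integrable fun z => -inner ℝ (mollify ρ ((parCyl 0 0 2 4).indicator u) z)
      (timeDeriv φ z) := i1.neg
    have i3 := hbi hUi hct' htest.compactSupport.timeDeriv
    have i3' : Integrable fun z => -inner ℝ ((parCyl 0 0 2 4).indicator u z)
      (timeDeriv (mollify ρ φ) z) := i3.neg
    rw [integral_add i1' i2, integral_neg, hρ.integral_inner_mollify hUi hct hts,
      hρ.integral_inner_mollify hGi hcs hss, ← hρ.timeDeriv_mollify hφ.contDiff hφ.compactSupport,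
      ← hρ.spaceGrad_mollify hφ.contDiff hφ.compactSupport, ← integral_neg,
      ← integral_add i3'
        (hbi hGi hcs' htest.compactSupport.spaceGrad), ← integral_indicator hQ]
    congr 1
    ext1 z
    by_cases hz : z ∈ parCyl (0 : RVec n) 0 2 4 <;> simp [hz]
  rw [hlhs]
  refine (hsol.approx 0 0 2 4 two_pos four_pos subset_rfl _ htest).trans ?_
  -- The mollifier has been moved onto the test function, and Young's inequality shows that this
  -- does not increase the error term.
  have hY : ∫ z in parCyl 0 0 2 4, ‖spaceGrad (mollify ρ φ) z‖ ^ p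
      ≤ ∫ z, ‖spaceGrad φ z‖ ^ p := by
    rw [integral_norm_rpow_eq_toReal hcs'.aestronglyMeasurable (by linarith),
      integral_norm_rpow_eq_toReal hcs.aestronglyMeasurable (by linarith)]
    refine ENNReal.toReal_mono ?_ ((setLIntegral_le_lintegral _ _).trans ?_)
    · have hi : Integrable fun z => ‖spaceGrad φ z‖ ^ p :=
        (hcs.norm.rpow_const fun _ => Or.inr (by linarith)).integrable_of_hasCompactSupport
          (HasCompactSupport.intro hss fun z hz => by
            rw [image_eq_zero_of_notMem_tsupport hz, norm_zero, Real.zero_rpow (by linarith)])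
      have he : ∀ z, ‖spaceGrad φ z‖ₑ ^ p = ‖‖spaceGrad φ z‖ ^ p‖ₑ := fun z => by
        rw [← ofReal_norm, ENNReal.ofReal_rpow_of_nonneg (norm_nonneg _) (by linarith),
          Real.enorm_of_nonneg (by positivity)]
      simp_rw [he]
      exact hi.2.ne
    · rw [hρ.spaceGrad_mollify hφ.contDiff hφ.compactSupport]
      exact hρ.lintegral_mollify_rpow_le hcs.aestronglyMeasurable hp.le
  have hI0 : 0 ≤ ∫ z, ‖spaceGrad φ z‖ ^ p := integral_nonneg fun z => by positivity
  have hI0' : 0 ≤ ∫ z in parCyl 0 0 2 4, ‖spaceGrad (mollify ρ φ) z‖ ^ p :=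
    integral_nonneg fun z => by positivity
  have hc0 : 0 ≤ δ * ((∫ z in parCyl 0 0 2 4, ‖Du z‖ ^ p) ^ (1 / p)) ^ (p - 1) := by positivity
  refine mul_le_mul hc ?_ (by positivity) (hc0.trans hc)
  refine (Real.rpow_le_rpow hI0' hY (by positivity)).trans ?_
  generalize (∫ z, ‖spaceGrad φ z‖ ^ p) = I at hI0 ⊢
  rcases le_total I 1 with h | h
  · exact (Real.rpow_le_one hI0 h (by positivity)).trans (by linarith)
  · calc I ^ (1 / p) ≤ I ^ (1 : ℝ) := Real.rpow_le_rpow_of_exponent_le h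
          ((div_le_one (by linarith)).2 hp.le)
      _ ≤ 1 + I := by rw [Real.rpow_one]; linarith

end Mollified

/-! ### Removing the mollification: the estimate on the unit cylinder. -/

theorem integrable_mul_inner {α E : Type*} [MeasurableSpace α] {μ : Measure α}
    [NormedAddCommGroup E] [InnerProductSpace ℝ E] {p q : ℝ≥0∞} [p.HolderTriple q 1]
    {f g : α → E} {κ : α → ℝ} (hf : MemLp f p μ) (hg : MemLp g q μ)
    (hκm : AEStronglyMeasurable κ μ) (hκ : ∀ x, |κ x| ≤ 1) :
    Integrable (fun x => κ x * inner ℝ (f x) (g x)) μ := by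
  have h : MemLp (fun x => inner ℝ (f x) (g x)) 1 μ :=
    MemLp.of_bilin (p := p) (q := q) (fun a b : E => (inner ℝ a b : ℝ)) 1 hf hg (hf.1.inner hg.1)
      (Filter.Eventually.of_forall fun x => by
        rw [one_mul]
        exact norm_inner_le_norm _ _)
  exact (memLp_one_iff_integrable.1 h).bdd_mul hκm (Filter.Eventually.of_forall hκ)

/-- Strong convergence in dual exponents, applied to the mollified flux in L^{p/(p-1)} and the
mollified gradient in L^p. The flux is mollified as a whole, so no continuity of A is needed. -/
theorem tendsto_integral_mul_inner {α E : Type*} [MeasurableSpace α] {μ : Measure α}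
    [NormedAddCommGroup E] [InnerProductSpace ℝ E] {p q : ℝ≥0∞} [p.HolderTriple q 1]
    (hq : 1 ≤ q)
    {f : ℕ → α → E} {g : ℕ → α → E} {f₀ g₀ : α → E} {κ : α → ℝ}
    (hf : ∀ k, MemLp (f k) p μ) (hg : ∀ k, MemLp (g k) q μ) (hf₀ : MemLp f₀ p μ)
    (hg₀ : MemLp g₀ q μ) (hκm : AEStronglyMeasurable κ μ) (hκ : ∀ x, |κ x| ≤ 1)
    (hft : Filter.Tendsto (fun k => eLpNorm (f k - f₀) p μ) Filter.atTop (nhds 0))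
    (hgt : Filter.Tendsto (fun k => eLpNorm (g k - g₀) q μ) Filter.atTop (nhds 0)) :
    Filter.Tendsto (fun k => ∫ x, κ x * inner ℝ (f k x) (g k x) ∂μ) Filter.atTop
      (nhds (∫ x, κ x * inner ℝ (f₀ x) (g₀ x) ∂μ)) := by
  have hle : ∀ {f g : α → E}, MemLp f p μ → MemLp g q μ →
      eLpNorm (fun x => inner ℝ (f x) (g x)) 1 μ ≤ eLpNorm f p μ * eLpNorm g q μ := by
    intro f g hf hg
    have := eLpNorm_le_eLpNorm_mul_eLpNorm_of_nnnorm (p := p) (q := q) (r := 1) hf.1 hg.1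
      (fun a b : E => (inner ℝ a b : ℝ)) 1
      (Filter.Eventually.of_forall fun x => by
        rw [one_mul]
        exact norm_inner_le_norm _ _)
    simpa using this
  refine tendsto_integral_of_L1' _ (integrable_mul_inner hf₀ hg₀ hκm hκ).1
    (Filter.Eventually.of_forall fun k => integrable_mul_inner (hf k) (hg k) hκm hκ) ?_
  have hb : ∀ k, eLpNorm ((fun x => κ x * inner ℝ (f k x) (g k x))
      - fun x => κ x * inner ℝ (f₀ x) (g₀ x)) 1 μ
      ≤ eLpNorm (f k - f₀) p μ * (eLpNorm (g k - g₀) q μ + eLpNorm g₀ q μ)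
        + eLpNorm f₀ p μ * eLpNorm (g k - g₀) q μ := by
    intro k
    calc _ ≤ eLpNorm ((fun x => inner ℝ ((f k - f₀) x) (g k x))
          + fun x => inner ℝ (f₀ x) ((g k - g₀) x)) 1 μ := by
          refine eLpNorm_mono fun x => ?_
          rw [Pi.sub_apply, Pi.add_apply, ← mul_sub, norm_mul]
          refine (mul_le_of_le_one_left (norm_nonneg _) (hκ x)).trans_eq ?_
          simp only [Pi.sub_apply, inner_sub_left, inner_sub_right]
          congr 1
          ring
      _ ≤ _ := eLpNorm_add_le (((hf k).sub hf₀).1.inner (hg k).1) (hf₀.1.inner ((hg k).sub hg₀).1) le_rfl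
      _ ≤ eLpNorm (f k - f₀) p μ * eLpNorm (g k) q μ
          + eLpNorm f₀ p μ * eLpNorm (g k - g₀) q μ :=
          add_le_add (hle ((hf k).sub hf₀) (hg k)) (hle hf₀ ((hg k).sub hg₀))
      _ ≤ _ := by
          gcongr
          calc eLpNorm (g k) q μ = eLpNorm (g k - g₀ + g₀) q μ := by rw [sub_add_cancel]
            _ ≤ _ := eLpNorm_add_le ((hg k).sub hg₀).1 hg₀.1 hq
  refine tendsto_of_tendsto_of_tendsto_of_le_of_le tendsto_const_nhds ?_ (fun _ => zero_le) hb
  have h1 : Filter.Tendsto (fun k => eLpNorm (g k - g₀) q μ + eLpNorm g₀ q μ) Filter.atTop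
      (nhds (0 + eLpNorm g₀ q μ)) := hgt.add tendsto_const_nhds
  have h2 := ENNReal.Tendsto.mul hft (Or.inr (by rw [zero_add]; exact hg₀.2.ne)) h1
    (Or.inr ENNReal.zero_ne_top)
  have h3 := ENNReal.Tendsto.const_mul hgt (Or.inr hf₀.2.ne)
  simpa using h2.add h3

/-- The rise takes place between -7/4 and -3/2, before the space-time cutoff starts at -5/4, and the
fall between -2η and -η. Hence χ does not increase wherever the other cutoff is nonzero. -/
theorem exists_time_cutoff {η : ℝ} (hη : 0 < η) : ∃ χ : ℝ → ℝ, ContDiff ℝ 1 χ ∧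
    tsupport χ ⊆ Icc (-(7 / 4)) (-η) ∧ (∀ t, 0 ≤ χ t) ∧ (∀ t, χ t ≤ 1) ∧
    (∀ t, -(5 / 4) ≤ t → deriv χ t ≤ 0) ∧ ∀ t, -1 ≤ t → t ≤ -(2 * η) → χ t = 1 := by
  set g : ℝ → ℝ := fun t => Real.smoothTransition ((-t - η) / η) with hg
  have hga : Antitone g := fun s t hst =>
    Real.smoothTransition.monotone (by gcongr)
  have h1 : ∀ t, -(3 / 2) ≤ t → Real.smoothTransition (4 * (t + 7 / 4)) = 1 := fun t ht =>
    Real.smoothTransition.one_of_one_le (by linarith)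
  refine ⟨fun t => Real.smoothTransition (4 * (t + 7 / 4)) * g t, ?_, ?_, ?_, ?_, ?_, ?_⟩
  · have h := Real.smoothTransition.contDiff (n := 1)
    exact (h.comp (by fun_prop)).mul (h.comp (by fun_prop))
  · refine closure_minimal (fun t ht => ?_) isClosed_Icc
    by_contra hc
    rw [mem_Icc, not_and_or, not_le, not_le] at hc
    refine ht ?_
    rcases hc with hc | hc
    · simp only
      rw [Real.smoothTransition.zero_of_nonpos (by linarith), zero_mul]
    · simp only [hg]
      rw [Real.smoothTransition.zero_of_nonpos (x := (-t - η) / η)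
        (div_nonpos_of_nonpos_of_nonneg (by linarith) hη.le), mul_zero]
  · exact fun t => mul_nonneg (Real.smoothTransition.nonneg _) (Real.smoothTransition.nonneg _)
  · exact fun t => mul_le_one₀ (Real.smoothTransition.le_one _) (Real.smoothTransition.nonneg _)
      (Real.smoothTransition.le_one _)
  · intro t ht
    have he : (fun t => Real.smoothTransition (4 * (t + 7 / 4)) * g t) =ᶠ[nhds t] g := by
      filter_upwards [Ioi_mem_nhds (show -(3 / 2) < t by linarith)] with s hs
      rw [h1 s (mem_Ioi.1 hs).le, one_mul]
    rw [he.deriv_eq]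
    exact hga.deriv_nonpos
  · intro t ht1 ht2
    simp only [hg]
    rw [h1 t (by linarith), one_mul, Real.smoothTransition.one_of_one_le]
    rw [le_div_iff₀ hη]
    linarith

/-- The time cutoff must vanish near the final time 0, so estimates are first obtained up to -η; the
slice t = 0 is null. -/
theorem setLIntegral_parCyl_le_of_forall {n : ℕ} {f : RVec n × ℝ → ℝ≥0∞} {N : ℝ≥0∞}
    (hN : ∀ η > 0, ∫⁻ z in Metric.ball 0 1 ×ˢ Icc (-1) (-η), f z ≤ N) :
    ∫⁻ z in parCyl 0 0 1 1, f z ≤ N := by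
  have hU : (Metric.ball (0 : RVec n) 1 ×ˢ Ico (-1 : ℝ) 0)
      = ⋃ k : ℕ, Metric.ball (0 : RVec n) 1 ×ˢ Icc (-1 : ℝ) (-(1 / (k + 1 : ℝ))) := by
    rw [← prod_iUnion]
    congr 1
    ext t
    simp only [mem_Ico, mem_iUnion, mem_Icc]
    constructor
    · rintro ⟨h1, h2⟩
      obtain ⟨k, hk⟩ := exists_nat_one_div_lt (neg_pos.2 h2)
      exact ⟨k, h1, by linarith⟩
    · rintro ⟨k, h1, h2⟩
      have : (0 : ℝ) < 1 / (k + 1 : ℝ) := by positivity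
      exact ⟨h1, by linarith⟩
  have hae : parCyl (0 : RVec n) 0 1 1 =ᵐ[volume] Metric.ball (0 : RVec n) 1 ×ˢ Ico (-1 : ℝ) 0 := by
    rw [parCyl, zero_sub]
    exact Measure.set_prod_ae_eq (by rfl) Ico_ae_eq_Icc.symm
  rw [setLIntegral_congr hae, hU, setLIntegral_iUnion_of_directed]
  · exact iSup_le fun k => hN _ (by positivity)
  · refine directed_of_isDirected_le fun i j hij => ?_
    refine prod_mono_right (Icc_subset_Icc_right ?_)
    have : (i : ℝ) ≤ j := by exact_mod_cast hij
    rw [neg_le_neg_iff]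
    gcongr
theorem lintegral_indicator_enorm_rpow {α F : Type*} [MeasurableSpace α] {μ : Measure α}
    [NormedAddCommGroup F] {s : Set α} (hs : MeasurableSet s) (f : α → F) {r : ℝ} (hr : 0 < r) :
    ∫⁻ z, ‖s.indicator f z‖ₑ ^ r ∂μ = ∫⁻ z in s, ‖f z‖ₑ ^ r ∂μ := by
  rw [← lintegral_indicator hs]
  congr 1
  ext1 z
  by_cases hz : z ∈ s <;> simp [hz, hr]

theorem IsMollifier.setIntegral_norm_rpow_le {G F : Type*} [NormedAddCommGroup G]
    [NormedSpace ℝ G] [FiniteDimensional ℝ G] [MeasureSpace G] [BorelSpace G]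
    [(volume : Measure G).IsAddHaarMeasure] [NormedAddCommGroup F] [NormedSpace ℝ F]
    {ρ : G → ℝ} {h : ℝ} (hρ : IsMollifier ρ h) {f g : G → F}
    (hf : AEStronglyMeasurable f volume) {r K : ℝ} (hr : 1 ≤ r) (hK : 0 ≤ K)
    (hfK : ∫⁻ z, ‖f z‖ₑ ^ r ≤ ENNReal.ofReal K) {D : Set G} (hD : MeasurableSet D)
    (hg : AEStronglyMeasurable g volume) (hgf : ∀ z ∈ D, g z = mollify ρ f z) :
    ∫ z in D, ‖g z‖ ^ r ≤ K := by
  rw [integral_norm_rpow_eq_toReal hg.restrict (by linarith)]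
  refine ENNReal.toReal_le_of_le_ofReal hK ?_
  calc ∫⁻ z in D, ‖g z‖ₑ ^ r = ∫⁻ z in D, ‖mollify ρ f z‖ₑ ^ r :=
        setLIntegral_congr_fun hD fun z hz => by simp only [hgf z hz]
    _ ≤ ∫⁻ z, ‖mollify ρ f z‖ₑ ^ r := setLIntegral_le_lintegral _ _
    _ ≤ _ := (hρ.lintegral_mollify_rpow_le hf hr).trans hfK

theorem EllipticE.enorm_le {m n : ℕ} {p lam Lam : ℝ} {A : RVec m → RGrad m n → RGrad m n}
    (hA : EllipticE p lam Lam A) (hp : 1 < p) (hLam : 0 ≤ Lam) (w : RVec m) (ζ : RGrad m n) :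
    ‖A w ζ‖ₑ ≤ ENNReal.ofReal Lam * ‖ζ‖ₑ ^ (p - 1) := by
  rw [← ofReal_norm, ← ofReal_norm, ENNReal.ofReal_rpow_of_nonneg (norm_nonneg _) (by linarith),
    ← ENNReal.ofReal_mul hLam]
  exact ENNReal.ofReal_le_ofReal (hA.norm_le hLam w ζ)

theorem EllipticE.lintegral_flux_rpow_le {m n : ℕ} {p lam Lam : ℝ}
    {A : RVec m → RGrad m n → RGrad m n} (hA : EllipticE p lam Lam A) (hp : 1 < p)
    (hLam : 0 ≤ Lam) {α : Type*} [MeasurableSpace α] {μ : Measure α} {u : α → RVec m}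
    {v : α → RGrad m n} {K : ℝ} (hK : ∫⁻ z, ‖v z‖ₑ ^ p ∂μ ≤ ENNReal.ofReal K) :
    ∫⁻ z, ‖A (u z) (v z)‖ₑ ^ (p / (p - 1)) ∂μ
      ≤ ENNReal.ofReal (Lam ^ (p / (p - 1)) * K) := by
  have hp1 : 0 < p - 1 := by linarith
  have hp' : 0 < p / (p - 1) := by positivity
  calc _ ≤ ∫⁻ z, ENNReal.ofReal (Lam ^ (p / (p - 1))) * ‖v z‖ₑ ^ p ∂μ := by
        refine lintegral_mono fun z => ?_
        refine (ENNReal.rpow_le_rpow (hA.enorm_le hp hLam _ _) hp'.le).trans_eq ?_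
        rw [ENNReal.mul_rpow_of_nonneg _ _ hp'.le, ← ENNReal.rpow_mul,
          ENNReal.ofReal_rpow_of_nonneg hLam hp'.le]
        congr 2
        field_simp
    _ = ENNReal.ofReal (Lam ^ (p / (p - 1))) * ∫⁻ z, ‖v z‖ₑ ^ p ∂μ :=
        lintegral_const_mul' _ _ ENNReal.ofReal_ne_top
    _ ≤ _ := by
        rw [ENNReal.ofReal_mul (by positivity)]
        gcongr

/-- Smallness of the gradient in L^q passes to the flux in L¹ because |A| is at most Lam |v|^{p-1},
and this power is bounded by a small constant plus a multiple of |v|^q. -/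
theorem EllipticE.lintegral_flux_le {m n : ℕ} {p q lam Lam : ℝ}
    {A : RVec m → RGrad m n → RGrad m n} (hA : EllipticE p lam Lam A) (hp : 1 < p)
    (hLam : 0 ≤ Lam) {α : Type*} [MeasurableSpace α] {μ : Measure α} {u : α → RVec m}
    {v : α → RGrad m n} {c e C V : ℝ} (hc : 0 ≤ c) (he : 0 ≤ e) (hC : 0 ≤ C) (hV : 0 ≤ V)
    (hμ : μ univ ≤ ENNReal.ofReal V)
    (hCe : ∀ y : ℝ, 0 ≤ y → y ^ (p - 1) ≤ e + C * y ^ q) (hq : 0 ≤ q)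
    (hvc : ∫⁻ z, ‖v z‖ₑ ^ q ∂μ ≤ ENNReal.ofReal c) :
    ∫⁻ z, ‖A (u z) (v z)‖ₑ ∂μ ≤ ENNReal.ofReal (Lam * (e * V + C * c)) := by
  have hpt : ∀ z, ‖A (u z) (v z)‖ₑ
      ≤ ENNReal.ofReal Lam * (ENNReal.ofReal e + ENNReal.ofReal C * ‖v z‖ₑ ^ q) := by
    intro z
    refine (hA.enorm_le hp hLam _ _).trans ?_
    gcongr
    rw [← ofReal_norm, ENNReal.ofReal_rpow_of_nonneg (norm_nonneg _) (by linarith),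
      ENNReal.ofReal_rpow_of_nonneg (norm_nonneg _) hq, ← ENNReal.ofReal_mul hC,
      ← ENNReal.ofReal_add he (by positivity)]
    exact ENNReal.ofReal_le_ofReal (hCe _ (norm_nonneg _))
  calc _ ≤ ∫⁻ z, ENNReal.ofReal Lam *
        (ENNReal.ofReal e + ENNReal.ofReal C * ‖v z‖ₑ ^ q) ∂μ := lintegral_mono hpt
    _ = ENNReal.ofReal Lam * (ENNReal.ofReal e * μ univ
        + ENNReal.ofReal C * ∫⁻ z, ‖v z‖ₑ ^ q ∂μ) := by
        rw [lintegral_const_mul' _ _ ENNReal.ofReal_ne_top, lintegral_add_left measurable_const,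
          lintegral_const, lintegral_const_mul' _ _ ENNReal.ofReal_ne_top]
    _ ≤ _ := by
        rw [ENNReal.ofReal_mul hLam, ENNReal.ofReal_add (by positivity) (by positivity),
          ENNReal.ofReal_mul he, ENNReal.ofReal_mul hC]
        gcongr

/-- If the gradient of an approximate solution on a fixed cylinder is bounded in `L^p` and small in
`L^q`, then its `L^p` mean on a smaller cylinder is at most one. -/
theorem exists_reverseHolder_unit {n m : ℕ} (hn : 1 ≤ n) {p q P lam Lam K : ℝ} (hp : 1 < p)
    (hlam : 0 < lam) (hLam : 0 < Lam) (hpP : p ≤ P) (hP : 2 ≤ P) (hq : 1 ≤ q) (hqp : q < p)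
    (hpq : p - 1 ≤ q) (hPq : P - q ≤ 1) (hnq : n * P / (n + 2) ≤ q) (hK : 0 ≤ K) :
    ∃ c : ℝ, 0 < c ∧ ∃ δ₀ : ℝ, 0 < δ₀ ∧ ∀ A : RVec m → RGrad m n → RGrad m n,
      EllipticE p lam Lam A → ∀ δ : ℝ, 0 ≤ δ → δ ≤ δ₀ →
      ∀ (u : RVec n × ℝ → RVec m) (Du : RVec n × ℝ → RGrad m n),
      IsApproxWeakSol p δ A 0 0 2 4 u Du →
      ∫⁻ z in parCyl 0 0 2 4, ‖Du z‖ₑ ^ p ≤ ENNReal.ofReal K →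
      ∫⁻ z in parCyl 0 0 2 4, ‖Du z‖ₑ ^ q ≤ ENNReal.ofReal c →
      ∫⁻ z in parCyl 0 0 1 1, ‖Du z‖ₑ ^ p ≤ volume (parCyl (0 : RVec n) 0 1 1) := by
  have hp1 : 0 < p - 1 := by linarith
  set p' : ℝ := p / (p - 1) with hp'
  have hp'1 : 1 < p' := by rw [hp', lt_div_iff₀ hp1]; linarith
  set ζ : ContDiffBump (0 : RVec n) := ⟨1 / 2, 1, by norm_num, by norm_num⟩ with hζ
  set ψ : ContDiffBump (0 : RVec n × ℝ) := ⟨1, 5 / 4, by norm_num, by norm_num⟩ with hψ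
  obtain ⟨Z, hZ⟩ : ∃ Z, ∀ x, ‖ζ.normed volume x‖ ≤ Z :=
    (ζ.contDiff_normed (n := 1)).continuous.bounded_above_of_compact_support
      ζ.hasCompactSupport_normed
  set V₁ : ℝ := (volume (parCyl (0 : RVec n) 0 1 1)).toReal with hV₁
  have hV₁0 : 0 < V₁ := ENNReal.toReal_pos (volume_parCyl_pos _ _ one_pos one_pos).ne'
    (volume_parCyl_ne_top _ _ _ _)
  set V : ℝ := (volume (parCyl (0 : RVec n) 0 2 4)).toReal with hV
  have hV0 : 0 ≤ V := ENNReal.toReal_nonneg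
  set K₁ : ℝ := max K (Lam ^ p' * K) with hK₁
  have hK₁0 : 0 ≤ K₁ := hK.trans (le_max_left _ _)
  -- The tolerance lam·V₁ is chosen so that, after ellipticity and division by lam, the bound is the
  -- volume of the unit cylinder.
  obtain ⟨c₁, hc₁, hmain⟩ := exists_smooth_energy_small (n := n) (m := m) hn hp hpP hP hq
    (hqp.trans_le hpP) hPq hnq (ζ.contDiff_normed (n := 1))
    (by
      rw [ζ.tsupport_normed_eq]
      exact Metric.closedBall_subset_ball (by norm_num))
    hZ ζ.integral_normed (ψ := ψ) ψ.contDiff (by rw [ψ.tsupport_eq]) (fun z => ψ.nonneg)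
    (fun z => ψ.le_one) hK₁0 (ε := lam * V₁) (by positivity)
  -- This e, together with the second entry in the definition of c, bounds the L¹ norm of the flux
  -- by c₁/2 + c₁/2.
  obtain ⟨C, hC0, hC⟩ := exists_rpow_le_add_mul_rpow hp1 hpq
    (e := c₁ / (2 * Lam * (V + 1))) (by positivity)
  set c : ℝ := min c₁ (c₁ / (2 * Lam * (C + 1))) with hc
  have hc0 : 0 < c := by positivity
  set Kδ : ℝ := (K ^ (1 / p)) ^ (p - 1) with hKδ
  have hKδ0 : 0 ≤ Kδ := by positivity
  refine ⟨c, hc0, c₁ / (Kδ + 1), by positivity, ?_⟩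
  intro A hA δ hδ0 hδ u Du hsol hDp hDq
  set Q : Set (RVec n × ℝ) := parCyl 0 0 2 4 with hQdef
  have hQ : MeasurableSet Q := measurableSet_parCyl _ _ _ _
  have hDm : AEStronglyMeasurable (Q.indicator Du) volume :=
    (aestronglyMeasurable_indicator_iff hQ).2 hsol.memVp.memLp_grad.1
  have hAm : AEStronglyMeasurable (Q.indicator fun z => A (u z) (Du z)) volume :=
    (aestronglyMeasurable_indicator_iff hQ).2 hsol.flux_measurable
  have hDp' : ∫⁻ z, ‖Q.indicator Du z‖ₑ ^ p ≤ ENNReal.ofReal K := by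
    rwa [lintegral_indicator_enorm_rpow hQ _ (by linarith)]
  have hDq' : ∫⁻ z, ‖Q.indicator Du z‖ₑ ^ q ≤ ENNReal.ofReal c := by
    rwa [lintegral_indicator_enorm_rpow hQ _ (by linarith)]
  have hAp' : ∫⁻ z, ‖Q.indicator (fun z => A (u z) (Du z)) z‖ₑ ^ p'
      ≤ ENNReal.ofReal (Lam ^ p' * K) := by
    rw [lintegral_indicator_enorm_rpow hQ _ (by linarith)]
    exact hA.lintegral_flux_rpow_le hp hLam.le hDp
  have hA1 : ∫⁻ z in Q, ‖A (u z) (Du z)‖ₑ ≤ ENNReal.ofReal c₁ := by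
    refine (hA.lintegral_flux_le hp hLam.le hc0.le (by positivity) hC0 hV0
      (μ := volume.restrict Q) ?_ hC (by linarith) hDq).trans (ENNReal.ofReal_le_ofReal ?_)
    · rw [Measure.restrict_apply_univ, hV, ENNReal.ofReal_toReal (volume_parCyl_ne_top _ _ _ _)]
    · have h1 : Lam * (c₁ / (2 * Lam * (V + 1)) * V) ≤ c₁ / 2 := by
        have h : V / (V + 1) ≤ 1 := (div_le_one (by positivity)).2 (by linarith)
        calc Lam * (c₁ / (2 * Lam * (V + 1)) * V) = c₁ / 2 * (V / (V + 1)) := by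
              field_simp
          _ ≤ c₁ / 2 := mul_le_of_le_one_right (by positivity) h
      have h2 : Lam * (C * c) ≤ c₁ / 2 := by
        have h : C / (C + 1) ≤ 1 := (div_le_one (by positivity)).2 (by linarith)
        calc Lam * (C * c) ≤ Lam * (C * (c₁ / (2 * Lam * (C + 1)))) := by
              gcongr
              exact min_le_right _ _
          _ = c₁ / 2 * (C / (C + 1)) := by field_simp
          _ ≤ c₁ / 2 := mul_le_of_le_one_right (by positivity) h
      rw [mul_add]
      linarith
  have hA1' : ∫⁻ z, ‖Q.indicator (fun z => A (u z) (Du z)) z‖ₑ ^ (1 : ℝ)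
      ≤ ENNReal.ofReal c₁ := by
    rw [lintegral_indicator_enorm_rpow hQ _ one_pos]
    simpa using hA1
  have hAi : IntegrableOn (fun z => A (u z) (Du z)) Q :=
    ⟨hsol.flux_measurable, hA1.trans_lt ENNReal.ofReal_lt_top⟩
  have hD : MemLp (Q.indicator Du) (ENNReal.ofReal p) volume :=
    (memLp_indicator_iff_restrict hQ).2 hsol.memVp.memLp_grad
  have hAM : MemLp (Q.indicator fun z => A (u z) (Du z)) (ENNReal.ofReal p') volume := by
    refine ⟨hAm, ?_⟩
    rw [eLpNorm_lt_top_iff_lintegral_rpow_enorm_lt_top (by simp; linarith)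
      ENNReal.ofReal_ne_top, ENNReal.toReal_ofReal (by linarith)]
    exact hAp'.trans_lt ENNReal.ofReal_lt_top
  have hδc : δ * ((∫ z in Q, ‖Du z‖ ^ p) ^ (1 / p)) ^ (p - 1) ≤ c₁ := by
    have hI : ∫ z in Q, ‖Du z‖ ^ p ≤ K := by
      rw [integral_norm_rpow_eq_toReal hsol.memVp.memLp_grad.1 (by linarith)]
      exact ENNReal.toReal_le_of_le_ofReal hK hDp
    have hI0 : 0 ≤ ∫ z in Q, ‖Du z‖ ^ p := integral_nonneg fun z => by positivity
    calc δ * ((∫ z in Q, ‖Du z‖ ^ p) ^ (1 / p)) ^ (p - 1) ≤ c₁ / (Kδ + 1) * Kδ := by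
          rw [hKδ]
          gcongr
      _ ≤ c₁ := by
          rw [div_mul_eq_mul_div, div_le_iff₀ (by positivity)]
          nlinarith
  set h : ℕ → ℝ := fun k => 1 / ((k : ℝ) + 4) with hh
  have hh0 : ∀ k, 0 < h k := fun k => by positivity
  have hh4 : ∀ k, h k ≤ 1 / 4 := fun k =>
    one_div_le_one_div_of_le (by norm_num) (by linarith [(Nat.cast_nonneg k : (0 : ℝ) ≤ k)])
  have hht : Filter.Tendsto h Filter.atTop (nhds 0) := by
    have := (tendsto_one_div_add_atTop_nhds_zero_nat (𝕜 := ℝ)).comp (Filter.tendsto_add_atTop_nat 3)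
    refine this.congr fun k => ?_
    simp only [Function.comp, hh]
    push_cast
    ring_nf
  set ρ : ℕ → RVec n × ℝ → ℝ := fun k =>
    (⟨h k / 2, h k, half_pos (hh0 k), half_lt_self (hh0 k)⟩ :
      ContDiffBump (0 : RVec n × ℝ)).normed volume with hρdef
  have hρ : ∀ k, IsMollifier (ρ k) (h k) := fun k =>
    (⟨h k / 2, h k, half_pos (hh0 k), half_lt_self (hh0 k)⟩ :
      ContDiffBump (0 : RVec n × ℝ)).isMollifier
  clear_value ρ
  refine setLIntegral_parCyl_le_of_forall fun η hη => ?_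
  obtain ⟨χ, hχ, hχs, hχ0, hχ1, hχd, hχone⟩ := exists_time_cutoff (half_pos hη)
  have hUi : LocallyIntegrable (Q.indicator u) :=
    ((integrable_indicator_iff hQ).2 hsol.memVp.integrableOn).locallyIntegrable
  have hGi : LocallyIntegrable (Q.indicator fun z => A (u z) (Du z)) :=
    ((integrable_indicator_iff hQ).2 hAi).locallyIntegrable
  have hκ : ∀ z : RVec n × ℝ, |χ z.2 * ψ z ^ 3| ≤ 1 := fun z => by
    rw [abs_of_nonneg (mul_nonneg (hχ0 _) (pow_nonneg ψ.nonneg 3))]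
    exact mul_le_one₀ (hχ1 _) (pow_nonneg ψ.nonneg 3) (pow_le_one₀ ψ.nonneg ψ.le_one)
  have hκm : AEStronglyMeasurable (fun z : RVec n × ℝ => χ z.2 * ψ z ^ 3) volume :=
    ((hχ.continuous.comp continuous_snd).mul (ψ.continuous.pow 3)).aestronglyMeasurable
  have hlim : ∫ z : RVec n × ℝ, (χ z.2 * ψ z ^ 3) *
      inner ℝ (Q.indicator (fun z => A (u z) (Du z)) z) (Q.indicator Du z) ≤ lam * V₁ := by
    have hHT : (ENNReal.ofReal p').HolderTriple (ENNReal.ofReal p) 1 :=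
      (Real.HolderConjugate.conjExponent hp).symm.ennrealOfReal
    have hDi : LocallyIntegrable (Q.indicator Du) :=
      hD.locallyIntegrable (ENNReal.one_le_ofReal.2 hp.le)
    have htend := tendsto_integral_mul_inner (p := ENNReal.ofReal p') (q := ENNReal.ofReal p)
      (ENNReal.one_le_ofReal.2 hp.le)
      (fun k => ⟨((hρ k).contDiff_mollify hGi).continuous.aestronglyMeasurable,
        ((hρ k).eLpNorm_mollify_le hAm hp'1.le).trans_lt hAM.2⟩)
      (fun k => ⟨((hρ k).contDiff_mollify hDi).continuous.aestronglyMeasurable,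
        ((hρ k).eLpNorm_mollify_le hDm hp.le).trans_lt hD.2⟩)
      hAM hD hκm hκ (tendsto_eLpNorm_mollify_sub hρ hht hp'1.le hAM)
      (tendsto_eLpNorm_mollify_sub hρ hht hp.le hD)
    refine le_of_tendsto htend ?_
    filter_upwards [hht.eventually_lt_const (half_pos hη)] with k hk
    have hk0 := hh0 k
    have hk4 := hh4 k
    have hgrad : ∀ z ∈ parCylInt (0 : RVec n) (-h k) (3 / 2) (-h k + 2),
        spaceGrad (mollify (ρ k) (Q.indicator u)) z = mollify (ρ k) (Q.indicator Du) z :=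
      fun z hz => hsol.memVp.spaceGrad_mollify hp (hρ k) hk0 hk4 hz
    have hwc := (hρ k).contDiff_mollify hUi
    have hGc := ((hρ k).contDiff_mollify hGi).continuous
    have hms := (continuous_spaceGrad hwc).aestronglyMeasurable (μ := volume)
    have hDk : MeasurableSet (parCylInt (0 : RVec n) (-h k) (3 / 2) (-h k + 2)) :=
      measurableSet_parCylInt _ _ _ _
    have hfin := hmain (-h k) (by linarith) (by linarith) _ _ hwc hGc
      (hsol.isApproxDivSol_mollify hp hδ0 hAi hδc (hρ k) hk0 hk4)
      ((hρ k).setIntegral_norm_rpow_le hDm hp.le hK₁0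
        (hDp'.trans (ENNReal.ofReal_le_ofReal (le_max_left _ _))) hDk hms hgrad)
      ((hρ k).setIntegral_norm_rpow_le hAm hp'1.le hK₁0
        (hAp'.trans (ENNReal.ofReal_le_ofReal (le_max_right _ _))) hDk
        hGc.aestronglyMeasurable fun _ _ => rfl)
      ((hρ k).setIntegral_norm_rpow_le hDm hq hc₁.le
        (hDq'.trans (ENNReal.ofReal_le_ofReal (min_le_left _ _))) hDk hms hgrad)
      (by
        simpa using (hρ k).setIntegral_norm_rpow_le hAm le_rfl hc₁.le hA1' hDk
          hGc.aestronglyMeasurable fun _ _ => rfl)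
      χ hχ (fun t ht => ⟨by linarith [(hχs ht).1], by linarith [(hχs ht).2]⟩) hχ0 hχ1 hχd
    refine (integral_congr_ae (Filter.Eventually.of_forall fun z => ?_)).trans_le hfin
    by_cases hz : χ z.2 * ψ z ^ 3 = 0
    · rw [hz, zero_mul, zero_mul]
    · rw [hgrad]
      have h1 : χ z.2 ≠ 0 := left_ne_zero_of_mul hz
      have h2 : ψ z ≠ 0 := fun h => hz (by rw [h]; ring)
      have h3 := hχs (subset_tsupport _ h1)
      have h4 : z ∈ Metric.ball (0 : RVec n × ℝ) (5 / 4) := by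
        rw [← ψ.support_eq]
        exact h2
      rw [mem_ball_zero_iff] at h4
      refine mem_parCylInt.2 ⟨?_, ?_, ?_⟩
      · rw [dist_zero_right]
        exact (norm_fst_le z).trans_lt (by linarith)
      · linarith [h3.1]
      · linarith [h3.2]
  have hHT : (ENNReal.ofReal p').HolderTriple (ENNReal.ofReal p) 1 :=
    (Real.HolderConjugate.conjExponent hp).symm.ennrealOfReal
  have hint := integrable_mul_inner (p := ENNReal.ofReal p') (q := ENNReal.ofReal p) hAM hD hκm hκ
  -- Ellipticity is used only now, after the limit: the mollified flux and gradient need not satisfy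
  -- it.
  have hlow : ∀ z, lam * (χ z.2 * ψ z ^ 3) * ‖Q.indicator Du z‖ ^ p ≤ (χ z.2 * ψ z ^ 3) *
      inner ℝ (Q.indicator (fun z => A (u z) (Du z)) z) (Q.indicator Du z) := by
    intro z
    by_cases hz : z ∈ Q
    · rw [indicator_of_mem hz, indicator_of_mem hz]
      have := mul_le_mul_of_nonneg_left (hA.lower (u z) (Du z))
        (mul_nonneg (hχ0 z.2) (pow_nonneg (ψ.nonneg (x := z)) 3))
      linarith
    · rw [indicator_of_notMem hz, indicator_of_notMem hz, norm_zero, inner_zero_right,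
        Real.zero_rpow (by linarith), mul_zero, mul_zero]
  have hlow0 : ∀ z, 0 ≤ (χ z.2 * ψ z ^ 3) *
      inner ℝ (Q.indicator (fun z => A (u z) (Du z)) z) (Q.indicator Du z) := fun z =>
    (mul_nonneg (mul_nonneg hlam.le (mul_nonneg (hχ0 _) (pow_nonneg ψ.nonneg 3)))
      (by positivity)).trans (hlow z)
  have hS : MeasurableSet (Metric.ball (0 : RVec n) 1 ×ˢ Icc (-1 : ℝ) (-η)) :=
    measurableSet_ball.prod measurableSet_Icc
  have hfinal : ENNReal.ofReal lam * ∫⁻ z in Metric.ball (0 : RVec n) 1 ×ˢ Icc (-1 : ℝ) (-η),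
      ‖Du z‖ₑ ^ p ≤ ENNReal.ofReal lam * volume (parCyl (0 : RVec n) 0 1 1) := by
    calc _ = ∫⁻ z in Metric.ball (0 : RVec n) 1 ×ˢ Icc (-1 : ℝ) (-η),
          ENNReal.ofReal lam * ‖Du z‖ₑ ^ p :=
          (lintegral_const_mul' _ _ ENNReal.ofReal_ne_top).symm
      _ ≤ ∫⁻ z in Metric.ball (0 : RVec n) 1 ×ˢ Icc (-1 : ℝ) (-η),
          ENNReal.ofReal ((χ z.2 * ψ z ^ 3) *
            inner ℝ (Q.indicator (fun z => A (u z) (Du z)) z) (Q.indicator Du z)) := by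
          refine setLIntegral_mono' hS fun z hz => ?_
          have hz1 : ‖z.1‖ < 1 := by simpa using hz.1
          have hz2 := hz.2
          have hzψ : ψ z = 1 := ψ.one_of_mem_closedBall (by
            rw [mem_closedBall_zero_iff, Prod.norm_def, Real.norm_eq_abs]
            exact max_le hz1.le (abs_le.2 ⟨hz2.1, by linarith [hz2.2]⟩))
          have hzQ : z ∈ Q := mem_parCyl.2 (by
            rw [dist_zero_right]
            exact ⟨by linarith, by linarith [hz2.1], by linarith [hz2.2]⟩)
          have h1 := hlow z
          rw [hzψ, hχone z.2 hz2.1 (by linarith [hz2.2]), one_pow, mul_one, mul_one] at h1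
          rw [hzψ, hχone z.2 hz2.1 (by linarith [hz2.2]), one_pow, mul_one]
          rw [indicator_of_mem hzQ Du] at h1 ⊢
          rw [← ofReal_norm, ENNReal.ofReal_rpow_of_nonneg (norm_nonneg _) (by linarith),
            ← ENNReal.ofReal_mul hlam.le]
          exact ENNReal.ofReal_le_ofReal h1
      _ ≤ ∫⁻ z, ENNReal.ofReal ((χ z.2 * ψ z ^ 3) *
            inner ℝ (Q.indicator (fun z => A (u z) (Du z)) z) (Q.indicator Du z)) :=
          setLIntegral_le_lintegral _ _
      _ = ENNReal.ofReal (∫ z, (χ z.2 * ψ z ^ 3) *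
            inner ℝ (Q.indicator (fun z => A (u z) (Du z)) z) (Q.indicator Du z)) :=
          (ofReal_integral_eq_lintegral_ofReal hint (Filter.Eventually.of_forall hlow0)).symm
      _ ≤ ENNReal.ofReal (lam * V₁) := ENNReal.ofReal_le_ofReal hlim
      _ = _ := by
          rw [ENNReal.ofReal_mul hlam.le, hV₁, ENNReal.ofReal_toReal (volume_parCyl_ne_top _ _ _ _)]
  exact (ENNReal.mul_le_mul_iff_right (by simpa using hlam) ENNReal.ofReal_ne_top).1 hfinal

/-! ### The intrinsic reverse Hölder inequality and the conclusion. -/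

theorem setLIntegral_enorm_smul_comp_parHomeo {n : ℕ} {F : Type*} [NormedAddCommGroup F]
    [NormedSpace ℝ F] (y : RVec n) (τ : ℝ) {r s k e : ℝ} (hr : 0 < r) (hs : 0 < s) (hk : 0 ≤ k)
    (he : 0 ≤ e) (f : RVec n × ℝ → F) (R ρ : ℝ) :
    ∫⁻ z in parCyl 0 0 R ρ, ‖k • f (parHomeo y τ hr.ne' hs.ne' z)‖ₑ ^ e
      = ENNReal.ofReal (k ^ e * (r ^ n * s)⁻¹) * ∫⁻ z in parCyl y τ (r * R) (s * ρ), ‖f z‖ₑ ^ e := by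
  have h1 : ∀ z, ‖k • f z‖ₑ ^ e = ENNReal.ofReal (k ^ e) * ‖f z‖ₑ ^ e := fun z => by
    rw [enorm_smul, ENNReal.mul_rpow_of_nonneg _ _ he, Real.enorm_of_nonneg hk,
      ENNReal.ofReal_rpow_of_nonneg hk he]
  have h2 := setLIntegral_comp_parHomeo y τ hr hs (fun z => ‖k • f z‖ₑ ^ e) 0 0 R ρ
  rw [smul_zero, add_zero, mul_zero, add_zero] at h2
  rw [h2]
  simp_rw [h1]
  rw [lintegral_const_mul' _ _ ENNReal.ofReal_ne_top, ← mul_assoc,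
    ENNReal.ofReal_mul (by positivity), mul_comm (ENNReal.ofReal (k ^ e))]

/-- By contradiction: were the integral of |Du|^q over the doubled cylinder too small, rescaling
with μ = l r would give a solution on B_2 × [-4, 0] to which the unit estimate applies, and the mean
of |Du|^p over the original cylinder would be at most l^p. The stopping bound on the enlargement
supplies the constant 10^{n+2}|B_1|. -/
theorem IsApproxWeakSol.intrinsicRevHolder {n m : ℕ} {p q lam Lam c c₀ δ₀ δ : ℝ} (hp : 1 < p)
    (hq : 0 ≤ q) (hc₀ : 0 ≤ c₀)
    (hc : ENNReal.ofReal c₀ * volume (Metric.ball (0 : RVec n) 1) ≤ ENNReal.ofReal c)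
    (hunit : ∀ A : RVec m → RGrad m n → RGrad m n,
      EllipticE p lam Lam A → ∀ δ : ℝ, 0 ≤ δ → δ ≤ δ₀ →
      ∀ (u : RVec n × ℝ → RVec m) (Du : RVec n × ℝ → RGrad m n),
      IsApproxWeakSol p δ A 0 0 2 4 u Du →
      ∫⁻ z in parCyl 0 0 2 4, ‖Du z‖ₑ ^ p
        ≤ ENNReal.ofReal (10 ^ (n + 2) * (volume (Metric.ball (0 : RVec n) 1)).toReal) →
      ∫⁻ z in parCyl 0 0 2 4, ‖Du z‖ₑ ^ q ≤ ENNReal.ofReal c →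
      ∫⁻ z in parCyl 0 0 1 1, ‖Du z‖ₑ ^ p ≤ volume (parCyl (0 : RVec n) 0 1 1))
    {A : RVec m → RGrad m n → RGrad m n} (hA : EllipticE p lam Lam A) (hδ : 0 ≤ δ) (hδ₀ : δ ≤ δ₀)
    {u : RVec n × ℝ → RVec m} {Du : RVec n × ℝ → RGrad m n}
    (hsol : IsApproxWeakSol p δ A 0 0 1 1 u Du) {g : RVec n × ℝ → ℝ≥0}
    (hg : ∀ᵐ z ∂volume.restrict (parCyl (0 : RVec n) 0 1 1), (g z : ℝ≥0∞) = ‖Du z‖ₑ) :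
    IntrinsicRevHolder p q c₀ g := by
  intro l hl y b r hr hb hE hbig hle
  have hl0 : 0 < l := by linarith
  have hcongr : ∀ {S : Set (RVec n × ℝ)}, S ⊆ parCyl 0 0 1 1 → ∀ e : ℝ,
      ∫⁻ z in S, (g z : ℝ≥0∞) ^ e = ∫⁻ z in S, ‖Du z‖ₑ ^ e := fun hS e =>
    lintegral_congr_ae ((ae_restrict_of_ae_restrict_of_subset hS hg).mono fun z hz => by
      simp only [hz])
  set s : ℝ := l ^ (2 - p) * r ^ 2 with hs
  have hs0 : 0 < s := by positivity
  have e10 : l ^ (2 - p) * (10 * r) ^ 2 = 100 * s := by rw [hs]; ring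
  have e2 : l ^ (2 - p) * (2 * r) ^ 2 = s * 4 := by rw [hs]; ring
  rw [e10] at hE hle
  rw [e2, mul_comm 2 r]
  have hm : min (b + 16 * s) 0 ≤ b + 16 * s := min_le_left _ _
  have hbm : b ≤ min (b + 16 * s) 0 := le_min (by linarith) hb
  have h2E : parCyl y b (r * 2) (s * 4) ⊆ parCyl y (min (b + 16 * s) 0) (10 * r) (100 * s) :=
    parCyl_subset (by rw [dist_self]; linarith) (by linarith) hbm
  have h12 : parCyl y b r s ⊆ parCyl y b (r * 2) (s * 4) :=
    parCyl_subset (by rw [dist_self]; linarith) (by linarith) le_rfl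
  rw [hcongr (h2E.trans hE)]
  rw [hcongr hE] at hle
  rw [hcongr ((h12.trans h2E).trans hE)] at hbig
  by_contra! hlt
  set ω := volume (Metric.ball (0 : RVec n) 1) with hω
  have hω0 : ω ≠ ⊤ := measure_ball_lt_top.ne
  have hk : r / (l * r) = l⁻¹ := by field_simp
  -- The time length l^{2-p} r² is exactly what the scaling relation requires for μ = l r.
  have hrs : s * (l * r) ^ (p - 2) = r ^ p := by
    rw [hs, Real.mul_rpow hl0.le hr.le, show 2 - p = -(p - 2) by ring, Real.rpow_neg hl0.le,
      ← Real.rpow_natCast r 2]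
    calc _ = ((l ^ (p - 2))⁻¹ * l ^ (p - 2)) * (r ^ ((2 : ℕ) : ℝ) * r ^ (p - 2)) := by ring
      _ = r ^ p := by
        rw [inv_mul_cancel₀ (by positivity), one_mul, ← Real.rpow_add hr]
        congr 1
        push_cast
        ring
  have hsol' : IsApproxWeakSol p δ A (y + r • 0) (b + s * 0) (r * 2) (s * 4) u Du := by
    rw [smul_zero, add_zero, mul_zero, add_zero]
    exact hsol.mono (by positivity) (by positivity) (h2E.trans hE)
  have hres := hsol'.rescale hp hr hs0 (mul_pos hl0 hr) hrs
  have hsc : ∀ {e : ℝ}, 0 ≤ e → ∀ R ρ, ∫⁻ z in parCyl 0 0 R ρ,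
      ‖(r / (l * r)) • Du (parHomeo y b hr.ne' hs0.ne' z)‖ₑ ^ e
      = ENNReal.ofReal (l⁻¹ ^ e * (r ^ n * s)⁻¹) * ∫⁻ z in parCyl y b (r * R) (s * ρ),
        ‖Du z‖ₑ ^ e := fun he R ρ => by
    rw [hk]
    exact setLIntegral_enorm_smul_comp_parHomeo y b hr hs0 (by positivity) he Du R ρ
  have hp0 : 0 ≤ p := by linarith
  have hfin := hunit _ (hA.rescale hr (mul_pos hl0 hr)) δ hδ hδ₀ _ _ hres
    (by
      rw [hsc hp0]
      calc _ ≤ ENNReal.ofReal (l⁻¹ ^ p * (r ^ n * s)⁻¹) * (ENNReal.ofReal (l ^ p) *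
            volume (parCyl y (min (b + 16 * s) 0) (10 * r) (100 * s))) := by
            gcongr
            exact (lintegral_mono_set h2E).trans hle
        _ = ENNReal.ofReal (10 ^ (n + 2)) * ω := by
            rw [volume_parCyl _ _ (by positivity), ← mul_assoc, ← mul_assoc,
              ← ENNReal.ofReal_mul (by positivity), ← ENNReal.ofReal_mul (by positivity),
              Real.inv_rpow hl0.le]
            congr 2
            field_simp
            ring
        _ ≤ _ := by rw [ENNReal.ofReal_mul (by positivity), ENNReal.ofReal_toReal hω0])
    (by
      rw [hsc hq]
      calc _ ≤ ENNReal.ofReal (l⁻¹ ^ q * (r ^ n * s)⁻¹) * (ENNReal.ofReal (c₀ * l ^ q) *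
            volume (parCyl y b r s)) := by
            gcongr
        _ = ENNReal.ofReal c₀ * ω := by
            rw [volume_parCyl _ _ hr, ← mul_assoc, ← mul_assoc,
              ← ENNReal.ofReal_mul (by positivity), ← ENNReal.ofReal_mul (by positivity),
              Real.inv_rpow hl0.le]
            congr 2
            field_simp
        _ ≤ _ := hc)
  rw [hsc hp0, mul_one, mul_one, volume_parCyl _ _ one_pos] at hfin
  refine absurd hbig (not_lt.2 ?_)
  calc ∫⁻ z in parCyl y b r s, ‖Du z‖ₑ ^ p
      = ENNReal.ofReal (l ^ p * (r ^ n * s)) * (ENNReal.ofReal (l⁻¹ ^ p * (r ^ n * s)⁻¹) *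
        ∫⁻ z in parCyl y b r s, ‖Du z‖ₑ ^ p) := by
        rw [← mul_assoc, ← ENNReal.ofReal_mul (by positivity), Real.inv_rpow hl0.le,
          show l ^ p * (r ^ n * s) * ((l ^ p)⁻¹ * (r ^ n * s)⁻¹) = 1 by field_simp,
          ENNReal.ofReal_one, one_mul]
    _ ≤ ENNReal.ofReal (l ^ p * (r ^ n * s)) * (ENNReal.ofReal (1 ^ n * 1) * ω) := by gcongr
    _ = _ := by
        rw [volume_parCyl _ _ hr, one_pow, mul_one, ENNReal.ofReal_one, one_mul,
          ENNReal.ofReal_mul (p := l ^ p) (by positivity), mul_assoc]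

/-- Admissible exponents for the reverse Hölder inequality. -/
theorem exists_reverseHolder_exponent {n : ℕ} {p : ℝ} (hp1 : 1 < p)
    (hp : 2 * (n : ℝ) / ((n : ℝ) + 2) < p) :
    ∃ q : ℝ, 1 ≤ q ∧ q < p ∧ p - 1 ≤ q ∧ max p 2 - q ≤ 1 ∧ n * max p 2 / (n + 2) ≤ q := by
  -- For p ≤ 2 this is the hypothesis p > 2n/(n+2); for p ≥ 2 it is automatic. The exponent q is
  -- then the largest of its lower bounds.
  have h : n * max p 2 / (n + 2) < p := by
    rcases le_total p 2 with h | h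
    · rwa [max_eq_right h, mul_comm]
    · rw [max_eq_left h, div_lt_iff₀ (by positivity)]
      nlinarith
  refine ⟨max (max 1 (p - 1)) (n * max p 2 / (n + 2)), ?_, ?_, ?_, ?_, le_max_right _ _⟩
  · exact (le_max_left _ _).trans (le_max_left _ _)
  · exact max_lt (max_lt hp1 (by linarith)) h
  · exact (le_max_right _ _).trans (le_max_left _ _)
  · have h1 : max 1 (p - 1) = max p 2 - 1 := by
      rcases le_total p 2 with h | h
      · rw [max_eq_right h, max_eq_left (by linarith)]; norm_num
      · rw [max_eq_left h, max_eq_right (by linarith)]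
    linarith [le_max_left (max 1 (p - 1)) (n * max p 2 / (n + 2))]

end

theorem lemma3p11 (n m : ℕ) (hn : 1 ≤ n) (p lam Lam : ℝ)
    (hp1 : 1 < p) (hp : 2 * (n : ℝ) / ((n : ℝ) + 2) < p)
    (hlam : 0 < lam) (hLam : 0 < Lam) :
    ∃ δ₀ : ℝ, 0 < δ₀ ∧ ∃ ε : ℝ, 0 < ε ∧ ∀ M : ℝ, ∃ C : ℝ,
      ∀ (A : RVec m → RGrad m n → RGrad m n), EllipticE p lam Lam A →
      ∀ (δ : ℝ), 0 ≤ δ → δ ≤ δ₀ →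
      ∀ (x₀ : RVec n) (t₀ R : ℝ), 0 < R → R ≤ 1 →
      ∀ (u : RVec n × ℝ → RVec m) (Du : RVec n × ℝ → RGrad m n),
        IsApproxWeakSol p δ A x₀ t₀ R (R ^ p) u Du →
        R ^ p * (⨍ z in parCyl x₀ t₀ R (R ^ p), ‖Du z‖ ^ p) ≤ M →
        (p < 2 →
          1 / R ^ p * (⨍ z in parCyl x₀ t₀ R (R ^ p),
            ‖u z - ⨍ w in parCyl x₀ t₀ R (R ^ p), u w‖ ^ 2) ≤ M) →
        IntegrableOn (fun z => ‖Du z‖ ^ (p + ε)) (parCyl x₀ t₀ (R / 2) (R ^ p / 2)) ∧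
        R ^ (p + ε) * (⨍ z in parCyl x₀ t₀ (R / 2) (R ^ p / 2), ‖Du z‖ ^ (p + ε)) ≤ C := by
  obtain ⟨q, hq1, hqp, hpq, hPq, hnq⟩ := exists_reverseHolder_exponent hp1 hp
  set ω : ℝ := (volume (Metric.ball (0 : RVec n) 1)).toReal with hω
  have hωtop : volume (Metric.ball (0 : RVec n) 1) ≠ ⊤ := measure_ball_lt_top.ne
  have hω0 : 0 < ω := ENNReal.toReal_pos (Metric.measure_ball_pos _ _ one_pos).ne' hωtop
  have hωe : volume (Metric.ball (0 : RVec n) 1) = ENNReal.ofReal ω :=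
    (ENNReal.ofReal_toReal hωtop).symm
  obtain ⟨c, hc, δ₀, hδ₀, hunit⟩ := exists_reverseHolder_unit (n := n) (m := m) (K := 10 ^ (n + 2) * ω)
    hn hp1 hlam hLam (le_max_left p 2) (le_max_right p 2) hq1 hqp hpq hPq hnq (by positivity)
  -- Turns the absolute smallness c at unit scale into a density; the cap at 1 is required by the
  -- level estimate.
  set c₀ : ℝ := min 1 (c / ω) with hc₀
  have hc₀0 : 0 < c₀ := by positivity
  have hc₀c : ENNReal.ofReal c₀ * volume (Metric.ball (0 : RVec n) 1) ≤ ENNReal.ofReal c := by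
    rw [hωe, ← ENNReal.ofReal_mul hc₀0.le]
    refine ENNReal.ofReal_le_ofReal ?_
    rw [← le_div_iff₀ hω0]
    exact min_le_right _ _
  obtain ⟨ε, hε, hhigh⟩ := IntrinsicRevHolder.higher_integrability n hq1 hqp hp hc₀0
    (min_le_left _ _)
  refine ⟨δ₀, hδ₀, ε, hε, fun M => ?_⟩
  obtain ⟨C, hC⟩ := hhigh (M * ω)
  -- The half cylinder has volume 2^{-(n+1)} R^{n+p} ω. The maximum with 0 is needed because C, met
  -- only inside `ENNReal.ofReal`, may be negative.
  refine ⟨2 ^ (n + 1) / ω * max C 0, ?_⟩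
  intro A hA δ hδ hδδ x₀ t₀ R hR _ u Du hsol hM _
  have hs : 0 < R ^ p := by positivity
  have hp0 : 0 < p := by linarith
  have hsol' : IsApproxWeakSol p δ A (x₀ + R • 0) (t₀ + R ^ p * 0) (R * 1) (R ^ p * 1) u Du := by
    simpa using hsol
  -- The given cylinder has time length R^p, so it becomes the unit cylinder without multiplying u,
  -- and the gradient is multiplied by R. This accounts for the powers of R in hypothesis and
  -- conclusion.
  have hres := hsol'.rescale hp1 hR hs one_pos (by rw [Real.one_rpow, mul_one])
  set Dv : RVec n × ℝ → RGrad m n := fun z => (R / 1) • Du (parHomeo x₀ t₀ hR.ne' hs.ne' z)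
    with hDv
  have hsc : ∀ {e : ℝ}, 0 ≤ e → ∀ a b, ∫⁻ z in parCyl 0 0 a b, ‖Dv z‖ₑ ^ e
      = ENNReal.ofReal (R ^ e * (R ^ n * R ^ p)⁻¹) * ∫⁻ z in parCyl x₀ t₀ (R * a) (R ^ p * b),
        ‖Du z‖ₑ ^ e := fun he a b => by
    rw [hDv, div_one]
    exact setLIntegral_enorm_smul_comp_parHomeo x₀ t₀ hR hs hR.le he Du a b
  have hm := hres.memVp.memLp_grad.1
  -- Gehring's lemma is stated for measurable functions on the whole space, so the norm of a
  -- measurable representative is used.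
  set g : RVec n × ℝ → NNReal := fun z => ‖hm.mk Dv z‖₊ with hg
  have hgD : ∀ᵐ z ∂volume.restrict (parCyl (0 : RVec n) 0 1 1), (g z : ENNReal) = ‖Dv z‖ₑ :=
    hm.ae_eq_mk.mono fun z hz => by rw [hz]; rfl
  have hRH := hres.intrinsicRevHolder hp1 (by linarith) hc₀0.le hc₀c hunit (hA.rescale hR one_pos)
    hδ hδδ hgD
  have hcongr : ∀ {S : Set (RVec n × ℝ)}, S ⊆ parCyl 0 0 1 1 → ∀ e : ℝ,
      ∫⁻ z in S, (g z : ENNReal) ^ e = ∫⁻ z in S, ‖Dv z‖ₑ ^ e := fun hS e =>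
    lintegral_congr_ae ((ae_restrict_of_ae_restrict_of_subset hS hgD).mono fun z hz => by
      simp only [hz])
  have hLfin : ∫⁻ z in parCyl x₀ t₀ R (R ^ p), ‖Du z‖ₑ ^ p ≠ ⊤ := by
    have := hsol.memVp.memLp_grad.2
    rw [eLpNorm_lt_top_iff_lintegral_rpow_enorm_lt_top (by simpa using hp0)
      ENNReal.ofReal_ne_top, ENNReal.toReal_ofReal hp0.le] at this
    exact this.ne
  have hvol : ∀ {a b : ℝ}, 0 < a → 0 < b →
      volume.real (parCyl x₀ t₀ a b) = a ^ n * b * ω := fun ha hb => by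
    rw [measureReal_def, volume_parCyl _ _ ha, ENNReal.toReal_mul,
      ENNReal.toReal_ofReal (by positivity)]
  have hgM : ∫⁻ z in parCyl 0 0 1 1, (g z : ENNReal) ^ p ≤ ENNReal.ofReal (M * ω) := by
    rw [hcongr subset_rfl, hsc hp0.le, mul_one, mul_one, ← ENNReal.ofReal_toReal hLfin,
      ← ENNReal.ofReal_mul (by positivity)]
    refine ENNReal.ofReal_le_ofReal ?_
    rw [setAverage_eq, hvol hR hs,
      integral_norm_rpow_eq_toReal hsol.memVp.memLp_grad.1 hp0.le, smul_eq_mul] at hM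
    calc _ = R ^ p * ((R ^ n * R ^ p * ω)⁻¹ *
          (∫⁻ z in parCyl x₀ t₀ R (R ^ p), ‖Du z‖ₑ ^ p).toReal) * ω := by field_simp
      _ ≤ M * ω := by gcongr
  have hfin := hC g hm.stronglyMeasurable_mk.measurable.nnnorm hRH hgM
  have hpε : 0 ≤ p + ε := by linarith
  rw [hcongr (parCyl_subset (by rw [dist_self]; norm_num) (by norm_num) le_rfl), hsc hpε,
    mul_one_div, mul_one_div] at hfin
  have hk : 0 < R ^ (p + ε) * (R ^ n * R ^ p)⁻¹ := by positivity
  have hL2 : ∫⁻ z in parCyl x₀ t₀ (R / 2) (R ^ p / 2), ‖Du z‖ₑ ^ (p + ε) ≠ ⊤ := fun h => by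
    rw [h, ENNReal.mul_top (by simpa using hk)] at hfin
    exact ENNReal.ofReal_ne_top (top_le_iff.1 hfin)
  have hDm : AEStronglyMeasurable Du (volume.restrict (parCyl x₀ t₀ (R / 2) (R ^ p / 2))) :=
    hsol.memVp.memLp_grad.1.mono_measure (Measure.restrict_mono
      (parCyl_subset (by rw [dist_self]; linarith) (by linarith) le_rfl) le_rfl)
  constructor
  · refine ⟨(hDm.norm.aemeasurable.pow_const _).aestronglyMeasurable, ?_⟩
    refine lt_of_le_of_lt (lintegral_mono fun z => ?_) hL2.lt_top
    rw [Real.enorm_of_nonneg (by positivity), ← ofReal_norm,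
      ENNReal.ofReal_rpow_of_nonneg (norm_nonneg _) hpε]
  · rw [setAverage_eq, hvol (by positivity) (by positivity), integral_norm_rpow_eq_toReal hDm hpε,
      smul_eq_mul]
    rw [← ENNReal.ofReal_toReal hL2, ← ENNReal.ofReal_mul hk.le] at hfin
    have hreal : R ^ (p + ε) * (R ^ n * R ^ p)⁻¹ *
        (∫⁻ z in parCyl x₀ t₀ (R / 2) (R ^ p / 2), ‖Du z‖ₑ ^ (p + ε)).toReal ≤ max C 0 := by
      rcases le_total 0 C with h | h
      · exact ((ENNReal.ofReal_le_ofReal_iff h).1 hfin).trans (le_max_left _ _)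
      · rw [ENNReal.ofReal_of_nonpos h, nonpos_iff_eq_zero, ENNReal.ofReal_eq_zero] at hfin
        exact hfin.trans (le_max_right _ _)
    calc _ = 2 ^ (n + 1) / ω * (R ^ (p + ε) * (R ^ n * R ^ p)⁻¹ *
          (∫⁻ z in parCyl x₀ t₀ (R / 2) (R ^ p / 2), ‖Du z‖ₑ ^ (p + ε)).toReal) := by
          rw [div_pow]
          field_simp
          try ring
      _ ≤ _ := by gcongr
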